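/- Fix $\hbar>0$ and $a>0$ with $\hbar a^2<4\pi$ (the ultraviolet-finite regime). Test densities are $f\,dt\,d\mathbf x$ with $f\in C_c^\infty(\mathbb R^2,\mathbb R)$ on two-dimensional Minkowski space with $x=(t,\mathbf x)$, $(x-y)^2=(t_x-t_y)^2-(\mathbf x_x-\mathbf x_y)^2$; write $\langle 1,f\rangle=\int f$, $\langle f,Kh\rangle=\int\!\!\int f(x)K(x,y)h(y)\,dx\,dy$, $$\Delta(x,y)=-\tfrac12\Theta(t_x-t_y-|\mathbf x_x-\mathbf x_y|)+\tfrac12\Theta(t_y-t_x-|\mathbf x_x-\mathbf x_y|),\qquad H(x,y)=-\tfrac1{4\pi}\ln|(x-y)^2|,$$ $$\Delta^F(x,y)=-\tfrac1{4\pi}\ln\bigl(-(x-y)^2+i\sigma 0\bigr),$$ where $\sigma\in\{1,-1\}$ is fixed ($\sigma=1$ is time ordering for the above $\Delta$; the result holds for both signs). *Representation.* Let $\psi$ be a test density with $\int\psi=1$, $P_\psi f=f-\psi\int f$, let $\mathcal H_0$ be the bosonic Fock space over $L^2(\mathbb R,dk)$ with vacuum $\Omega_0$, and for $\int h=0$ let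 $\varphi(h)=a^\dagger(u_h)+a(u_h)$ with $u_h(k)=\sqrt{\hbar/(4\pi|k|)}\int h(t,\mathbf x)e^{i(|k|t-k\mathbf x)}dt\,d\mathbf x$ (the massless field). On $L^2(\mathbb R)$ let $(p\xi)(k)=k\xi(k)$, $(q\xi)(k)=i\hbar\xi'(k)$. The Derezinski–Meissner representation on $\mathcal H=\mathcal H_0\otimes L^2(\mathbb R)$ is $$\pi_\psi(\Phi(f))=\varphi(P_\psi f)\otimes1+1\otimes q\langle1,f\rangle-1\otimes p\langle f,\Delta\psi\rangle ,$$ $$\pi_\psi(e^{i\Phi(f)})=e^{i\varphi(P_\psi f)}\otimes e^{i(q\langle1,f\rangle-p\langle f,\Delta\psi\rangle)}.$$ Let $D_\psi$ be the linear span of the vectors $\pi_\psi(e^{i\Phi(f)})\Omega_0\otimes\xi$, with $f$ a test density and $\xi\in L^2(\mathbb R)$. *S-matrix terms.* Put $\pi_\psi(:\!e^{i\Phi(h)}\!:)=e^{\frac\hbar2\langle h,Hh\rangle}\pi_\psi(e^{i\Phi(h)})$ for test densities $h$. Let $g$ be a test density. For $\alpha\in\{a,-a\}^n$ let $t_\alpha(x)=\exp\bigl(-\sum_{i<j}\alpha_i\alpha_j\hbar\,\Delta^F(x_i,x_j)\bigr)$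 and let $$\pi_\psi(\mathcal T_n(V_{\alpha_1}\otimes\cdots\otimes V_{\alpha_n})(g^{\otimes n}))=\int \pi_\psi\bigl(:\!e^{i\sum_j\alpha_j\Phi(x_j)}\!:\bigr)\,t_\alpha(x)\,g(x_1)\cdots g(x_n)\,dx$$ be the linear operator $T$ from $D_\psi$ to $\mathcal H$ such that $t_\alpha\,g^{\otimes n}$ is integrable and, for all $\Psi,\Psi'\in D_\psi$ and every test density $\rho$ with $\int\rho=1$, $\rho_\varepsilon(y)=\varepsilon^{-2}\rho(y/\varepsilon)$, $$\langle\Psi',T\Psi\rangle=\lim_{\varepsilon\downarrow0}\int\langle\Psi',\pi_\psi(:\!e^{i\Phi(\sum_j\alpha_j\rho_\varepsilon(\cdot-x_j))}\!:)\Psi\rangle\,t_\alpha(x)\,g(x_1)\cdots g(x_n)\,dx .$$ For $V(g)=\frac12(V_a(g)+V_{-a}(g))$ put $$\pi_\psi(S_n(V(g)))=\frac1{n!}\Bigl(\frac i\hbar\Bigr)^n\frac1{2^n}\sum_{k=0}^n\binom nk\,\pi_\psi\bigl(\mathcal T_n(V_a(g)^{\otimes k}\otimes V_{-a}(g)^{\otimes(n-k)})\bigr).$$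 *Proposition.* 1. For every $\psi$, $D_\psi$ is dense in $\mathcal H$ and the operators $\pi_\psi(S_n(V(g)))$, $n\ge0$, exist on $D_\psi$ and are unique. 2. For every $p$ with $1<p<\frac{4\pi}{\hbar a^2}$ there is a constant $C>0$ (depending only on $g$, $a$, $p$, $\hbar$ and $\sigma$) such that for every $\psi$, every $n\ge0$, every test density $f$ and every $\xi\in L^2(\mathbb R)$ with $\|\xi\|=1$ $$\bigl\|\pi_\psi(S_n(V(g)))\,\pi_\psi(e^{i\Phi(f)})\,\Omega_0\otimes\xi\bigr\|\le C^n\,(n!)^{\frac{1-p}p}.$$ 3. For every $\psi$ and every $\lambda\in\mathbb C$ the S-matrix series $\sum_n\lambda^n\pi_\psi(S_n(V(g)))$ converges strongly on $D_\psi$ to a linear operator $D_\psi\to\mathcal H$. -/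

import Mathlib

open MeasureTheory Filter Topology
open scoped NNReal Nat ContDiff Distributions TensorProduct

noncomputable section
namespace SineGordon

/-- The Hilbert space of square integrable complex wave functions on `ℝ`. -/
abbrev L2 : Type := Lp ℂ 2 (volume : Measure ℝ)

theorem measurePreserving_perm {m : ℕ} (s : Equiv.Perm (Fin m)) :
    MeasurePreserving (fun k : Fin m → ℝ => k ∘ s) volume volume := by
  have h := volume_measurePreserving_piCongrLeft (fun _ : Fin m => ℝ) s.symm
  convert h using 1
  funext k
  funext i
  simp [MeasurableEquiv.piCongrLeft, Equiv.piCongrLeft, Equiv.piCongrLeft']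

/-- Symmetric square integrable wave functions of `m` momenta. -/
def SymL2 (m : ℕ) : Submodule ℂ (Lp ℂ 2 (volume : Measure (Fin m → ℝ))) where
  carrier := {F | ∀ s : Equiv.Perm (Fin m),
    Lp.compMeasurePreserving (fun k : Fin m → ℝ => k ∘ s) (measurePreserving_perm s) F = F}
  add_mem' hF hG s := by rw [map_add, hF s, hG s]
  zero_mem' s := map_zero _
  smul_mem' c F hF s := by
    have := (Lp.compMeasurePreservingₗ ℂ (fun k : Fin m → ℝ => k ∘ s)
      (measurePreserving_perm s) (E := ℂ) (p := 2)).map_smul c F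
    exact this.trans (congrArg (c • ·) (hF s))

theorem isClosed_SymL2 (m : ℕ) :
    IsClosed (SymL2 m : Set (Lp ℂ 2 (volume : Measure (Fin m → ℝ)))) := by
  have : (SymL2 m : Set (Lp ℂ 2 (volume : Measure (Fin m → ℝ)))) = ⋂ s : Equiv.Perm (Fin m),
    {F | Lp.compMeasurePreserving (fun k : Fin m → ℝ => k ∘ s) (measurePreserving_perm s) F = F} := by
    ext F
    rw [Set.mem_iInter]
    exact Iff.rfl
  rw [this]
  exact isClosed_iInter fun s => isClosed_eq
    (Lp.isometry_compMeasurePreserving (measurePreserving_perm s)).continuous continuous_id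

instance (m : ℕ) : CompleteSpace (SymL2 m) := (isClosed_SymL2 m).completeSpace_coe

/-- The symmetric (bosonic) Fock space over the one particle space `L2`: the Hilbert sum of the spaces of
symmetric square integrable `m`-particle wave functions. -/
def Fock : Type := lp (fun m : ℕ => SymL2 m) 2

instance : NormedAddCommGroup Fock := inferInstanceAs (NormedAddCommGroup (lp (fun m : ℕ => SymL2 m) 2))
instance : InnerProductSpace ℂ Fock := inferInstanceAs (InnerProductSpace ℂ (lp (fun m : ℕ => SymL2 m) 2))
instance : CompleteSpace Fock := inferInstanceAs (CompleteSpace (lp (fun m : ℕ => SymL2 m) 2))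

/-- The `m`-particle component of a Fock space vector. -/
def Fock.component (F : Fock) (m : ℕ) : SymL2 m :=
  let G : lp (fun m : ℕ => SymL2 m) 2 := F
  G m

theorem Fock.ext {F G : Fock} (h : ∀ m, F.component m = G.component m) : F = G :=
  lp.ext (funext h)

theorem Fock.hasSum_inner (F G : Fock) :
    HasSum (fun m => inner ℂ (F.component m) (G.component m)) (inner ℂ F G) :=
  lp.hasSum_inner (𝕜 := ℂ) (G := fun m : ℕ => SymL2 m) F G

theorem memLp_prod {m : ℕ} (u : Fin m → L2) :
    MemLp (fun k : Fin m → ℝ => ∏ i, u i (k i)) 2 volume := by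
  have hm : AEStronglyMeasurable (fun k : Fin m → ℝ => ∏ i, u i (k i)) volume := by
    refine Finset.aestronglyMeasurable_fun_prod _ fun i _ => ?_
    exact (Lp.aestronglyMeasurable (u i)).comp_quasiMeasurePreserving
      (Measure.quasiMeasurePreserving_eval (fun _ : Fin m => (volume : Measure ℝ)) i)
  rw [memLp_two_iff_integrable_sq_norm hm]
  simp only [norm_prod, ← Finset.prod_pow]
  exact Integrable.fintype_prod (f := fun (i : Fin m) (x : ℝ) => ‖u i x‖ ^ 2)
    fun i => (memLp_two_iff_integrable_sq_norm (Lp.aestronglyMeasurable (u i))).1 (Lp.memLp (u i))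

theorem ae_eval {m : ℕ} (i : Fin m) {P : ℝ → Prop} (h : ∀ᵐ x, P x) :
    ∀ᵐ k : Fin m → ℝ, P (k i) :=
  (Measure.quasiMeasurePreserving_eval (fun _ : Fin m => (volume : Measure ℝ)) i).ae h

theorem inner_toLp_prod {m : ℕ} (u v : Fin m → L2) :
    inner ℂ ((memLp_prod u).toLp _) ((memLp_prod v).toLp _) = ∏ i, (inner ℂ (u i) (v i) : ℂ) := by
  simp only [L2.inner_def]
  rw [← integral_fintype_prod_volume_eq_prod
    (fun (i : Fin m) (x : ℝ) => (inner ℂ (u i x) (v i x) : ℂ))]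
  refine integral_congr_ae ?_
  filter_upwards [(memLp_prod u).coeFn_toLp, (memLp_prod v).coeFn_toLp] with k h1 h2
  simp only [h1, h2, RCLike.inner_apply, map_prod, Finset.prod_mul_distrib]

theorem norm_toLp_prod {m : ℕ} (u : Fin m → L2) :
    ‖(memLp_prod u).toLp _‖ = ∏ i, ‖u i‖ := by
  have h1 := inner_toLp_prod u u
  simp only [inner_self_eq_norm_sq_to_K, Finset.prod_pow] at h1
  have h' : ‖(memLp_prod u).toLp _‖ ^ 2 = (∏ i, ‖u i‖) ^ 2 := by exact_mod_cast h1
  exact (sq_eq_sq₀ (norm_nonneg _) (by positivity)).1 h'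

/-- The elementary tensor `u₁ ⊗ ⋯ ⊗ uₘ`. -/
def tensor (m : ℕ) : L2 [×m]→L[ℂ] (Lp ℂ 2 (volume : Measure (Fin m → ℝ))) :=
  MultilinearMap.mkContinuous
    { toFun := fun u => (memLp_prod u).toLp _
      map_update_add' := by
        intro inst u i x y
        rw [← MemLp.toLp_add]
        refine (MemLp.toLp_eq_toLp_iff _ _).2 ?_
        filter_upwards [ae_eval i (Lp.coeFn_add x y)] with k hk
        simp only [Pi.add_apply] at hk ⊢
        rw [← Finset.mul_prod_erase _ _ (Finset.mem_univ i), ← Finset.mul_prod_erase _ _ (Finset.mem_univ i),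
          ← Finset.mul_prod_erase _ _ (Finset.mem_univ i)]
        simp only [Function.update_self]
        rw [hk, add_mul]
        congr 1 <;> congr 1 <;> refine Finset.prod_congr rfl fun j hj => ?_ <;>
          simp [Function.update_of_ne (Finset.ne_of_mem_erase hj)]
      map_update_smul' := by
        intro inst u i c x
        rw [← MemLp.toLp_const_smul]
        refine (MemLp.toLp_eq_toLp_iff _ _).2 ?_
        filter_upwards [ae_eval i (Lp.coeFn_smul c x)] with k hk
        simp only [Pi.smul_apply, smul_eq_mul] at hk ⊢
        rw [← Finset.mul_prod_erase _ _ (Finset.mem_univ i), ← Finset.mul_prod_erase _ _ (Finset.mem_univ i)]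
        simp only [Function.update_self]
        rw [hk, mul_assoc]
        congr 2; refine Finset.prod_congr rfl fun j hj => ?_
        simp [Function.update_of_ne (Finset.ne_of_mem_erase hj)] } 1
    fun u => by rw [one_mul]; exact (norm_toLp_prod u).le

/-- The `m`-fold tensor power `u ⊗ ⋯ ⊗ u`. -/
def tensorPow (u : L2) (m : ℕ) : SymL2 m :=
  ⟨tensor m fun _ => u, fun s => by
    change Lp.compMeasurePreserving _ _ ((memLp_prod fun _ => u).toLp _) = (memLp_prod fun _ => u).toLp _
    rw [Lp.toLp_compMeasurePreserving]
    congr 1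
    funext k
    exact Equiv.prod_comp s (fun i => u (k i))⟩

theorem inner_tensorPow (u v : L2) (m : ℕ) :
    inner ℂ (tensorPow u m) (tensorPow v m) = (inner ℂ u v : ℂ) ^ m := by
  have h := inner_toLp_prod (fun _ : Fin m => u) (fun _ => v)
  rw [Finset.prod_const, Finset.card_univ, Fintype.card_fin] at h
  exact h

theorem norm_tensorPow (u : L2) (m : ℕ) : ‖tensorPow u m‖ = ‖u‖ ^ m := by
  have h := norm_toLp_prod (fun _ : Fin m => u)
  rw [Finset.prod_const, Finset.card_univ, Fintype.card_fin] at h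
  exact h

theorem memℓp_expVec (u : L2) :
    Memℓp (fun m : ℕ => ((Real.sqrt (m ! : ℝ) : ℝ) : ℂ)⁻¹ • tensorPow u m) 2 := by
  refine memℓp_gen ?_
  have h := Real.summable_pow_div_factorial (‖u‖ ^ 2)
  refine h.congr fun m => ?_
  have hm : (0 : ℝ) < (m ! : ℝ) := by positivity
  rw [norm_smul, norm_inv, Complex.norm_real, norm_tensorPow]
  simp only [ENNReal.toReal_ofNat, Real.rpow_two, Real.norm_eq_abs, mul_pow, inv_pow, sq_abs,
    Real.sq_sqrt hm.le]
  rw [div_eq_inv_mul]; ring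

/-- The exponential vector `⊕ₘ u^{⊗ m} / √(m!)`. -/
def expVec (u : L2) : Fock := (⟨_, memℓp_expVec u⟩ : lp (fun m : ℕ => SymL2 m) 2)

theorem inner_expVec (u v : L2) : inner ℂ (expVec u) (expVec v) = Complex.exp (inner ℂ u v) := by
  rw [← (Fock.hasSum_inner _ _).tsum_eq, Complex.exp_eq_exp_ℂ, NormedSpace.exp_eq_tsum_div]
  refine tsum_congr fun m => ?_
  change inner ℂ (((Real.sqrt (m ! : ℝ) : ℝ) : ℂ)⁻¹ • tensorPow u m)
    (((Real.sqrt (m ! : ℝ) : ℝ) : ℂ)⁻¹ • tensorPow v m) = _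
  refine (inner_smul_left (𝕜 := ℂ) (tensorPow u m) _ _).trans ?_
  refine (congrArg _ (inner_smul_right (𝕜 := ℂ) (tensorPow u m) (tensorPow v m) _)).trans ?_
  rw [inner_tensorPow]
  have hm : (0 : ℝ) ≤ (m ! : ℝ) := by positivity
  have h2 : (((Real.sqrt (m ! : ℝ) : ℝ) : ℂ)) * ((Real.sqrt (m ! : ℝ) : ℝ) : ℂ) = (m ! : ℂ) := by
    exact_mod_cast Real.mul_self_sqrt hm
  rw [map_inv₀, Complex.conj_ofReal, ← mul_assoc, ← mul_inv, h2, div_eq_inv_mul]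

theorem eq_zero_of_tensor {m : ℕ} (F : Lp ℂ 2 (volume : Measure (Fin m → ℝ)))
    (h : ∀ u, inner ℂ (tensor m u) F = 0) : F = 0 := by
  classical
  rw [Lp.eq_zero_iff_ae_eq_zero]
  let B : ℕ → Set (Fin m → ℝ) := fun N => Set.univ.pi fun _ => Set.Icc (-(N : ℝ)) N
  have hBm (N) : MeasurableSet (B N) := MeasurableSet.univ_pi fun _ => measurableSet_Icc
  have hBf (N) : volume (B N) < ⊤ := by
    rw [volume_pi_pi]
    exact ENNReal.prod_lt_top fun i _ => by simp
  have hI (N) : IntegrableOn F (B N) := by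
    have := (Lp.memLp F).restrict (B N)
    have hfin : IsFiniteMeasure (volume.restrict (B N)) := ⟨by simpa using hBf N⟩
    exact this.integrable (by norm_num)
  have key (N) : ∀ s, MeasurableSet s → ∫ x in s ∩ B N, F x = 0 := by
    have gen (s : Fin m → Set ℝ) (hs : ∀ i, MeasurableSet (s i)) :
        ∫ x in Set.univ.pi s ∩ B N, F x = 0 := by
      have hf (i) : volume (s i ∩ Set.Icc (-(N : ℝ)) N) ≠ ⊤ :=
        ((measure_mono Set.inter_subset_right).trans_lt (by simp)).ne
      have hms (i) := (hs i).inter (measurableSet_Icc (a := -(N : ℝ)) (b := N))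
      have h1 := h fun i => indicatorConstLp 2 (hms i) (hf i) (1 : ℂ)
      rw [L2.inner_def] at h1
      rw [← h1, ← Set.pi_inter_distrib, ← integral_indicator (MeasurableSet.univ_pi hms)]
      refine integral_congr_ae ?_
      filter_upwards [(memLp_prod fun i => indicatorConstLp 2 (hms i) (hf i) (1 : ℂ)).coeFn_toLp,
        ae_all_iff.2 fun i => ae_eval i (indicatorConstLp_coeFn (p := 2) (hs := hms i) (hμs := hf i) (c := (1 : ℂ)))]
        with k h1 h2
      simp only [tensor, MultilinearMap.coe_mkContinuous, MultilinearMap.coe_mk, h1, h2]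
      by_cases hk : k ∈ Set.univ.pi fun i => s i ∩ Set.Icc (-(N : ℝ)) N
      · rw [Set.indicator_of_mem hk]
        have : ∀ i, k i ∈ s i ∩ Set.Icc (-(N : ℝ)) N := fun i => hk i trivial
        simp only [Set.indicator_of_mem (this _)]
        simp
      · rw [Set.indicator_of_notMem hk]
        simp only [Set.mem_pi, not_forall] at hk
        obtain ⟨i, -, hi⟩ := hk
        rw [Finset.prod_eq_zero (Finset.mem_univ i) (Set.indicator_of_notMem hi _)]
        simp
    intro s hs
    refine MeasurableSpace.induction_on_inter (C := fun s _ => ∫ x in s ∩ B N, F x = 0)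
      generateFrom_pi.symm isPiSystem_pi ?_ ?_ ?_ ?_ s hs
    · simp
    · intro t ht
      obtain ⟨s, hs, rfl⟩ := ht
      exact gen s fun i => hs i trivial
    · intro t ht ih
      have h0 : ∫ x in B N, F x = 0 := by
        have := gen (fun _ => Set.univ) fun _ => MeasurableSet.univ
        rwa [Set.pi_univ, Set.univ_inter] at this
      have h2 := integral_inter_add_sdiff (μ := volume) (f := F) ht (hI N)
      rw [Set.inter_comm, ih, zero_add, h0] at h2
      rwa [Set.sdiff_eq, Set.inter_comm] at h2
    · intro f hd hm ih
      rw [Set.iUnion_inter, integral_iUnion (fun i => (hm i).inter (hBm N))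
        (fun i j hij => (hd hij).mono Set.inter_subset_left Set.inter_subset_left)
        ((hI N).mono_set (Set.iUnion_subset fun i => Set.inter_subset_right))]
      simp [ih]
  have hz (N) : F =ᵐ[volume.restrict (B N)] 0 :=
    (hI N).ae_eq_zero_of_forall_setIntegral_eq_zero fun s hs _ => by
      rw [Measure.restrict_restrict hs]; exact key N s hs
  have hU : (⋃ N, B N) = Set.univ := by
    refine Set.eq_univ_of_forall fun k => ?_
    obtain ⟨N, hN⟩ := exists_nat_ge (‖k‖)
    refine Set.mem_iUnion.2 ⟨N, fun i _ => ?_⟩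
    exact abs_le.1 ((norm_le_pi_norm k i).trans hN)
  have := ae_restrict_iUnion_iff B (fun x => F x = (0 : (Fin m → ℝ) → ℂ) x) |>.2 hz
  rwa [hU, Measure.restrict_univ] at this

theorem eq_zero_of_tensorPow {m : ℕ} (F : SymL2 m) (h : ∀ u, inner ℂ (tensorPow u m) F = 0) :
    F = 0 := by
  refine Subtype.ext (eq_zero_of_tensor _ fun u => ?_)
  let f : L2 [×m]→L[ℂ] ℂ := (innerSL ℂ (F : Lp ℂ 2 (volume : Measure (Fin m → ℝ)))).compContinuousMultilinearMap
    (tensor m)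
  have h1 := f.iteratedFDeriv_comp_diagonal 0 u
  have h0 : (fun x => f fun _ => x) = fun _ => 0 := by
    funext x
    have hx : inner ℂ (tensor m fun _ => x) (F : Lp ℂ 2 (volume : Measure (Fin m → ℝ))) = 0 := h x
    rw [← inner_conj_symm, map_eq_zero] at hx
    exact hx
  have hs (s : Equiv.Perm (Fin m)) : f (fun i => u (s i)) = f u := by
    have hF := F.2 s⁻¹
    change inner ℂ (F : Lp ℂ 2 (volume : Measure (Fin m → ℝ))) (tensor m fun i => u (s i))
      = inner ℂ (F : Lp ℂ 2 (volume : Measure (Fin m → ℝ))) (tensor m u)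
    rw [← (Lp.compMeasurePreservingₗᵢ ℂ (fun k : Fin m → ℝ => k ∘ s) (measurePreserving_perm s)).inner_map_map
      _ (tensor m fun i => u (s i))]
    congr 1
    · exact F.2 s
    · change Lp.compMeasurePreserving _ (measurePreserving_perm s) ((memLp_prod _).toLp _) = (memLp_prod _).toLp _
      rw [Lp.toLp_compMeasurePreserving]
      congr 1
      funext k
      exact Equiv.prod_comp s (fun i => u i (k i))
  rw [h0] at h1
  simp only [hs, Finset.sum_const, Finset.card_univ, Fintype.card_perm, Fintype.card_fin] at h1
  have h2 : iteratedFDeriv ℂ m (fun _ : L2 => (0 : ℂ)) 0 = 0 := by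
    simp
  rw [h2] at h1
  have h3 : f u = 0 := by
    simpa [Nat.factorial_ne_zero] using h1.symm
  rw [← inner_conj_symm, map_eq_zero]
  exact h3

theorem tensorPow_smul (c : ℂ) (u : L2) (m : ℕ) : tensorPow (c • u) m = c ^ m • tensorPow u m := by
  have h := (tensor m).map_smul_univ (fun _ => c) (fun _ => u)
  simp only [Finset.prod_const, Finset.card_univ, Fintype.card_fin] at h
  exact Subtype.ext h

/-- Exponential vectors are total in the Fock space. -/
theorem denseRange_expVec : DenseRange (Finsupp.linearCombination ℂ expVec) := by
  have : (LinearMap.range (Finsupp.linearCombination ℂ expVec)).topologicalClosure = ⊤ := by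
    rw [Submodule.topologicalClosure_eq_top_iff, Submodule.eq_bot_iff]
    intro F hF
    have h0 (u : L2) : inner ℂ (expVec u) F = 0 :=
      (Submodule.mem_orthogonal _ _).1 hF _ ⟨Finsupp.single u 1, by simp⟩
    refine Fock.ext fun m => (eq_zero_of_tensorPow (F.component m) fun u => ?_).trans rfl
    let c : ℕ → ℂ := fun m => inner ℂ ((expVec u).component m) (F.component m)
    have hsum (t : ℝ) : HasSum (fun m => (t : ℂ) ^ m * c m) 0 := by
      have h1 := Fock.hasSum_inner (expVec ((t : ℂ) • u)) F
      rw [h0] at h1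
      have hc : (fun m => (t : ℂ) ^ m * c m) =
          fun m => inner ℂ ((expVec ((t : ℂ) • u)).component m) (F.component m) := by
       funext m
       change _ = inner ℂ (((Real.sqrt (m ! : ℝ) : ℝ) : ℂ)⁻¹ • tensorPow ((t : ℂ) • u) m) (F.component m)
       rw [tensorPow_smul, smul_comm]
       refine Eq.trans ?_ (inner_smul_left (𝕜 := ℂ) _ (F.component m) _).symm
       simp only [map_pow, Complex.conj_ofReal]
       rfl
      rw [hc]
      exact h1
    let p : FormalMultilinearSeries ℝ ℝ ℂ := fun n => ContinuousMultilinearMap.mkPiRing ℝ (Fin n) (c n)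
    have hr : 1 ≤ p.radius := by
      have hs : Summable fun n => ‖p n‖ * ((1 : ℝ≥0) : ℝ) ^ n := by
        simpa [p] using (hsum 1).summable.norm
      simpa using p.le_radius_of_summable_norm hs
    have hp := p.hasFPowerSeriesOnBall (zero_lt_one.trans_le hr)
    have hp0 : p.sum = 0 := by
      funext t
      have := (hsum t).tsum_eq
      simpa [FormalMultilinearSeries.sum, p] using this
    rw [hp0] at hp
    have h1 := congrArg (fun q => q m fun _ => 1) hp.hasFPowerSeriesAt.eq_zero
    have h2 : c m = 0 := by simpa [p] using h1
    have h3 : c m = (starRingEnd ℂ (((Real.sqrt (m ! : ℝ) : ℝ) : ℂ)⁻¹)) * inner ℂ (tensorPow u m) (F.component m) :=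
      inner_smul_left (𝕜 := ℂ) (tensorPow u m) (F.component m) _
    rw [h2] at h3
    have hne : (starRingEnd ℂ (((Real.sqrt (m ! : ℝ) : ℝ) : ℂ)⁻¹)) ≠ 0 := by
      simp [Nat.factorial_ne_zero]
    exact (mul_eq_zero.1 h3.symm).resolve_left hne
  have h2 := Submodule.dense_iff_topologicalClosure_eq_top.2 this
  exact h2

/-- Action of the displacement operator `exp(a†(w) - a(w))` on combinations of exponential vectors:
`e(v) ↦ exp(-‖w‖²/2 - ⟪w, v⟫) e(v + w)`. -/
def weylPre (w : L2) : (L2 →₀ ℂ) →ₗ[ℂ] Fock :=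
  Finsupp.linearCombination ℂ fun v =>
    Complex.exp (-((‖w‖ : ℂ) ^ 2 / 2) - inner ℂ w v) • expVec (v + w)

theorem norm_weylPre (w : L2) (x : L2 →₀ ℂ) :
    ‖weylPre w x‖ = ‖Finsupp.linearCombination ℂ expVec x‖ := by
  have h : inner ℂ (weylPre w x) (weylPre w x) =
      inner ℂ (Finsupp.linearCombination ℂ expVec x) (Finsupp.linearCombination ℂ expVec x) := by
    simp only [weylPre, Finsupp.linearCombination_apply, Finsupp.sum, sum_inner, inner_sum,
      inner_smul_left, inner_smul_right, inner_expVec]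
    have key (u v : L2) : Complex.exp (-((‖w‖ : ℂ) ^ 2 / 2) - inner ℂ w u) *
        ((starRingEnd ℂ) (Complex.exp (-((‖w‖ : ℂ) ^ 2 / 2) - inner ℂ w v)) *
          Complex.exp (inner ℂ (v + w) (u + w))) = Complex.exp (inner ℂ v u) := by
      rw [← Complex.exp_conj, ← Complex.exp_add, ← Complex.exp_add]
      congr 1
      simp only [map_sub, map_neg, map_div₀, map_pow, Complex.conj_ofReal, inner_conj_symm,
        inner_add_left, inner_add_right, inner_self_eq_norm_sq_to_K, map_ofNat]
      simp only [Complex.coe_algebraMap]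
      ring
    simp only [Finset.mul_sum]
    refine Finset.sum_congr rfl fun u _ => Finset.sum_congr rfl fun v _ => ?_
    rw [← key u v]
    ring
  rw [inner_self_eq_norm_sq_to_K, inner_self_eq_norm_sq_to_K] at h
  have h' : ‖weylPre w x‖ ^ 2 = ‖Finsupp.linearCombination ℂ expVec x‖ ^ 2 := by exact_mod_cast h
  exact (sq_eq_sq₀ (norm_nonneg _) (norm_nonneg _)).1 h'

/-- The displacement operator `exp(a†(w) - a(w))` on the Fock space. -/
def displacement (w : L2) : Fock →L[ℂ] Fock :=
  (weylPre w).extendOfNorm (Finsupp.linearCombination ℂ expVec)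

theorem displacement_expVec (w v : L2) : displacement w (expVec v) =
    Complex.exp (-((‖w‖ : ℂ) ^ 2 / 2) - inner ℂ w v) • expVec (v + w) := by
  have h := LinearMap.extendOfNorm_eq (f := weylPre w) denseRange_expVec
    ⟨1, fun x => by rw [one_mul]; exact (norm_weylPre w x).le⟩ (Finsupp.single v 1)
  simpa [displacement, weylPre] using h

/-- Points `(t, x)` of two dimensional Minkowski space. -/
abbrev Minkowski : Type := ℝ × ℝ

/-- Real test functions on Minkowski space; they stand for test densities via `f ↦ f dt dx`. -/
abbrev TestDensity : Type := 𝓓((⊤ : TopologicalSpace.Opens Minkowski), ℝ)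

/-- The restriction to the positive light cone `{(|k|, k)}` of the Fourier transform. -/
def lightConeTransform (f : TestDensity) (k : ℝ) : ℂ :=
  ∫ x : Minkowski, (f x : ℂ) * Complex.exp (Complex.I * ((|k| * x.1 - k * x.2 : ℝ) : ℂ))

/-- The one particle wave function `√(ħ / (4π|k|)) f̂(|k|, k)`. -/
def oneParticleFun (ħ : ℝ) (f : TestDensity) (k : ℝ) : ℂ :=
  (Real.sqrt (ħ / (4 * Real.pi * |k|)) : ℂ) * lightConeTransform f k

theorem integrable_testDensity (f : TestDensity) : Integrable (fun x => (f x : ℂ)) := by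
  have := f.continuous.integrable_of_hasCompactSupport f.hasCompactSupport (μ := volume)
  exact this.ofReal

theorem continuous_lightConeTransform (f : TestDensity) : Continuous (lightConeTransform f) := by
  refine continuous_of_dominated (bound := fun x => ‖(f x : ℂ)‖) (fun k => ?_) (fun k => ?_)
    (integrable_testDensity f).norm ?_
  · have := f.continuous
    exact Continuous.aestronglyMeasurable (by fun_prop)
  · refine Eventually.of_forall fun x => ?_
    rw [norm_mul, mul_comm Complex.I, Complex.norm_exp_ofReal_mul_I, mul_one]
  · exact Eventually.of_forall fun x => by fun_prop

theorem norm_lightConeTransform_le (f : TestDensity) (hf : ∫ x, f x = 0) :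
    ∃ C : ℝ, ∀ k, ‖lightConeTransform f k‖ ≤ C * |k| := by
  have hc : Continuous fun x : Minkowski => ‖(f x : ℂ)‖ * (|x.1| + |x.2|) := by
    have := f.continuous
    fun_prop
  have hi : Integrable fun x : Minkowski => ‖(f x : ℂ)‖ * (|x.1| + |x.2|) := by
    refine hc.integrable_of_hasCompactSupport (f.hasCompactSupport.mono ?_)
    intro x hx hfx
    exact hx (by simp [hfx])
  refine ⟨∫ x : Minkowski, ‖(f x : ℂ)‖ * (|x.1| + |x.2|), fun k => ?_⟩
  have h0 : ∫ x : Minkowski, (f x : ℂ) = 0 := by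
    rw [integral_complex_ofReal, hf, Complex.ofReal_zero]
  have h1 : lightConeTransform f k = ∫ x : Minkowski, (f x : ℂ) *
      (Complex.exp (Complex.I * ((|k| * x.1 - k * x.2 : ℝ) : ℂ)) - 1) := by
    simp only [mul_sub, mul_one]
    rw [integral_sub _ (integrable_testDensity f), h0, sub_zero, lightConeTransform]
    refine (integrable_testDensity f).mono ?_ (Eventually.of_forall fun x => ?_)
    · have := f.continuous
      exact Continuous.aestronglyMeasurable (by fun_prop)
    · rw [norm_mul, mul_comm Complex.I, Complex.norm_exp_ofReal_mul_I, mul_one]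
  rw [h1, ← integral_mul_const]
  refine norm_integral_le_of_norm_le (hi.mul_const _) (Eventually.of_forall fun x => ?_)
  rw [norm_mul, mul_assoc]
  refine mul_le_mul_of_nonneg_left ?_ (norm_nonneg _)
  refine (Real.norm_exp_I_mul_ofReal_sub_one_le).trans ?_
  rw [Real.norm_eq_abs]
  calc |(|k| * x.1 - k * x.2)| ≤ |(|k| * x.1)| + |k * x.2| := abs_sub _ _
    _ = (|x.1| + |x.2|) * |k| := by rw [abs_mul, abs_mul, abs_abs]; ring

theorem norm_lightConeTransform_mul_le (f : TestDensity) :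
    ∃ C : ℝ, ∀ k, ‖lightConeTransform f k‖ * |k| ≤ C := by
  let D : Minkowski → ℂ := fun x => (fderiv ℝ f x (0, 1) : ℂ)
  have hD : Continuous D :=
    Complex.continuous_ofReal.comp ((f.contDiff.continuous_fderiv (by simp)).clm_apply continuous_const)
  have hDs : HasCompactSupport D := by
    refine (f.hasCompactSupport.fderiv (𝕜 := ℝ)).mono ?_
    intro x hx h
    exact hx (by simp [D, h])
  have hDi : Integrable D := hD.integrable_of_hasCompactSupport hDs
  refine ⟨∫ x, ‖D x‖, fun k => ?_⟩
  let e : Minkowski → ℂ := fun x => Complex.exp (Complex.I * ((|k| * x.1 - k * x.2 : ℝ) : ℂ))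
  have hen (x) : ‖e x‖ = 1 := by
    simp only [e]; rw [mul_comm Complex.I, Complex.norm_exp_ofReal_mul_I]
  have hec : Continuous e := by fun_prop
  have he (x : Minkowski) : HasLineDerivAt ℝ e (e x * (Complex.I * (-k : ℝ))) x (0, 1) := by
    have h1 : HasDerivAt (fun s : ℝ => (|k| * x.1 - k * (x.2 + s) : ℝ)) (-k) 0 := by
      have := (((hasDerivAt_id (0 : ℝ)).const_add x.2).const_mul k).const_sub (|k| * x.1)
      simpa using this
    have h2 := (h1.ofReal_comp.const_mul Complex.I).cexp
    have h3 : (fun s : ℝ => e (x + s • (0, 1))) = fun s : ℝ =>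
        Complex.exp (Complex.I * ((|k| * x.1 - k * (x.2 + s) : ℝ) : ℂ)) := by
      funext s
      simp [e]
    rw [HasLineDerivAt, h3]
    simpa [e] using h2
  have hfd (x : Minkowski) : HasLineDerivAt ℝ (fun x => (f x : ℂ)) (D x) x (0, 1) := by
    have h1 := (f.contDiff.differentiable (by simp) x).hasFDerivAt.hasLineDerivAt (0, 1)
    exact HasDerivAt.ofReal_comp h1
  have hb {h : Minkowski → ℂ} (hh : Integrable h) : Integrable fun x => h x * e x :=
    hh.mul_bdd hec.aestronglyMeasurable (Eventually.of_forall fun x => (hen x).le)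
  have hparts := integral_bilinear_hasLineDerivAt_right_eq_neg_left_of_integrable (μ := volume)
    (B := ContinuousLinearMap.mul ℝ ℂ) (f := fun x => (f x : ℂ)) (f' := D) (g := e)
    (g' := fun x => e x * (Complex.I * (-k : ℝ))) (v := (0, 1))
    (hb hDi) (by simpa [mul_assoc] using (hb (integrable_testDensity f)).mul_const (Complex.I * (-k : ℝ)))
    (hb (integrable_testDensity f)) (fun x _ => hfd x) (fun x _ => he x)
  simp only [ContinuousLinearMap.mul_apply'] at hparts
  have h1 : lightConeTransform f k * (Complex.I * (-k : ℝ)) = - ∫ x, D x * e x := by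
    rw [← hparts, lightConeTransform, ← integral_mul_const]
    exact integral_congr_ae (Eventually.of_forall fun x => mul_assoc _ _ _)
  have h2 := congrArg norm h1
  rw [norm_mul, norm_mul, Complex.norm_I, one_mul, Complex.norm_real, norm_neg, norm_neg,
    Real.norm_eq_abs] at h2
  rw [h2]
  refine norm_integral_le_of_norm_le hDi.norm (Eventually.of_forall fun x => ?_)
  rw [norm_mul, hen, mul_one]

theorem memLp_oneParticleFun (ħ : ℝ) (f : TestDensity) (hf : ∫ x, f x = 0) :
    MemLp (oneParticleFun ħ f) 2 volume := by
  have hm : AEStronglyMeasurable (oneParticleFun ħ f) volume := by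
    have h1 := (continuous_lightConeTransform f).measurable
    exact Measurable.aestronglyMeasurable (by unfold oneParticleFun; fun_prop)
  obtain ⟨A, hA⟩ := norm_lightConeTransform_le f hf
  obtain ⟨B, hB⟩ := norm_lightConeTransform_mul_le f
  rw [memLp_two_iff_integrable_sq_norm hm]
  refine (integrable_inv_one_add_sq.const_mul (2 * (|ħ| / (4 * Real.pi)) * (A ^ 2 + B ^ 2))).mono'
    (hm.norm.pow 2) (Eventually.of_forall fun k => ?_)
  rw [Real.norm_eq_abs, abs_of_nonneg (by positivity), oneParticleFun, norm_mul, mul_pow,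
    Complex.norm_real, Real.norm_eq_abs, sq_abs]
  have hs : Real.sqrt (ħ / (4 * Real.pi * |k|)) ^ 2 ≤ |ħ| / (4 * Real.pi) / |k| := by
    rw [div_div]
    have h0 : 0 ≤ |ħ| / (4 * Real.pi * |k|) := by positivity
    calc _ ≤ Real.sqrt (|ħ| / (4 * Real.pi * |k|)) ^ 2 := by
          gcongr
          exact le_abs_self ħ
      _ = _ := Real.sq_sqrt h0
  have hc : 0 ≤ |ħ| / (4 * Real.pi) := by positivity
  refine (mul_le_mul_of_nonneg_right hs (by positivity)).trans ?_
  rw [show 2 * (|ħ| / (4 * Real.pi)) * (A ^ 2 + B ^ 2) * (1 + k ^ 2)⁻¹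
    = |ħ| / (4 * Real.pi) * (2 * (A ^ 2 + B ^ 2) / (1 + k ^ 2)) by ring, div_mul_eq_mul_div,
    mul_div_assoc]
  refine mul_le_mul_of_nonneg_left ?_ hc
  rcases eq_or_ne k 0 with rfl | hk
  · simp; positivity
  have hk' : 0 < |k| := abs_pos.2 hk
  set L := ‖lightConeTransform f k‖ with hL
  have hL0 : 0 ≤ L := norm_nonneg _
  have h1 : L ^ 2 ≤ A ^ 2 * k ^ 2 := by
    have := pow_le_pow_left₀ hL0 (hA k) 2
    rwa [mul_pow, sq_abs] at this
  have h2 : L ^ 2 * k ^ 2 ≤ B ^ 2 := by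
    have := pow_le_pow_left₀ (by positivity) (hB k) 2
    rwa [mul_pow, sq_abs] at this
  rw [div_le_div_iff₀ hk' (by positivity)]
  rcases le_total |k| 1 with h | h
  · have hk2 : k ^ 2 ≤ 1 := by rw [← sq_abs]; exact pow_le_one₀ hk'.le h
    have hkk : k ^ 2 ≤ |k| := by rw [← sq_abs, sq]; nlinarith
    calc L ^ 2 * (1 + k ^ 2) ≤ A ^ 2 * k ^ 2 * 2 := by
          apply mul_le_mul h1 (by linarith) (by positivity) (by positivity)
      _ ≤ A ^ 2 * |k| * 2 := by gcongr
      _ ≤ _ := by nlinarith [sq_nonneg B, mul_nonneg (sq_nonneg B) hk'.le]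
  · have hk2 : 1 ≤ k ^ 2 := by rw [← sq_abs]; exact one_le_pow₀ h
    calc L ^ 2 * (1 + k ^ 2) ≤ L ^ 2 * k ^ 2 * 2 := by nlinarith [sq_nonneg L]
      _ ≤ B ^ 2 * 2 := by linarith
      _ ≤ _ := by nlinarith [sq_nonneg A, sq_nonneg B, mul_nonneg (sq_nonneg A) hk'.le,
                    mul_nonneg (sq_nonneg B) (sub_nonneg.2 h)]

/-- The one particle vector of a test density with vanishing integral. -/
def oneParticle (ħ : ℝ) (f : TestDensity) (hf : ∫ x, f x = 0) : L2 :=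
  (memLp_oneParticleFun ħ f hf).toLp _

/-- A test density with total integral `1`. -/
abbrev UnitDensity : Type := {ψ : TestDensity // ∫ x, ψ x = 1}

/-- The projection `P_ψ f = f - ψ ∫ f` onto test densities with vanishing integral. -/
def projDensity (ψ : UnitDensity) (f : TestDensity) : TestDensity := f - (∫ x, f x) • ψ.1

theorem integral_projDensity (ψ : UnitDensity) (f : TestDensity) :
    ∫ x, projDensity ψ f x = 0 := by
  have hi (h : TestDensity) : Integrable (fun x => h x) :=
    h.continuous.integrable_of_hasCompactSupport h.hasCompactSupport
  have h1 : ∀ x, projDensity ψ f x = f x - (∫ x, f x) * ψ.1 x := fun x => rfl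
  simp only [h1]
  rw [integral_sub (hi f) ((hi ψ.1).const_mul _), integral_const_mul, ψ.2, mul_one, sub_self]

/-- The commutator function of the massless field. -/
def commutatorFun (x y : Minkowski) : ℝ :=
  -(1 / 2) * (if 0 < x.1 - y.1 - |x.2 - y.2| then 1 else 0)
    + (1 / 2) * (if 0 < -x.1 + y.1 - |x.2 - y.2| then 1 else 0)

/-- The bilinear form `⟨f, Δ h⟩`. -/
def commutatorForm (f h : TestDensity) : ℝ :=
  ∫ x, f x * ∫ y, commutatorFun x y * h y

/-- The Lorentz square `(x - y)² = (x⁰ - y⁰)² - (x¹ - y¹)²`. -/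
def lorentzSq (x y : Minkowski) : ℝ := (x.1 - y.1) ^ 2 - (x.2 - y.2) ^ 2

/-- The symmetric Hadamard parametrix `-(1/4π) ln |(x - y)²|` (at mass scale `1`). -/
def hadamardFun (x y : Minkowski) : ℝ := -(1 / (4 * Real.pi)) * Real.log |lorentzSq x y|

/-- The bilinear form `⟨f, H h⟩`. -/
def hadamardForm (f h : TestDensity) : ℝ :=
  ∫ x, f x * ∫ y, hadamardFun x y * h y

theorem memLp_schrodinger (ħ α β : ℝ) (ξ : L2) :
    MemLp (fun k : ℝ => Complex.exp (((-β * k + ħ * α * β / 2 : ℝ) : ℂ) * Complex.I) * ξ (k - ħ * α))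
      2 volume := by
  have h := (Lp.memLp ξ).comp_measurePreserving (measurePreserving_sub_right volume (ħ * α))
  refine h.of_le (AEStronglyMeasurable.mul
    (Continuous.aestronglyMeasurable (by fun_prop)) h.1) (Eventually.of_forall fun k => ?_)
  rw [norm_mul, Complex.norm_exp_ofReal_mul_I, one_mul]
  rfl

/-- The Schrödinger Weyl operator `exp(i(α q - β p))`, where `(p ξ)(k) = k ξ(k)` and
`(q ξ)(k) = i ħ ξ'(k)`.  As `exp(i α q)` is the translation `ξ ↦ ξ(· - ħ α)` and `[q, p] = i ħ`, one has
`exp(i(α q - β p)) = exp(-i ħ α β / 2) exp(i α q) exp(-i β p)`. -/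
def schrodinger (ħ α β : ℝ) : L2 →ₗᵢ[ℂ] L2 where
  toFun ξ := (memLp_schrodinger ħ α β ξ).toLp _
  map_add' ξ η := by
    rw [← MemLp.toLp_add]
    refine (MemLp.toLp_eq_toLp_iff _ _).2 ?_
    filter_upwards [(measurePreserving_sub_right volume (ħ * α)).quasiMeasurePreserving.ae
      (Lp.coeFn_add ξ η)] with k hk
    simp only [Pi.add_apply] at hk ⊢
    rw [hk, mul_add]
  map_smul' c ξ := by
    rw [RingHom.id_apply, ← MemLp.toLp_const_smul]
    refine (MemLp.toLp_eq_toLp_iff _ _).2 ?_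
    filter_upwards [(measurePreserving_sub_right volume (ħ * α)).quasiMeasurePreserving.ae
      (Lp.coeFn_smul c ξ)] with k hk
    simp only [Pi.smul_apply, smul_eq_mul] at hk ⊢
    rw [hk]
    ring
  norm_map' ξ := by
    have h := measurePreserving_sub_right (volume : Measure ℝ) (ħ * α)
    change ‖(memLp_schrodinger ħ α β ξ).toLp _‖ = ‖ξ‖
    rw [← (Lp.compMeasurePreservingₗᵢ ℂ _ h).norm_map ξ]
    refine le_antisymm (Lp.norm_le_norm_of_ae_le ?_) (Lp.norm_le_norm_of_ae_le ?_) <;>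
      filter_upwards [(memLp_schrodinger ħ α β ξ).coeFn_toLp, Lp.coeFn_compMeasurePreserving ξ h] with k h1 h2
    · change _ ≤ ‖Lp.compMeasurePreserving _ h ξ k‖
      rw [h1, h2, norm_mul, Complex.norm_exp_ofReal_mul_I, one_mul]
      rfl
    · change ‖Lp.compMeasurePreserving _ h ξ k‖ ≤ _
      rw [h1, h2, norm_mul, Complex.norm_exp_ofReal_mul_I, one_mul]
      rfl

/-- The Hilbert space tensor product of the Fock space with `L²(ℝ)`. -/
abbrev DMSpace : Type := UniformSpace.Completion (Fock ⊗[ℂ] L2)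

/-- The simple tensor `η ⊗ ξ`. -/
def tmul (η : Fock) (ξ : L2) : DMSpace := ((η ⊗ₜ[ℂ] ξ : Fock ⊗[ℂ] L2) : DMSpace)

/-- The operator `A ⊗ B` on the Hilbert space tensor product. -/
def tensorOp (A : Fock →L[ℂ] Fock) (B : L2 →L[ℂ] L2) : DMSpace →L[ℂ] DMSpace :=
  (UniformSpace.Completion.toComplL ∘L TensorProduct.mapL A B).extend
    (UniformSpace.Completion.toComplL (𝕜 := ℂ) (E := Fock ⊗[ℂ] L2))

theorem tensorOp_tmul (A : Fock →L[ℂ] Fock) (B : L2 →L[ℂ] L2) (η : Fock) (ξ : L2) :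
    tensorOp A B (tmul η ξ) = tmul (A η) (B ξ) :=
  ContinuousLinearMap.extend_eq _ UniformSpace.Completion.denseRange_coe
    (UniformSpace.Completion.isUniformInducing_coe _) _

/-- The Weyl operators of the Dereziński–Meissner representation,
`π_ψ(exp(iΦ(f))) = exp(iφ(P_ψ f)) ⊗ exp(i(q ⟨1, f⟩ - p ⟨f, Δψ⟩))`.
Here `φ(h) = a†(u) + a(u)` with `u = oneParticle ħ h`, so `exp(iφ(h))` is the displacement by `i u`. -/
def weylRep (ħ : ℝ) (ψ : UnitDensity) (f : TestDensity) : DMSpace →L[ℂ] DMSpace :=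
  tensorOp
    (displacement (Complex.I • oneParticle ħ (projDensity ψ f) (integral_projDensity ψ f)))
    (schrodinger ħ (∫ x, f x) (commutatorForm f ψ.1)).toContinuousLinearMap

/-- The Fock vacuum. -/
def vacuum : Fock := expVec 0

/-- The vector `π_ψ(exp(iΦ(f))) (Ω₀ ⊗ ξ)`. -/
def weylVec (ħ : ℝ) (ψ : UnitDensity) (f : TestDensity) (ξ : L2) : DMSpace :=
  weylRep ħ ψ f (tmul vacuum ξ)

/-- The domain spanned by the vectors `π_ψ(exp(iΦ(f))) (Ω₀ ⊗ ξ)`. -/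
def weylDomain (ħ : ℝ) (ψ : UnitDensity) : Submodule ℂ DMSpace :=
  Submodule.span ℂ {v | ∃ (f : TestDensity) (ξ : L2), v = weylVec ħ ψ f ξ}

/-- The vector `π_ψ(exp(iΦ(f))) (Ω₀ ⊗ ξ)` as an element of the domain. -/
def weylDomainVec (ħ : ℝ) (ψ : UnitDensity) (f : TestDensity) (ξ : L2) : weylDomain ħ ψ :=
  ⟨weylVec ħ ψ f ξ, Submodule.subset_span ⟨f, ξ, rfl⟩⟩

/-- The normal ordered exponential `π_ψ(:exp(iΦ(h)):) = exp((ħ/2)⟨h, H h⟩) π_ψ(exp(iΦ(h)))`. -/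
def normalOrderedExp (ħ : ℝ) (ψ : UnitDensity) (h : TestDensity) : DMSpace →L[ℂ] DMSpace :=
  (Real.exp (ħ / 2 * hadamardForm h h) : ℂ) • weylRep ħ ψ h

/-- The rescaled translate `y ↦ ε⁻² ρ((y - x)/ε)`, tending to `δ_x` as `ε → 0` if `∫ ρ = 1`. -/
def mollifier (ρ : TestDensity) (ε : ℝ) (x : Minkowski) : TestDensity where
  toFun y := (ε ^ 2)⁻¹ * ρ (ε⁻¹ • (y - x))
  contDiff' := by
    have := ρ.contDiff
    fun_prop
  hasCompactSupport' := by
    rcases eq_or_ne ε 0 with rfl | hε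
    · simp only [ne_eq, OfNat.ofNat_ne_zero, not_false_eq_true, zero_pow, inv_zero, zero_mul]
      exact HasCompactSupport.zero
    · refine HasCompactSupport.mul_left ?_
      exact ρ.hasCompactSupport.comp_homeomorph
        ((Homeomorph.subRight x).trans (Homeomorph.smulOfNeZero ε⁻¹ (inv_ne_zero hε)))
  tsupport_subset' := Set.subset_univ _

/-- The smeared point charges `∑ⱼ αⱼ ρ_ε(· - xⱼ)`, tending to `∑ⱼ αⱼ δ_{xⱼ}`. -/
def smearedCharges {n : ℕ} (ρ : TestDensity) (ε : ℝ) (α : Fin n → ℝ) (x : Fin n → Minkowski) :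
    TestDensity :=
  ∑ j, α j • mollifier ρ ε (x j)

/-- The Feynman propagator `-(1/4π) ln(-(x - y)² + i σ 0)`. -/
def feynman (σ : ℤˣ) (x y : Minkowski) : ℂ :=
  -(1 / (4 * Real.pi)) * ((Real.log |lorentzSq x y| : ℂ)
    + (if 0 < lorentzSq x y then ((σ : ℤ) : ℂ) * Complex.I * Real.pi else 0))

/-- The kernel `exp(-∑_{i<j} αᵢ αⱼ ħ Δ^F(xᵢ, xⱼ))` of the time ordered product. -/
def timeOrderedKernel (ħ : ℝ) (σ : ℤˣ) {n : ℕ} (α : Fin n → ℝ) (x : Fin n → Minkowski) : ℂ :=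
  Complex.exp (-∑ i, ∑ j ∈ Finset.Ioi i, (α i : ℂ) * α j * ħ * feynman σ (x i) (x j))

/-- `T` is the operator `π_ψ(𝒯ₙ(V_{α₁} ⊗ ⋯ ⊗ V_{αₙ})(g^{⊗ n}))` on the Weyl domain, i.e. the integral
`∫ :exp(i ∑ⱼ αⱼ Φ(xⱼ)): t(x) g(x₁) ⋯ g(xₙ) dx`, where `:exp(i ∑ⱼ αⱼ Φ(xⱼ)):` is the operator valued
distribution obtained in the sense of matrix elements on the Weyl domain from normal ordered
exponentials of smeared charges by removing the smearing. -/
def IsTimeOrderedProduct (ħ : ℝ) (σ : ℤˣ) (ψ : UnitDensity) (g : TestDensity) {n : ℕ}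
    (α : Fin n → ℝ) (T : weylDomain ħ ψ →ₗ[ℂ] DMSpace) : Prop :=
  Integrable (fun x : Fin n → Minkowski => timeOrderedKernel ħ σ α x * ∏ j, (g (x j) : ℂ)) ∧
  ∀ ρ : TestDensity, ∫ x, ρ x = 1 → ∀ Ψ Ψ' : weylDomain ħ ψ,
    Tendsto (fun ε : ℝ => ∫ x : Fin n → Minkowski,
        timeOrderedKernel ħ σ α x * (∏ j, (g (x j) : ℂ)) *
          inner ℂ (Ψ' : DMSpace) (normalOrderedExp ħ ψ (smearedCharges ρ ε α x) Ψ))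
      (𝓝[>] 0) (𝓝 (inner ℂ (Ψ' : DMSpace) (T Ψ)))

/-- The charges `(a, …, a, -a, …, -a)` with `k` entries `a` followed by `n - k` entries `-a`. -/
def signedCharges (a : ℝ) (n k : ℕ) : Fin n → ℝ := fun j => if (j : ℕ) < k then a else -a

/-- `S` is the `n`-th order term of the S-matrix on the Weyl domain,
`π_ψ(Sₙ(V(g))) = (1/n!) (i/ħ)ⁿ (1/2)ⁿ ∑ₖ (n choose k) π_ψ(𝒯ₙ(V_a(g)^{⊗ k} ⊗ V_{-a}(g)^{⊗ (n-k)}))`. -/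
def IsSMatrixTerm (ħ a : ℝ) (σ : ℤˣ) (ψ : UnitDensity) (g : TestDensity) (n : ℕ)
    (S : weylDomain ħ ψ →ₗ[ℂ] DMSpace) : Prop :=
  ∃ T : ℕ → (weylDomain ħ ψ →ₗ[ℂ] DMSpace),
    (∀ k ≤ n, IsTimeOrderedProduct ħ σ ψ g (signedCharges a n k) (T k)) ∧
    S = ((1 / (n ! : ℂ)) * (Complex.I / ħ) ^ n * (1 / 2) ^ n) •
      ∑ k ∈ Finset.range (n + 1), (n.choose k : ℂ) • T k

end SineGordon

end

open SineGordon

/-! The square of the norm of a time ordered product applied to a vector `weylVec ħ ψ f ξ` is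
formally a double integral over configurations `x` and `y` of the two kernels times the inner
product of two normal ordered exponentials. The coherent state given by `f` enters this inner
product only through a phase (`norm_inner_displacedVec`), and the dependence on `ψ` cancels against
the normal ordering (`re_inner_chargeVec`). What is left has the modulus of the Boltzmann factor of
a two dimensional Coulomb gas with charges `αᵢ` at `xᵢ` and `-αᵢ` at `yᵢ`, which is neutral whatever
`α` is.

In the light cone coordinates `u = t - x`, `v = t + x` the logarithm of the Lorentz square splits.
After exchanging `xᵢ` and `yᵢ` according to the sign of `αᵢ`, the Boltzmann factor is `|det (1/(aᵢ -
bⱼ))|^β` in `u` times the same in `v`, with `β = ħ a² / 4π` (`exp_energy_eq`). A Cauchy determinant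
is bounded by a sum of `n!` products of `|aᵢ - bⱼ|⁻¹` (`exists_exp_cauchyLog_le`). For `β p < 1`
Hölder's inequality and subadditivity of the power `β p` leave `(n!)²` integrals of products of
locally integrable singularities, each at most a constant to the power `n` (`lintegral_neutral_le`,
`exists_lintegral_kernel_le`). So the squared norm is at most a geometric factor times `(n!)^(2/p)`;
the square root and the prefactor `1/n!` give `(n!)^((1-p)/p)`. This decays superexponentially
relative to `Cⁿ`, hence the series converges.

Point charges have no square integrable one particle vector. The estimate is therefore made with a
cutoff `exp(-δ|k|)`, which displaces the points of `x` and `y` into opposite complex half planes: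
the Cauchy determinant survives exactly, and its bound sees only real parts and so is uniform in
`δ`. The vector in question is a weak limit as `δ → 0` (`exists_vector_of_kernel_bound`). Its matrix
elements agree with the limit of smeared charges because both converge to the same explicit
expression `pointMatrixElt`.

Uniqueness needs the domain to be dense. This reduces to density of the real space of one particle
vectors, proved by Fourier injectivity applied to dipoles separated in time and dipoles separated in
space. -/

noncomputable section

namespace SineGordon

/-! ### The Cauchy determinant bound -/

theorem prod_erase_eq_prod_succAbove {n : ℕ} {M : Type*} [CommMonoid M] (j : Fin (n + 1))
    (f : Fin (n + 1) → M) :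
    ∏ l ∈ Finset.univ.erase j, f l = ∏ i, f (j.succAbove i) := by
  have : Finset.univ.erase j = Finset.univ.map j.succAboveEmb := by
    ext l
    simp [Fin.exists_succAbove_eq_iff]
  rw [this, Finset.prod_map]
  rfl

/-- The left side has degree `n` in `x`, so interpolation at the `n + 1` nodes `bⱼ` recovers it.
Divided by the product formula of the Cauchy determinant, this identity is the Laplace expansion
along the row of `x`. -/
theorem lagrange_prod_sub {n : ℕ} (x : ℂ) (a : Fin n → ℂ) (b : Fin (n + 1) → ℂ)
    (hb : Function.Injective b) (hx : ∀ j, x ≠ b j) :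
    ∏ i, (x - a i) = ∑ j, (∏ l, (x - b l)) *
      ((∏ i, (b j - b (j.succAbove i))⁻¹) * (x - b j)⁻¹ * ∏ i, (b j - a i)) := by
  have hdeg : (Lagrange.nodal Finset.univ a).degree < (Finset.univ : Finset (Fin (n + 1))).card := by
    rw [Lagrange.degree_nodal]
    simp only [Finset.card_univ, Fintype.card_fin]
    exact_mod_cast Nat.lt_succ_self n
  have h := congrArg (Polynomial.eval x) (Lagrange.eq_interpolate (v := b) hb.injOn hdeg)
  rw [Lagrange.eval_interpolate_not_at_node _ fun j _ => hx j] at h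
  simp only [Lagrange.eval_nodal, Lagrange.nodalWeight, prod_erase_eq_prod_succAbove] at h
  rw [h, Finset.mul_sum]

/-- The logarithm of the modulus of the Cauchy determinant `det (1 / (aᵢ - bⱼ))`. -/
def cauchyLog {n : ℕ} (a b : Fin n → ℂ) : ℝ :=
  (1 / 2) * ∑ i, ∑ j, (Real.log ‖a i - a j‖ + Real.log ‖b i - b j‖)
    - ∑ i, ∑ j, Real.log ‖a i - b j‖

/-- The bracket is the logarithm of the modulus of the `j`-th summand in `lagrange_prod_sub` at `x =
a 0`. The identity removes the pair `(a 0, b j)` from the configuration. Diagonal terms vanish by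
the convention `Real.log 0 = 0`. -/
theorem cauchyLog_succ {n : ℕ} (a b : Fin (n + 1) → ℂ) (j : Fin (n + 1)) :
    cauchyLog a b + (∑ i, Real.log ‖a 0 - b i‖ - ∑ i, Real.log ‖b j - b (j.succAbove i)‖
      - Real.log ‖a 0 - b j‖ + ∑ i : Fin n, Real.log ‖b j - a i.succ‖) =
    ∑ i : Fin n, Real.log ‖a 0 - a i.succ‖ - Real.log ‖a 0 - b j‖
      + cauchyLog (fun i => a i.succ) (fun i => b (j.succAbove i)) := by
  have h1 : ∑ i, ∑ l, Real.log ‖a i - a l‖ = ∑ i : Fin n, Real.log ‖a 0 - a i.succ‖ * 2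
      + ∑ i : Fin n, ∑ l : Fin n, Real.log ‖a i.succ - a l.succ‖ := by
    simp only [Fin.sum_univ_succ, sub_self, norm_zero, Real.log_zero, zero_add,
      Finset.sum_add_distrib, norm_sub_rev (a (Fin.succ _)) (a 0), mul_two]
    ring
  have h2 : ∑ i, ∑ l, Real.log ‖b i - b l‖ = ∑ i : Fin n, Real.log ‖b j - b (j.succAbove i)‖ * 2
      + ∑ i : Fin n, ∑ l : Fin n, Real.log ‖b (j.succAbove i) - b (j.succAbove l)‖ := by
    simp only [Fin.sum_univ_succAbove _ j, sub_self, norm_zero, Real.log_zero, zero_add,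
      Finset.sum_add_distrib, norm_sub_rev (b (j.succAbove _)) (b j), mul_two]
    ring
  have h3 : ∑ i, ∑ l, Real.log ‖a i - b l‖ = ∑ i, Real.log ‖a 0 - b i‖
      + ∑ i : Fin n, Real.log ‖b j - a i.succ‖
      + ∑ i : Fin n, ∑ l : Fin n, Real.log ‖a i.succ - b (j.succAbove l)‖ := by
    rw [Fin.sum_univ_succ, add_assoc]
    congr 1
    simp only [Fin.sum_univ_succAbove _ j, Finset.sum_add_distrib, norm_sub_rev (b j)]
  simp only [cauchyLog, Finset.sum_add_distrib, h1, h2, h3, ← Finset.sum_mul]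
  ring

theorem exp_sum_log_norm {ι : Type*} [Fintype ι] (z : ι → ℂ) (h : ∀ i, z i ≠ 0) :
    Real.exp (∑ i, Real.log ‖z i‖) = ‖∏ i, z i‖ := by
  rw [Real.exp_sum, norm_prod]
  exact Finset.prod_congr rfl fun i _ => Real.exp_log (norm_pos_iff.2 (h i))

/-- The Laplace expansion bound of the Cauchy determinant by `n!` products. -/
theorem exists_exp_cauchyLog_le (n : ℕ) : ∃ (ι : Type) (_ : Fintype ι) (π : ι → Fin n → Fin n),
    Fintype.card ι = n ! ∧ ∀ a b : Fin n → ℂ, Function.Injective a → Function.Injective b →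
      (∀ i j, a i ≠ b j) → Real.exp (cauchyLog a b) ≤ ∑ s, ∏ i, ‖a i - b (π s i)‖⁻¹ := by
  induction n with
  | zero => exact ⟨Unit, inferInstance, fun _ i => i, rfl, fun a b _ _ _ => by simp [cauchyLog]⟩
  | succ n ih =>
    obtain ⟨ι, hι, π, hc, h⟩ := ih
    -- A matching of `n + 1` pairs is a partner `j` of the index `0` and a matching of the rest.
    -- These maps are in fact permutations, but only their number matters later.
    refine ⟨Fin (n + 1) × ι, inferInstance,
      fun s => Fin.cons s.1 fun i => s.1.succAbove (π s.2 i), ?_, fun a b ha hb hab => ?_⟩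
    · rw [Fintype.card_prod, Fintype.card_fin, hc, Nat.factorial_succ]
    let c (j : Fin (n + 1)) : ℝ := ∑ i, Real.log ‖a 0 - b i‖
      - ∑ i, Real.log ‖b j - b (j.succAbove i)‖
      - Real.log ‖a 0 - b j‖ + ∑ i : Fin n, Real.log ‖b j - a i.succ‖
    let A : ℝ := ∑ i : Fin n, Real.log ‖a 0 - a i.succ‖
    have hA : Real.exp A = ‖∏ i : Fin n, (a 0 - a i.succ)‖ :=
      exp_sum_log_norm _ fun i => sub_ne_zero.2 (ha.ne (Fin.succ_ne_zero i).symm)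
    -- Triangle inequality in the interpolation formula: the only inequality behind the bound, where
    -- signs of the expansion are lost.
    have h1 : Real.exp A ≤ ∑ j, Real.exp (c j) := by
      rw [hA, lagrange_prod_sub (a 0) _ b hb (hab 0)]
      refine (norm_sum_le _ _).trans (Finset.sum_le_sum fun j _ => le_of_eq ?_)
      simp only [c, Real.exp_add, Real.exp_sub]
      rw [exp_sum_log_norm _ fun i => sub_ne_zero.2 (hab 0 i),
        exp_sum_log_norm _ fun i => sub_ne_zero.2 (hb.ne (Fin.succAbove_ne j i).symm),
        exp_sum_log_norm _ fun i => sub_ne_zero.2 (hab _ j).symm,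
        Real.exp_log (norm_pos_iff.2 (sub_ne_zero.2 (hab 0 j)))]
      simp only [norm_mul, norm_prod, norm_inv, Finset.prod_inv_distrib, div_eq_mul_inv, mul_assoc]
    have h2 (j) : Real.exp (cauchyLog a b) * Real.exp (c j) ≤
        Real.exp A * ∑ s, ‖a 0 - b j‖⁻¹ * ∏ i : Fin n, ‖a i.succ - b (j.succAbove (π s i))‖⁻¹ := by
      rw [← Real.exp_add, cauchyLog_succ, Real.exp_add, Real.exp_sub,
        Real.exp_log (norm_pos_iff.2 (sub_ne_zero.2 (hab 0 j))), div_eq_mul_inv, mul_assoc,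
        ← Finset.mul_sum]
      refine mul_le_mul_of_nonneg_left (mul_le_mul_of_nonneg_left ?_ (by positivity))
        (Real.exp_pos _).le
      exact h _ _ (ha.comp (Fin.succ_injective n)) (hb.comp Fin.succAbove_right_injective)
        fun i l => hab _ _
    -- Sum `h2` over `j` and use `h1` on the left; the common positive factor `exp A` then cancels.
    have h3 : Real.exp A * Real.exp (cauchyLog a b) ≤ Real.exp A *
        ∑ j, ∑ s, ‖a 0 - b j‖⁻¹ * ∏ i : Fin n, ‖a i.succ - b (j.succAbove (π s i))‖⁻¹ := by
      rw [Finset.mul_sum]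
      refine le_trans ?_ (Finset.sum_le_sum fun j _ => h2 j)
      rw [← Finset.mul_sum, mul_comm]
      exact mul_le_mul_of_nonneg_left h1 (Real.exp_pos _).le
    refine (le_of_mul_le_mul_left h3 (Real.exp_pos _)).trans (le_of_eq ?_)
    rw [Fintype.sum_prod_type]
    refine Finset.sum_congr rfl fun j _ => Finset.sum_congr rfl fun s _ => ?_
    simp [Fin.prod_univ_succ, mul_comm]

/-- Interchanging the points of a configuration of positive and negative charges does not change the
interaction energy. -/
theorem cauchyLog_ite {n : ℕ} (s : Fin n → Prop) [DecidablePred s] (X Y : Fin n → ℂ) :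
    cauchyLog (fun i => if s i then Y i else X i) (fun i => if s i then X i else Y i) =
    (1 / 2) * ∑ i, ∑ j, (if s i then (1 : ℝ) else -1) * (if s j then 1 else -1) *
      (Real.log ‖X i - X j‖ + Real.log ‖Y i - Y j‖)
    - ∑ i, ∑ j, (if s i then (1 : ℝ) else -1) * (if s j then 1 else -1) *
      Real.log ‖X i - Y j‖ := by
  -- The two sides agree only after adding the terms `(i, j)` and `(j, i)`: if exactly one of `s i`,
  -- `s j` holds, pairs `X`-`X` and `Y`-`Y` trade places with the two mixed pairs.
  have hsymm (F : Fin n → Fin n → ℝ) : ∑ i, ∑ j, F i j = (1 / 2) * ∑ i, ∑ j, (F i j + F j i) := by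
    simp only [Finset.sum_add_distrib]
    rw [Finset.sum_comm (f := fun i j => F j i)]
    ring
  rw [cauchyLog, hsymm fun i j => Real.log ‖(if s i then Y i else X i) - (if s j then X j else Y j)‖,
    hsymm fun i j => (if s i then (1 : ℝ) else -1) * (if s j then 1 else -1) *
      Real.log ‖X i - Y j‖, ← mul_sub, ← mul_sub, ← Finset.sum_sub_distrib, ← Finset.sum_sub_distrib]
  congr 1
  refine Finset.sum_congr rfl fun i _ => ?_
  rw [← Finset.sum_sub_distrib, ← Finset.sum_sub_distrib]
  refine Finset.sum_congr rfl fun j _ => ?_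
  by_cases hi : s i <;> by_cases hj : s j <;>
    simp only [hi, hj, if_true, if_false, norm_sub_rev (Y i) (X j), norm_sub_rev (Y j) (X i),
      norm_sub_rev (X j) (X i), norm_sub_rev (Y j) (Y i)] <;> ring

/-! ### Integrals of products over several variables -/

theorem lintegral_prod_fin {E : Type*} [MeasureSpace E] [SigmaFinite (volume : Measure E)] (n : ℕ)
    (f : Fin n → E → ENNReal) (hf : ∀ i, Measurable (f i)) :
    ∫⁻ x : Fin n → E, ∏ i, f i (x i) = ∏ i, ∫⁻ x, f i x := by
  induction n with
  | zero => simp [volume_pi]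
  | succ n ih =>
    have h := volume_preserving_piFinSuccAbove (fun _ : Fin (n + 1) => E) 0
    have hm : Measurable fun z : E × (Fin n → E) => f 0 z.1 * ∏ i : Fin n, f i.succ (z.2 i) := by
      have := hf 0
      have := fun i : Fin n => hf i.succ
      fun_prop
    rw [Fin.prod_univ_succ, ← ih (fun i => f i.succ) fun i => hf i.succ]
    have h2 : ∫⁻ z : E × (Fin n → E), f 0 z.1 * ∏ i : Fin n, f i.succ (z.2 i) =
        (∫⁻ x, f 0 x) * ∫⁻ x : Fin n → E, ∏ i : Fin n, f i.succ (x i) := by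
      have hm2 : Measurable fun x : Fin n → E => ∏ i : Fin n, f i.succ (x i) := by
        have := fun i : Fin n => hf i.succ
        fun_prop
      exact lintegral_prod_mul (hf 0).aemeasurable hm2.aemeasurable
    rw [← h2, ← h.lintegral_comp hm]
    refine lintegral_congr fun x => ?_
    rw [Fin.prod_univ_succ]
    rfl

/-- The singular kernel `|w|^(-γ)`. -/
def invPow (γ w : ℝ) : ENNReal := ENNReal.ofReal |w|⁻¹ ^ γ

@[fun_prop]
theorem measurable_invPow (γ : ℝ) : Measurable (invPow γ) := by
  unfold invPow
  fun_prop

theorem setLIntegral_invPow_lt_top {γ : ℝ} (h1 : γ < 1) :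
    ∫⁻ w in Set.Icc (-1) 1, invPow γ w < ⊤ := by
  have hi : IntervalIntegrable (fun w : ℝ => |w| ^ (-γ)) volume (-1) 1 := by
    refine intervalIntegrable_of_even (fun x => by rw [abs_neg]) fun x hx => ?_
    refine (intervalIntegral.intervalIntegrable_rpow' (r := -γ) (a := 0) (b := x)
      (by linarith)).congr fun w hw => ?_
    rw [Set.uIoc_of_le hx.le] at hw
    simp only [abs_of_pos hw.1]
  rw [intervalIntegrable_iff_integrableOn_Icc_of_le (by norm_num)] at hi
  refine lt_of_le_of_lt (le_of_eq ?_) hi.2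
  refine lintegral_congr_ae ?_
  have : ∀ᵐ w : ℝ, w ≠ 0 := by simp [ae_iff, measure_singleton]
  filter_upwards [ae_restrict_of_ae this] with w hw
  have hw' : 0 < |w| := abs_pos.2 hw
  rw [invPow, ENNReal.ofReal_rpow_of_pos (inv_pos.2 hw'), Real.inv_rpow hw'.le, Real.rpow_neg hw'.le,
    Real.enorm_of_nonneg (by positivity)]

/-- Within distance `1` of the singularity the integral does not depend on `s` by translation
invariance; elsewhere the kernel is at most `1`. -/
theorem exists_setLIntegral_invPow_le {γ : ℝ} (h0 : 0 ≤ γ) (h1 : γ < 1) (R : ℝ) :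
    ∃ K : ENNReal, K ≠ ⊤ ∧ ∀ s, ∫⁻ w in Set.Icc (-R) R, invPow γ (w - s) ≤ K := by
  refine ⟨(∫⁻ w in Set.Icc (-1) 1, invPow γ w) + volume (Set.Icc (-R) R),
    ENNReal.add_ne_top.2 ⟨(setLIntegral_invPow_lt_top h1).ne, by simp⟩, fun s => ?_⟩
  have hle (w : ℝ) : invPow γ (w - s) ≤ (Set.Icc (-1) 1).indicator (invPow γ) (w - s) + 1 := by
    by_cases hw : w - s ∈ Set.Icc (-1 : ℝ) 1
    · rw [Set.indicator_of_mem hw]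
      exact le_self_add
    · refine le_trans ?_ le_add_self
      refine ENNReal.rpow_le_one ?_ h0
      rw [ENNReal.ofReal_le_one]
      refine inv_le_one_of_one_le₀ (le_of_lt ?_)
      by_contra hc
      exact hw (abs_le.1 (not_lt.1 hc))
  have hm : Measurable ((Set.Icc (-1 : ℝ) 1).indicator (invPow γ)) :=
    (measurable_invPow γ).indicator measurableSet_Icc
  calc ∫⁻ w in Set.Icc (-R) R, invPow γ (w - s)
      ≤ ∫⁻ w in Set.Icc (-R) R, ((Set.Icc (-1) 1).indicator (invPow γ) (w - s) + 1) :=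
        lintegral_mono fun w => hle w
    _ = (∫⁻ w in Set.Icc (-R) R, (Set.Icc (-1) 1).indicator (invPow γ) (w - s))
        + volume (Set.Icc (-R) R) := by
        rw [lintegral_add_right _ measurable_const, setLIntegral_one]
    _ ≤ _ := by
        refine add_le_add_left ?_ _
        refine (setLIntegral_le_lintegral _ _).trans (le_of_eq ?_)
        rw [lintegral_sub_right_eq_self (fun w => (Set.Icc (-1) 1).indicator (invPow γ) w),
          lintegral_indicator measurableSet_Icc]

/-- The change of variables to light cone coordinates has Jacobian `1/2`. It is made in two steps:
the shear to `(u, x)`, which preserves the measure, and then `v = u + 2 x` for fixed `u`. -/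
theorem lintegral_lightCone (η χ : ℝ → ENNReal) (hη : Measurable η) (hχ : Measurable χ) :
    ∫⁻ z : Minkowski, η (z.1 - z.2) * χ (z.1 + z.2) =
      (∫⁻ w, η w) * (ENNReal.ofReal (1 / 2) * ∫⁻ w, χ w) := by
  have h := measurePreserving_sub_prod (volume : Measure ℝ) (volume : Measure ℝ)
  have h1 : ∫⁻ z : Minkowski, η (z.1 - z.2) * χ (z.1 + z.2) =
      ∫⁻ z : Minkowski, η z.1 * χ (z.1 + 2 * z.2) := by
    refine Eq.trans (lintegral_congr fun z => ?_)
      (h.lintegral_comp (f := fun z : ℝ × ℝ => η z.1 * χ (z.1 + 2 * z.2)) (by fun_prop))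
    congr 2
    dsimp only
    ring
  have h2 (s : ℝ) : ∫⁻ x, χ (s + 2 * x) = ENNReal.ofReal (1 / 2) * ∫⁻ w, χ w := by
    have h3 := lintegral_map (μ := volume) (f := fun w => χ (s + w)) (g := fun x : ℝ => 2 * x)
      (by fun_prop) (by fun_prop)
    rw [← h3, Real.map_volume_mul_left two_ne_zero, lintegral_smul_measure,
      lintegral_add_left_eq_self χ s]
    norm_num
  rw [h1, Measure.volume_eq_prod, lintegral_prod _ (by fun_prop)]
  simp only
  have h4 (s : ℝ) : ∫⁻ x, η s * χ (s + 2 * x) = η s * (ENNReal.ofReal (1 / 2) * ∫⁻ w, χ w) := by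
    rw [lintegral_const_mul _ (by fun_prop), h2]
  simp only [h4]
  rw [lintegral_mul_const _ hη]

/-- The integral over one point of Minkowski space factorizes in light cone coordinates. The
uniformity in `s` and `t` allows the points to be integrated one at a time, wherever their partners
are. -/
theorem exists_lintegral_invPow_le (g : TestDensity) {γ : ℝ} (h0 : 0 ≤ γ) (h1 : γ < 1) :
    ∃ K : ENNReal, K ≠ ⊤ ∧ ∀ s t : ℝ,
      ∫⁻ z : Minkowski, ‖g z‖ₑ * (invPow γ (z.1 - z.2 - s) * invPow γ (z.1 + z.2 - t)) ≤ K := by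
  obtain ⟨M, hM⟩ := g.hasCompactSupport.exists_bound_of_continuous g.continuous
  obtain ⟨R, hR⟩ := g.hasCompactSupport.isCompact.isBounded.subset_closedBall (0 : Minkowski)
  obtain ⟨K, hK, hKs⟩ := exists_setLIntegral_invPow_le h0 h1 (2 * R)
  refine ⟨ENNReal.ofReal M * (K * (ENNReal.ofReal (1 / 2) * K)),
    ENNReal.mul_ne_top ENNReal.ofReal_ne_top
      (ENNReal.mul_ne_top hK (ENNReal.mul_ne_top ENNReal.ofReal_ne_top hK)), fun s t => ?_⟩
  let η (s w : ℝ) : ENNReal := (Set.Icc (-(2 * R)) (2 * R)).indicator (fun w => invPow γ (w - s)) w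
  have hηm (s) : Measurable (η s) :=
    Measurable.indicator (by fun_prop) measurableSet_Icc
  have hηi (s) : ∫⁻ w, η s w ≤ K := by
    simp only [η]
    rw [lintegral_indicator measurableSet_Icc]
    exact hKs s
  have hle (z : Minkowski) : ‖g z‖ₑ * (invPow γ (z.1 - z.2 - s) * invPow γ (z.1 + z.2 - t)) ≤
      ENNReal.ofReal M * (η s (z.1 - z.2) * η t (z.1 + z.2)) := by
    by_cases hz : z ∈ tsupport g
    · have hz' := hR hz
      rw [mem_closedBall_zero_iff, Prod.norm_def, max_le_iff, Real.norm_eq_abs, Real.norm_eq_abs,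
        abs_le, abs_le] at hz'
      have hu : z.1 - z.2 ∈ Set.Icc (-(2 * R)) (2 * R) := ⟨by linarith, by linarith⟩
      have hv : z.1 + z.2 ∈ Set.Icc (-(2 * R)) (2 * R) := ⟨by linarith, by linarith⟩
      simp only [η, Set.indicator_of_mem hu, Set.indicator_of_mem hv]
      gcongr
      rw [← ofReal_norm]
      exact ENNReal.ofReal_le_ofReal (hM z)
    · rw [image_eq_zero_of_notMem_tsupport hz]
      simp
  refine (lintegral_mono hle).trans ?_
  rw [lintegral_const_mul _ ?_, lintegral_lightCone _ _ (hηm s) (hηm t)]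
  · gcongr
    · exact hηi s
    · exact hηi t
  · have := hηm s
    have := hηm t
    fun_prop

theorem ae_linear_ne_zero {E : Type*} [NormedAddCommGroup E] [NormedSpace ℝ E] [MeasurableSpace E]
    [BorelSpace E] [FiniteDimensional ℝ E] (μ : Measure E) [μ.IsAddHaarMeasure] (l : E →ₗ[ℝ] ℝ)
    (z : E) (hz : l z ≠ 0) : ∀ᵐ x ∂μ, l x ≠ 0 := by
  have h := Measure.addHaar_submodule μ (LinearMap.ker l) fun h => hz (LinearMap.mem_ker.1 (h ▸ trivial))
  exact measure_mono_null (fun x hx => by simpa using hx) h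

/-! ### The integral of the neutral kernel -/

/-- Exchanging `xᵢ` and `yᵢ` where `αᵢ = a` collects charges of one sign in the first component and
those of the other sign in the second. -/
theorem measurePreserving_exchange {E : Type*} [MeasureSpace E] [SigmaFinite (volume : Measure E)]
    {n : ℕ} (s : Fin n → Prop) [DecidablePred s] :
    MeasurePreserving (fun z : (Fin n → E) × (Fin n → E) =>
      ((fun i => if s i then z.2 i else z.1 i, fun i => if s i then z.1 i else z.2 i) :
        (Fin n → E) × (Fin n → E))) volume volume := by
  have h1 := volume_measurePreserving_arrowProdEquivProdArrow E E (Fin n)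
  have h2 := measurePreserving_pi (fun _ : Fin n => (volume : Measure (E × E)))
    (fun _ : Fin n => (volume : Measure (E × E)))
    (f := fun i z => if s i then z.swap else z) fun i => by
      by_cases hi : s i
      · simpa only [hi, if_true] using! Measure.measurePreserving_swap (μ := volume) (ν := volume)
      · simpa only [hi, if_false] using! MeasurePreserving.id volume
  have h3 := h1.comp (h2.comp h1.symm)
  have h4 : (fun z : (Fin n → E) × (Fin n → E) =>
      ((fun i => if s i then z.2 i else z.1 i, fun i => if s i then z.1 i else z.2 i) :
        (Fin n → E) × (Fin n → E))) = (MeasurableEquiv.arrowProdEquivProdArrow E E (Fin n)) ∘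
      (fun a i => if s i then (a i).swap else a i) ∘
        (MeasurableEquiv.arrowProdEquivProdArrow E E (Fin n)).symm := by
   funext z
   refine Prod.ext (funext fun i => ?_) (funext fun i => ?_) <;>
    by_cases hi : s i <;>
    simp [MeasurableEquiv.arrowProdEquivProdArrow, Equiv.arrowProdEquivProdArrow, hi]
  rw [h4]
  exact h3

/-- For fixed second configuration the integrand is a product of functions of the single points `z.1
i`, and each integral is at most `K`. Thus the matchings `π` and `π'` in the two light cone
coordinates may differ and need not be bijective. -/
theorem lintegral_prod_invPow_le (g : TestDensity) {γ : ℝ} {K : ENNReal}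
    (hK : ∀ s t : ℝ,
      ∫⁻ z : Minkowski, ‖g z‖ₑ * (invPow γ (z.1 - z.2 - s) * invPow γ (z.1 + z.2 - t)) ≤ K)
    {n : ℕ} (π π' : Fin n → Fin n) :
    ∫⁻ z : (Fin n → Minkowski) × (Fin n → Minkowski), ((∏ i, ‖g (z.1 i)‖ₑ) * ∏ i, ‖g (z.2 i)‖ₑ) *
      ∏ i, (invPow γ ((z.1 i).1 - (z.1 i).2 - ((z.2 (π i)).1 - (z.2 (π i)).2)) *
        invPow γ ((z.1 i).1 + (z.1 i).2 - ((z.2 (π' i)).1 + (z.2 (π' i)).2)))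
      ≤ (K * ∫⁻ z, ‖g z‖ₑ) ^ n := by
  have hg : Measurable fun z => ‖g z‖ₑ := g.continuous.enorm.measurable
  rw [Measure.volume_eq_prod, lintegral_prod_symm' _ (by fun_prop)]
  simp only
  have hle (y : Fin n → Minkowski) : ∫⁻ x : Fin n → Minkowski,
      ((∏ i, ‖g (x i)‖ₑ) * ∏ i, ‖g (y i)‖ₑ) *
      ∏ i, (invPow γ ((x i).1 - (x i).2 - ((y (π i)).1 - (y (π i)).2)) *
        invPow γ ((x i).1 + (x i).2 - ((y (π' i)).1 + (y (π' i)).2))) ≤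
      K ^ n * ∏ i, ‖g (y i)‖ₑ := by
    have h1 (x : Fin n → Minkowski) : ((∏ i, ‖g (x i)‖ₑ) * ∏ i, ‖g (y i)‖ₑ) *
      ∏ i, (invPow γ ((x i).1 - (x i).2 - ((y (π i)).1 - (y (π i)).2)) *
        invPow γ ((x i).1 + (x i).2 - ((y (π' i)).1 + (y (π' i)).2))) =
      (∏ i, ‖g (x i)‖ₑ * (invPow γ ((x i).1 - (x i).2 - ((y (π i)).1 - (y (π i)).2)) *
        invPow γ ((x i).1 + (x i).2 - ((y (π' i)).1 + (y (π' i)).2)))) * ∏ i, ‖g (y i)‖ₑ := by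
      simp only [Finset.prod_mul_distrib]
      ring
    simp only [h1]
    rw [lintegral_mul_const _ (by fun_prop), lintegral_prod_fin n
      (fun i z => ‖g z‖ₑ * (invPow γ (z.1 - z.2 - ((y (π i)).1 - (y (π i)).2)) *
        invPow γ (z.1 + z.2 - ((y (π' i)).1 + (y (π' i)).2)))) fun i => by fun_prop]
    gcongr
    refine (Finset.prod_le_prod' fun i _ => hK _ _).trans (le_of_eq ?_)
    simp
  refine (lintegral_mono hle).trans (le_of_eq ?_)
  rw [lintegral_const_mul _ (by fun_prop), lintegral_prod_fin n (fun _ z => ‖g z‖ₑ) fun _ => hg,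
    mul_pow]
  simp

theorem rpow_sum_le {ι : Type*} (s : Finset ι) (f : ι → ENNReal) {γ : ℝ} (h0 : 0 < γ) (h1 : γ ≤ 1) :
    (∑ i ∈ s, f i) ^ γ ≤ ∑ i ∈ s, f i ^ γ :=
  Finset.le_sum_of_subadditive (fun x : ENNReal => x ^ γ) (ENNReal.zero_rpow_of_pos h0).le
    (fun x y => ENNReal.rpow_add_le_add_rpow x y h0.le h1) s f

theorem prod_invPow_one_rpow {n : ℕ} (w : Fin n → ℝ) {γ : ℝ} (h0 : 0 ≤ γ) :
    (∏ i, invPow 1 (w i)) ^ γ = ∏ i, invPow γ (w i) := by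
  rw [← ENNReal.prod_rpow_of_nonneg h0]
  exact Finset.prod_congr rfl fun i _ => by simp [invPow]

/-- The regularized parametrix as a function of the difference of the arguments. -/
def logReg (δ : ℝ) (z : Minkowski) : ℝ :=
  -(1 / (8 * Real.pi)) * (Real.log ((z.1 - z.2) ^ 2 + δ ^ 2) + Real.log ((z.1 + z.2) ^ 2 + δ ^ 2))

theorem sum_sum_Ioi {n : ℕ} (F : Fin n → Fin n → ℝ) (hs : ∀ i j, F i j = F j i) (h0 : ∀ i, F i i = 0) :
    ∑ i, ∑ j ∈ Finset.Ioi i, F i j = (1 / 2) * ∑ i, ∑ j, F i j := by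
  have h1 (i) : ∑ j ∈ Finset.Ioi i, F i j = ∑ j, if i < j then F i j else 0 := by
    rw [← Finset.sum_filter]
    congr 1
    ext j
    simp
  simp only [h1]
  have h2 : ∑ i, ∑ j, F i j = ∑ i, ∑ j, (if i < j then F i j else 0)
      + ∑ i, ∑ j, (if j < i then F j i else 0) := by
    rw [← Finset.sum_add_distrib]
    refine Finset.sum_congr rfl fun i _ => ?_
    rw [← Finset.sum_add_distrib]
    refine Finset.sum_congr rfl fun j _ => ?_
    rcases lt_trichotomy i j with h | h | h
    · simp [h, h.not_gt]
    · subst h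
      simp [h0]
    · simp [h, h.not_gt, hs i j]
  rw [h2, Finset.sum_comm (f := fun i j => if j < i then F j i else 0)]
  ring

/-! ### The modulus of the time ordered kernel and the energy of a neutral configuration. -/

theorem feynman_re (σ : ℤˣ) (x y : Minkowski) :
    (feynman σ x y).re = -(1 / (4 * Real.pi)) * Real.log |lorentzSq x y| := by
  have h : (-(1 / (4 * (Real.pi : ℂ)))) = ((-(1 / (4 * Real.pi)) : ℝ) : ℂ) := by push_cast; rfl
  rw [feynman, h, Complex.re_ofReal_mul, Complex.add_re, Complex.ofReal_re]
  split_ifs <;> simp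

/-- The `σ`-dependent part of the propagator is imaginary and contributes only a phase. The sum over
pairs becomes half the full double sum, whose diagonal vanishes since `Real.log 0 = 0`. -/
theorem norm_timeOrderedKernel (ħ : ℝ) (σ : ℤˣ) {n : ℕ} (α : Fin n → ℝ) (x : Fin n → Minkowski) :
    ‖timeOrderedKernel ħ σ α x‖ =
      Real.exp (ħ / (8 * Real.pi) * ∑ i, ∑ j, α i * α j * Real.log |lorentzSq (x i) (x j)|) := by
  rw [timeOrderedKernel, Complex.norm_exp, Complex.neg_re, Complex.re_sum]
  simp only [Complex.re_sum]
  have h1 (i j : Fin n) : ((α i : ℂ) * α j * ħ * feynman σ (x i) (x j)).re =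
      -(ħ / (4 * Real.pi)) * (α i * α j * Real.log |lorentzSq (x i) (x j)|) := by
    rw [← Complex.ofReal_mul, ← Complex.ofReal_mul, Complex.re_ofReal_mul, feynman_re]
    ring
  simp only [h1, ← Finset.mul_sum]
  rw [sum_sum_Ioi fun i j => α i * α j * Real.log |lorentzSq (x i) (x j)|]
  · congr 1
    ring
  · intro i j
    rw [show lorentzSq (x i) (x j) = lorentzSq (x j) (x i) by unfold lorentzSq; ring]
    ring
  · intro i
    simp [lorentzSq]

theorem lorentzSq_eq (x y : Minkowski) :
    lorentzSq x y = (x.1 - x.2 - (y.1 - y.2)) * (x.1 + x.2 - (y.1 + y.2)) := by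
  unfold lorentzSq
  ring

theorem log_norm_regularized (d δ : ℝ) :
    Real.log ‖(d : ℂ) - (2 * δ : ℝ) * Complex.I‖ = 1 / 2 * Real.log (d ^ 2 + (2 * δ) ^ 2) := by
  have h : ‖(d : ℂ) - (2 * δ : ℝ) * Complex.I‖ ^ 2 = d ^ 2 + (2 * δ) ^ 2 := by
    rw [← Complex.normSq_eq_norm_sq, sub_eq_add_neg, ← neg_mul, ← Complex.ofReal_neg,
      Complex.normSq_add_mul_I]
    ring
  rw [← h, Real.log_pow]
  push_cast
  ring

/-- The light cone coordinates of the charges, displaced into the complex plane. -/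
theorem exp_energy_eq {n : ℕ} (ħ a : ℝ) (s : Fin n → Prop) [DecidablePred s] (α : Fin n → ℝ)
    (hα : ∀ i, α i = a * if s i then 1 else -1) (δ : ℝ) (x y : Fin n → Minkowski)
    (hx : ∀ i j, i ≠ j → (x i).1 - (x i).2 ≠ (x j).1 - (x j).2 ∧ (x i).1 + (x i).2 ≠ (x j).1 + (x j).2)
    (hy : ∀ i j, i ≠ j → (y i).1 - (y i).2 ≠ (y j).1 - (y j).2 ∧ (y i).1 + (y i).2 ≠ (y j).1 + (y j).2)
    (X Y X' Y' : Fin n → ℂ)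
    (hX : ∀ i, X i = (((x i).1 - (x i).2 : ℝ) : ℂ) - (δ : ℝ) * Complex.I)
    (hY : ∀ i, Y i = (((y i).1 - (y i).2 : ℝ) : ℂ) + (δ : ℝ) * Complex.I)
    (hX' : ∀ i, X' i = (((x i).1 + (x i).2 : ℝ) : ℂ) - (δ : ℝ) * Complex.I)
    (hY' : ∀ i, Y' i = (((y i).1 + (y i).2 : ℝ) : ℂ) + (δ : ℝ) * Complex.I) :
    ħ / (8 * Real.pi) * (∑ i, ∑ j, α i * α j * Real.log |lorentzSq (x i) (x j)|) +
    ħ / (8 * Real.pi) * (∑ i, ∑ j, α i * α j * Real.log |lorentzSq (y i) (y j)|) +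
    ħ * ∑ i, ∑ j, α i * α j * logReg (2 * δ) (x i - y j) =
    ħ * a ^ 2 / (4 * Real.pi) *
      (cauchyLog (fun i => if s i then Y i else X i) (fun i => if s i then X i else Y i) +
       cauchyLog (fun i => if s i then Y' i else X' i) (fun i => if s i then X' i else Y' i)) := by
  have hlog (x : Fin n → Minkowski) (hx : ∀ i j, i ≠ j → (x i).1 - (x i).2 ≠ (x j).1 - (x j).2 ∧
      (x i).1 + (x i).2 ≠ (x j).1 + (x j).2) (i j) : Real.log |lorentzSq (x i) (x j)| =
      Real.log |(x i).1 - (x i).2 - ((x j).1 - (x j).2)|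
        + Real.log |(x i).1 + (x i).2 - ((x j).1 + (x j).2)| := by
    rcases eq_or_ne i j with rfl | hij
    · simp [lorentzSq]
    · rw [lorentzSq_eq, abs_mul, Real.log_mul (abs_ne_zero.2 (sub_ne_zero.2 (hx i j hij).1))
        (abs_ne_zero.2 (sub_ne_zero.2 (hx i j hij).2))]
  have e1 (i j) : ‖X i - X j‖ = |(x i).1 - (x i).2 - ((x j).1 - (x j).2)| := by
    rw [hX, hX, sub_sub_sub_cancel_right, ← Complex.ofReal_sub, Complex.norm_real, Real.norm_eq_abs]
  have e2 (i j) : ‖X' i - X' j‖ = |(x i).1 + (x i).2 - ((x j).1 + (x j).2)| := by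
    rw [hX', hX', sub_sub_sub_cancel_right, ← Complex.ofReal_sub, Complex.norm_real, Real.norm_eq_abs]
  have e3 (i j) : ‖Y i - Y j‖ = |(y i).1 - (y i).2 - ((y j).1 - (y j).2)| := by
    rw [hY, hY, add_sub_add_right_eq_sub, ← Complex.ofReal_sub, Complex.norm_real, Real.norm_eq_abs]
  have e4 (i j) : ‖Y' i - Y' j‖ = |(y i).1 + (y i).2 - ((y j).1 + (y j).2)| := by
    rw [hY', hY', add_sub_add_right_eq_sub, ← Complex.ofReal_sub, Complex.norm_real, Real.norm_eq_abs]
  -- The `x` points are moved by `-iδ` and the `y` points by `+iδ`: differences within one family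
  -- stay real, and mixed differences acquire the imaginary part `-2δ`, which is the regularization
  -- of `logReg (2 * δ)`.
  have e5 (i j) : logReg (2 * δ) (x i - y j) = -(1 / (4 * Real.pi)) *
      (Real.log ‖X i - Y j‖ + Real.log ‖X' i - Y' j‖) := by
    have h1 : X i - Y j = (((x i).1 - (x i).2 - ((y j).1 - (y j).2) : ℝ) : ℂ)
        - (2 * δ : ℝ) * Complex.I := by
      rw [hX, hY]; push_cast; ring
    have h2 : X' i - Y' j = (((x i).1 + (x i).2 - ((y j).1 + (y j).2) : ℝ) : ℂ)
        - (2 * δ : ℝ) * Complex.I := by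
      rw [hX', hY']; push_cast; ring
    rw [h1, h2, log_norm_regularized, log_norm_regularized, logReg, Prod.fst_sub, Prod.snd_sub,
      show (x i).1 - (y j).1 - ((x i).2 - (y j).2) = (x i).1 - (x i).2 - ((y j).1 - (y j).2) by ring,
      show (x i).1 - (y j).1 + ((x i).2 - (y j).2) = (x i).1 + (x i).2 - ((y j).1 + (y j).2) by ring]
    ring
  rw [cauchyLog_ite, cauchyLog_ite]
  simp only [hlog x hx, hlog y hy, e1, e2, e3, e4, e5, hα, Finset.mul_sum, ← Finset.sum_add_distrib,
    ← Finset.sum_sub_distrib]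
  refine Finset.sum_congr rfl fun i _ => Finset.sum_congr rfl fun j _ => ?_
  ring

/-- Each coincidence of light cone coordinates is the kernel of a linear functional. The functional
is nonzero because moving a single point by `(1, 0)` changes both of its light cone coordinates by
`1`. -/
theorem ae_nondegenerate (n : ℕ) : ∀ᵐ z : (Fin n → Minkowski) × (Fin n → Minkowski),
    (∀ i j, i ≠ j → (z.1 i).1 - (z.1 i).2 ≠ (z.1 j).1 - (z.1 j).2 ∧
      (z.1 i).1 + (z.1 i).2 ≠ (z.1 j).1 + (z.1 j).2) ∧
    (∀ i j, i ≠ j → (z.2 i).1 - (z.2 i).2 ≠ (z.2 j).1 - (z.2 j).2 ∧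
      (z.2 i).1 + (z.2 i).2 ≠ (z.2 j).1 + (z.2 j).2) ∧
    (∀ i j, (z.1 i).1 - (z.1 i).2 ≠ (z.2 j).1 - (z.2 j).2 ∧
      (z.1 i).1 + (z.1 i).2 ≠ (z.2 j).1 + (z.2 j).2) := by
  let E := (Fin n → Minkowski) × (Fin n → Minkowski)
  let μ : Measure E := volume
  have h0 : (volume : Measure Minkowski).IsAddHaarMeasure :=
    Measure.prod.instIsAddHaarMeasure (volume : Measure ℝ) (volume : Measure ℝ)
  have h1 : (volume : Measure (Fin n → Minkowski)).IsAddHaarMeasure :=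
    Measure.pi.isAddHaarMeasure (fun _ : Fin n => (volume : Measure Minkowski))
  have hμ : μ.IsAddHaarMeasure :=
    Measure.prod.instIsAddHaarMeasure (volume : Measure (Fin n → Minkowski)) volume
  let x (i : Fin n) : E →ₗ[ℝ] Minkowski := LinearMap.proj i ∘ₗ LinearMap.fst ℝ _ _
  let y (i : Fin n) : E →ₗ[ℝ] Minkowski := LinearMap.proj i ∘ₗ LinearMap.snd ℝ _ _
  let u : Minkowski →ₗ[ℝ] ℝ := LinearMap.fst ℝ _ _ - LinearMap.snd ℝ _ _
  let v : Minkowski →ₗ[ℝ] ℝ := LinearMap.fst ℝ _ _ + LinearMap.snd ℝ _ _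
  have key (l : Minkowski →ₗ[ℝ] ℝ) (hl : l (1, 0) = 1) (p q : E →ₗ[ℝ] Minkowski) (z : E)
      (hp : p z = (1, 0)) (hq : q z = 0) : ∀ᵐ z : E, l (p z) ≠ l (q z) := by
    filter_upwards [ae_linear_ne_zero μ (l ∘ₗ (p - q)) z (by simp [hp, hq, hl])] with w hw h
    exact hw (by simp [h])
  have hu : u (1, 0) = 1 := by simp [u]
  have hv : v (1, 0) = 1 := by simp [v]
  rw [eventually_and, eventually_and]
  refine ⟨ae_all_iff.2 fun i => ae_all_iff.2 fun j => ?_, ae_all_iff.2 fun i => ae_all_iff.2 fun j => ?_,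
    ae_all_iff.2 fun i => ae_all_iff.2 fun j => ?_⟩
  · rcases eq_or_ne i j with rfl | hij
    · simp
    have hz : (x i (Pi.single i (1, 0), 0) = (1, 0)) ∧ x j (Pi.single i (1, 0), 0) = 0 :=
      ⟨Pi.single_eq_same (M := fun _ : Fin n => Minkowski) i (1, 0),
        Pi.single_eq_of_ne (M := fun _ : Fin n => Minkowski) hij.symm (1, 0)⟩
    filter_upwards [key u hu (x i) (x j) _ hz.1 hz.2, key v hv (x i) (x j) _ hz.1 hz.2]
      with z h1 h2 _ using ⟨h1, h2⟩
  · rcases eq_or_ne i j with rfl | hij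
    · simp
    have hz : (y i (0, Pi.single i (1, 0)) = (1, 0)) ∧ y j (0, Pi.single i (1, 0)) = 0 :=
      ⟨Pi.single_eq_same (M := fun _ : Fin n => Minkowski) i (1, 0),
        Pi.single_eq_of_ne (M := fun _ : Fin n => Minkowski) hij.symm (1, 0)⟩
    filter_upwards [key u hu (y i) (y j) _ hz.1 hz.2, key v hv (y i) (y j) _ hz.1 hz.2]
      with z h1 h2 _ using ⟨h1, h2⟩
  · have hz : (x i (Pi.single i (1, 0), 0) = (1, 0)) ∧ y j (Pi.single i (1, 0), 0) = 0 :=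
      ⟨Pi.single_eq_same (M := fun _ : Fin n => Minkowski) i (1, 0), rfl⟩
    filter_upwards [key u hu (x i) (y j) _ hz.1 hz.2, key v hv (x i) (y j) _ hz.1 hz.2]
      with z h1 h2 using ⟨h1, h2⟩

/-- A complex distance is at least the distance of the real parts, so the imaginary displacements
drop out. This makes the estimates uniform in the regularization. -/
theorem ofReal_exp_cauchyLog_le {n : ℕ} {ι : Type} [Fintype ι] {π : ι → Fin n → Fin n}
    (hπ : ∀ a b : Fin n → ℂ, Function.Injective a → Function.Injective b →
      (∀ i j, a i ≠ b j) → Real.exp (cauchyLog a b) ≤ ∑ s, ∏ i, ‖a i - b (π s i)‖⁻¹)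
    (a b : Fin n → ℂ) (a' b' : Fin n → ℝ) (ha : ∀ i, (a i).re = a' i) (hb : ∀ i, (b i).re = b' i)
    (ha' : ∀ i j, i ≠ j → a' i ≠ a' j) (hb' : ∀ i j, i ≠ j → b' i ≠ b' j)
    (hab : ∀ i j, a' i ≠ b' j) :
    ENNReal.ofReal (Real.exp (cauchyLog a b)) ≤ ∑ s, ∏ i, invPow 1 (a' i - b' (π s i)) := by
  have h := hπ a b (fun i j hij => by_contra fun hne => ha' i j hne (by rw [← ha, ← ha, hij]))
    (fun i j hij => by_contra fun hne => hb' i j hne (by rw [← hb, ← hb, hij]))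
    (fun i j hij => hab i j (by rw [← ha, ← hb, hij]))
  refine (ENNReal.ofReal_le_ofReal h).trans ?_
  rw [ENNReal.ofReal_sum_of_nonneg fun s _ => by positivity]
  refine Finset.sum_le_sum fun s _ => ?_
  rw [ENNReal.ofReal_prod_of_nonneg fun i _ => by positivity]
  refine Finset.prod_le_prod' fun i _ => ?_
  rw [invPow, ENNReal.rpow_one]
  refine ENNReal.ofReal_le_ofReal (inv_anti₀ (abs_pos.2 (sub_ne_zero.2 (hab _ _))) ?_)
  rw [← ha, ← hb, ← Complex.sub_re]
  exact Complex.abs_re_le_norm _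

/-- The points `p` all carry charge `-a` and the points `q` charge `a`, so each light cone
coordinate contributes one Cauchy determinant with the common exponent `ħ a² / 4π`. -/
theorem ofReal_exp_energy_le {n : ℕ} {ι : Type} [Fintype ι] {π : ι → Fin n → Fin n}
    (hπ : ∀ a b : Fin n → ℂ, Function.Injective a → Function.Injective b →
      (∀ i j, a i ≠ b j) → Real.exp (cauchyLog a b) ≤ ∑ s, ∏ i, ‖a i - b (π s i)‖⁻¹)
    {ħ a : ℝ} (hħ : 0 < ħ) (s : Fin n → Prop) [DecidablePred s] (α : Fin n → ℝ)
    (hα : ∀ i, α i = a * if s i then 1 else -1) (δ : ℝ) (x y p q : Fin n → Minkowski)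
    (hx : ∀ i j, i ≠ j → (x i).1 - (x i).2 ≠ (x j).1 - (x j).2 ∧ (x i).1 + (x i).2 ≠ (x j).1 + (x j).2)
    (hy : ∀ i j, i ≠ j → (y i).1 - (y i).2 ≠ (y j).1 - (y j).2 ∧ (y i).1 + (y i).2 ≠ (y j).1 + (y j).2)
    (hxy : ∀ i j, (x i).1 - (x i).2 ≠ (y j).1 - (y j).2 ∧ (x i).1 + (x i).2 ≠ (y j).1 + (y j).2)
    (hp : ∀ i, p i = if s i then y i else x i) (hq : ∀ i, q i = if s i then x i else y i) :
    ENNReal.ofReal (Real.exp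
      (ħ / (8 * Real.pi) * (∑ i, ∑ j, α i * α j * Real.log |lorentzSq (x i) (x j)|) +
      ħ / (8 * Real.pi) * (∑ i, ∑ j, α i * α j * Real.log |lorentzSq (y i) (y j)|) +
      ħ * ∑ i, ∑ j, α i * α j * logReg (2 * δ) (x i - y j))) ≤
    ((∑ r, ∏ i, invPow 1 ((p i).1 - (p i).2 - ((q (π r i)).1 - (q (π r i)).2))) *
     (∑ r, ∏ i, invPow 1 ((p i).1 + (p i).2 - ((q (π r i)).1 + (q (π r i)).2)))) ^
      (ħ * a ^ 2 / (4 * Real.pi)) := by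
  rw [exp_energy_eq ħ a s α hα δ x y hx hy _ _ _ _ (fun _ => rfl) (fun _ => rfl) (fun _ => rfl)
    (fun _ => rfl), mul_comm, Real.exp_mul, ← ENNReal.ofReal_rpow_of_pos (Real.exp_pos _), Real.exp_add,
    ENNReal.ofReal_mul (Real.exp_pos _).le]
  refine ENNReal.rpow_le_rpow ?_ (by positivity)
  refine mul_le_mul' ?_ ?_
  · refine ofReal_exp_cauchyLog_le hπ _ _ (fun i => (p i).1 - (p i).2) (fun i => (q i).1 - (q i).2)
      (fun i => ?_) (fun i => ?_) (fun i j hij => ?_) (fun i j hij => ?_) (fun i j => ?_)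
    · by_cases hi : s i <;> simp [hp, hi]
    · by_cases hi : s i <;> simp [hq, hi]
    · by_cases hi : s i <;> by_cases hj : s j <;> simp only [hp, hi, hj, if_true, if_false]
      exacts [(hy i j hij).1, (hxy j i).1.symm, (hxy i j).1, (hx i j hij).1]
    · by_cases hi : s i <;> by_cases hj : s j <;> simp only [hq, hi, hj, if_true, if_false]
      exacts [(hx i j hij).1, (hxy i j).1, (hxy j i).1.symm, (hy i j hij).1]
    · by_cases hi : s i <;> by_cases hj : s j <;> simp only [hp, hq, hi, hj, if_true, if_false]
      · exact (hxy j i).1.symm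
      · exact (hy i j (by rintro rfl; exact hj hi)).1
      · exact (hx i j (by rintro rfl; exact hi hj)).1
      · exact (hxy i j).1
  · refine ofReal_exp_cauchyLog_le hπ _ _ (fun i => (p i).1 + (p i).2) (fun i => (q i).1 + (q i).2)
      (fun i => ?_) (fun i => ?_) (fun i j hij => ?_) (fun i j hij => ?_) (fun i j => ?_)
    · by_cases hi : s i <;> simp [hp, hi]
    · by_cases hi : s i <;> simp [hq, hi]
    · by_cases hi : s i <;> by_cases hj : s j <;> simp only [hp, hi, hj, if_true, if_false]
      exacts [(hy i j hij).2, (hxy j i).2.symm, (hxy i j).2, (hx i j hij).2]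
    · by_cases hi : s i <;> by_cases hj : s j <;> simp only [hq, hi, hj, if_true, if_false]
      exacts [(hx i j hij).2, (hxy i j).2, (hxy j i).2.symm, (hy i j hij).2]
    · by_cases hi : s i <;> by_cases hj : s j <;> simp only [hp, hq, hi, hj, if_true, if_false]
      · exact (hxy j i).2.symm
      · exact (hy i j (by rintro rfl; exact hj hi)).2
      · exact (hx i j (by rintro rfl; exact hi hj)).2
      · exact (hxy i j).2

/-- Hölder's inequality for the measure with density `∏ |g|`, applied to `D ^ β` and `1`. As `β p ≤
1`, the power `β p` of a sum is at most the sum of the powers; the two determinants give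
`(Fintype.card ι)²` integrals, each covered by `lintegral_prod_invPow_le`. The second factor is the
total mass. -/
theorem lintegral_neutral_le (g : TestDensity) {β p q : ℝ} (hpq : p.HolderConjugate q)
    (hβ : 0 < β) (hβp : β * p ≤ 1) {K : ENNReal}
    (hK : ∀ s t : ℝ, ∫⁻ z : Minkowski, ‖g z‖ₑ *
      (invPow (β * p) (z.1 - z.2 - s) * invPow (β * p) (z.1 + z.2 - t)) ≤ K)
    {n : ℕ} {ι : Type} [Fintype ι] (π : ι → Fin n → Fin n) :
    ∫⁻ z : (Fin n → Minkowski) × (Fin n → Minkowski), ((∏ i, ‖g (z.1 i)‖ₑ) * ∏ i, ‖g (z.2 i)‖ₑ) *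
      ((∑ r, ∏ i, invPow 1 ((z.1 i).1 - (z.1 i).2 - ((z.2 (π r i)).1 - (z.2 (π r i)).2))) *
     (∑ r, ∏ i, invPow 1 ((z.1 i).1 + (z.1 i).2 - ((z.2 (π r i)).1 + (z.2 (π r i)).2)))) ^ β ≤
    ((Fintype.card ι : ENNReal) ^ 2 * (K * ∫⁻ z, ‖g z‖ₑ) ^ n) ^ (1 / p) *
      (((∫⁻ z, ‖g z‖ₑ) ^ 2) ^ n) ^ (1 / q) := by
  have hg : Measurable fun z => ‖g z‖ₑ := g.continuous.enorm.measurable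
  have hγ : 0 < β * p := mul_pos hβ hpq.pos
  let w (z : (Fin n → Minkowski) × (Fin n → Minkowski)) : ENNReal :=
    (∏ i, ‖g (z.1 i)‖ₑ) * ∏ i, ‖g (z.2 i)‖ₑ
  let D (z : (Fin n → Minkowski) × (Fin n → Minkowski)) : ENNReal :=
    (∑ r, ∏ i, invPow 1 ((z.1 i).1 - (z.1 i).2 - ((z.2 (π r i)).1 - (z.2 (π r i)).2))) *
     (∑ r, ∏ i, invPow 1 ((z.1 i).1 + (z.1 i).2 - ((z.2 (π r i)).1 + (z.2 (π r i)).2)))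
  have hw : Measurable w := by fun_prop
  have hD : Measurable D := by fun_prop
  have h1 := ENNReal.lintegral_mul_le_Lp_mul_Lq (volume.withDensity w) hpq (f := fun z => D z ^ β)
    (g := fun _ => 1) (hD.pow_const β).aemeasurable aemeasurable_const
  have h2 : ∫⁻ z, w z * D z ^ β = ∫⁻ z, D z ^ β * 1 ∂(volume.withDensity w) := by
    simp only [mul_one]
    rw [lintegral_withDensity_eq_lintegral_mul _ hw (hD.pow_const β)]
    rfl
  refine (le_of_eq h2).trans (h1.trans (mul_le_mul' ?_ ?_))
  · refine ENNReal.rpow_le_rpow ?_ (by have := hpq.pos; positivity)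
    rw [lintegral_withDensity_eq_lintegral_mul _ hw ((hD.pow_const β).pow_const p)]
    have h3 (z) : (w * fun z => (D z ^ β) ^ p) z ≤ ∑ r, ∑ r', w z *
        ∏ i, (invPow (β * p) ((z.1 i).1 - (z.1 i).2 - ((z.2 (π r i)).1 - (z.2 (π r i)).2)) *
        invPow (β * p) ((z.1 i).1 + (z.1 i).2 - ((z.2 (π r' i)).1 + (z.2 (π r' i)).2))) := by
      simp only [Pi.mul_apply, ← Finset.mul_sum]
      gcongr
      rw [← ENNReal.rpow_mul, ENNReal.mul_rpow_of_nonneg _ _ hγ.le]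
      refine (mul_le_mul' (rpow_sum_le _ _ hγ hβp) (rpow_sum_le _ _ hγ hβp)).trans (le_of_eq ?_)
      simp only [prod_invPow_one_rpow _ hγ.le, Finset.sum_mul_sum, Finset.prod_mul_distrib]
    refine (lintegral_mono h3).trans ?_
    rw [lintegral_finsetSum _ fun r _ => by fun_prop]
    have h4 (r : ι) : ∫⁻ z, ∑ r', w z *
        ∏ i, (invPow (β * p) ((z.1 i).1 - (z.1 i).2 - ((z.2 (π r i)).1 - (z.2 (π r i)).2)) *
        invPow (β * p) ((z.1 i).1 + (z.1 i).2 - ((z.2 (π r' i)).1 + (z.2 (π r' i)).2))) ≤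
        Fintype.card ι * (K * ∫⁻ z, ‖g z‖ₑ) ^ n := by
      rw [lintegral_finsetSum _ fun r _ => by fun_prop]
      refine (Finset.sum_le_sum fun r' _ => lintegral_prod_invPow_le g hK (π r) (π r')).trans
        (le_of_eq ?_)
      simp
    refine (Finset.sum_le_sum fun r _ => h4 r).trans (le_of_eq ?_)
    simp only [Finset.sum_const, Finset.card_univ, nsmul_eq_mul]
    ring
  · refine ENNReal.rpow_le_rpow (le_of_eq ?_) (by have := hpq.symm.pos; positivity)
    simp only [ENNReal.one_rpow, lintegral_one, withDensity_apply _ MeasurableSet.univ,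
      Measure.restrict_univ, w]
    have hgp : Measurable fun x : Fin n → Minkowski => ∏ i, ‖g (x i)‖ₑ := by fun_prop
    have h5 := lintegral_prod_mul (μ := (volume : Measure (Fin n → Minkowski)))
      (ν := (volume : Measure (Fin n → Minkowski)))
      (f := fun x => ∏ i, ‖g (x i)‖ₑ) (g := fun x => ∏ i, ‖g (x i)‖ₑ) hgp.aemeasurable hgp.aemeasurable
    refine h5.trans ?_
    rw [lintegral_prod_fin n (fun _ z => ‖g z‖ₑ) fun _ => hg]
    simp only [Finset.prod_const, Finset.card_univ, Fintype.card_fin]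
    ring

theorem enorm_kernel_mul (g : TestDensity) (ħ : ℝ) (σ : ℤˣ) {n : ℕ} (α : Fin n → ℝ)
    (x : Fin n → Minkowski) :
    ‖timeOrderedKernel ħ σ α x * ∏ j, (g (x j) : ℂ)‖ₑ =
      ENNReal.ofReal (Real.exp (ħ / (8 * Real.pi) *
        ∑ i, ∑ j, α i * α j * Real.log |lorentzSq (x i) (x j)|)) * ∏ j, ‖g (x j)‖ₑ := by
  rw [enorm_mul, ← ofReal_norm (timeOrderedKernel ħ σ α x), norm_timeOrderedKernel]
  congr 1
  rw [← ofReal_norm, norm_prod, ENNReal.ofReal_prod_of_nonneg fun _ _ => norm_nonneg _]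
  refine Finset.prod_congr rfl fun j _ => ?_
  rw [Complex.norm_real, ofReal_norm]

theorem prod_eq_zero_of_not_forall_mem (g : TestDensity) {n : ℕ} {x : Fin n → Minkowski}
    (h : ¬∀ i, x i ∈ tsupport g) : ∏ j, (g (x j) : ℂ) = 0 := by
  obtain ⟨i, hi⟩ := not_forall.1 h
  refine Finset.prod_eq_zero (Finset.mem_univ i) ?_
  rw [image_eq_zero_of_notMem_tsupport hi, Complex.ofReal_zero]

/-- The central estimate. The constant depends neither on `δ` nor on the order, the charges or the
sign `σ`. -/
theorem exists_lintegral_kernel_le {ħ a p : ℝ} (hħ : 0 < ħ) (ha : 0 < a) (hp : 1 < p)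
    (hp' : p < 4 * Real.pi / (ħ * a ^ 2)) (g : TestDensity) :
    ∃ C : ℝ, 0 < C ∧ ∀ (σ : ℤˣ) (n : ℕ) (α : Fin n → ℝ), (∀ i, α i = a ∨ α i = -a) → ∀ δ : ℝ,
      ∫⁻ z : (Fin n → Minkowski) × (Fin n → Minkowski),
        ‖timeOrderedKernel ħ σ α z.1 * ∏ j, (g (z.1 j) : ℂ)‖ₑ *
        ‖timeOrderedKernel ħ σ α z.2 * ∏ j, (g (z.2 j) : ℂ)‖ₑ *
        ENNReal.ofReal (Real.exp (ħ * ∑ i, ∑ j, α i * α j * logReg (2 * δ) (z.1 i - z.2 j))) ≤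
      ENNReal.ofReal ((C ^ n * (n ! : ℝ) ^ (1 / p)) ^ 2) := by
  have hpq := Real.HolderConjugate.conjExponent hp
  set q := p.conjExponent
  have hpi := Real.pi_pos
  have hβ : 0 < ħ * a ^ 2 / (4 * Real.pi) := by positivity
  have hβp : ħ * a ^ 2 / (4 * Real.pi) * p < 1 := by
    rw [lt_div_iff₀ (by positivity)] at hp'
    rw [div_mul_eq_mul_div, div_lt_one (by positivity)]
    linarith
  set β := ħ * a ^ 2 / (4 * Real.pi)
  have hp0 : 0 < p := hpq.pos
  have hq0 : 0 < q := hpq.symm.pos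
  obtain ⟨K, hK, hKs⟩ := exists_lintegral_invPow_le g (mul_pos hβ hp0).le hβp
  have hI : ∫⁻ z, ‖g z‖ₑ ≠ ⊤ :=
    (g.continuous.integrable_of_hasCompactSupport g.hasCompactSupport (μ := volume)).2.ne
  set I := ∫⁻ z, ‖g z‖ₑ
  -- The bound of `lintegral_neutral_le` is `((n!)²)^(1/p) * B ^ n`.
  let B : ENNReal := (K * I) ^ (1 / p) * (I ^ 2) ^ (1 / q)
  have hB : B ≠ ⊤ := ENNReal.mul_ne_top
    (ENNReal.rpow_ne_top_of_nonneg (by positivity) (ENNReal.mul_ne_top hK hI))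
    (ENNReal.rpow_ne_top_of_nonneg (by positivity) (ENNReal.pow_ne_top hI))
  -- The claim has `C ^ (2 * n)` on the right, and `B ≤ (B + 1)²`; adding `1` also ensures
  -- positivity.
  refine ⟨B.toReal + 1, by positivity, fun σ n α hα δ => ?_⟩
  have hBC : B ≤ ENNReal.ofReal ((B.toReal + 1) ^ 2) := by
    rw [← ENNReal.ofReal_toReal hB]
    refine ENNReal.ofReal_le_ofReal ?_
    rw [ENNReal.toReal_ofReal ENNReal.toReal_nonneg]
    nlinarith [B.toReal_nonneg]
  obtain ⟨ι, hι, π, hcard, hπ⟩ := exists_exp_cauchyLog_le n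
  classical
  let s (i : Fin n) : Prop := α i = a
  have hαs (i) : α i = a * if s i then 1 else -1 := by
    by_cases hi : s i
    · rw [if_pos hi, mul_one]
      exact hi
    · rw [if_neg hi, (hα i).resolve_left hi, mul_neg_one]
  let F (z : (Fin n → Minkowski) × (Fin n → Minkowski)) : ENNReal :=
    ((∏ i, ‖g (z.1 i)‖ₑ) * ∏ i, ‖g (z.2 i)‖ₑ) *
      ((∑ r, ∏ i, invPow 1 ((z.1 i).1 - (z.1 i).2 - ((z.2 (π r i)).1 - (z.2 (π r i)).2))) *
     (∑ r, ∏ i, invPow 1 ((z.1 i).1 + (z.1 i).2 - ((z.2 (π r i)).1 + (z.2 (π r i)).2)))) ^ β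
  have hF : Measurable F := by
    have hg : Measurable fun z => ‖g z‖ₑ := g.continuous.enorm.measurable
    fun_prop
  have h1 : ∫⁻ z, F z ≤ ENNReal.ofReal (((B.toReal + 1) ^ n * (n ! : ℝ) ^ (1 / p)) ^ 2) := by
    refine (lintegral_neutral_le g hpq hβ hβp.le hKs π).trans ?_
    rw [hcard, ENNReal.mul_rpow_of_nonneg _ _ (by positivity), mul_assoc,
      mul_pow ((B.toReal + 1) ^ n), ENNReal.ofReal_mul (by positivity), mul_comm]
    refine mul_le_mul' ?_ (le_of_eq ?_)
    · rw [pow_right_comm (B.toReal + 1) n 2, ENNReal.ofReal_pow (by positivity),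
        ← ENNReal.rpow_natCast_mul, ← ENNReal.rpow_natCast_mul, mul_comm (n : ℝ), mul_comm (n : ℝ),
        ENNReal.rpow_mul_natCast, ENNReal.rpow_mul_natCast, ← mul_pow]
      gcongr
    · rw [← ENNReal.rpow_natCast_mul, mul_comm ((2 : ℕ) : ℝ), ENNReal.rpow_mul_natCast,
        ENNReal.ofReal_pow (by positivity), ← ENNReal.ofReal_rpow_of_nonneg (by positivity)
        (by positivity), ENNReal.ofReal_natCast]
  refine le_trans ?_ h1
  -- Pull the integral of `F` back along the exchange; its weight `∏ |g|` is invariant, so only the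
  -- energies remain to be compared, almost everywhere.
  rw [← (measurePreserving_exchange s).lintegral_comp hF]
  refine lintegral_mono_ae ?_
  filter_upwards [ae_nondegenerate n] with z hz
  have h2 := ofReal_exp_energy_le hπ hħ s α hαs δ z.1 z.2 (fun i => if s i then z.2 i else z.1 i)
    (fun i => if s i then z.1 i else z.2 i) hz.1 hz.2.1 hz.2.2 (fun _ => rfl) fun _ => rfl
  have h3 : (∏ i, ‖g (if s i then z.2 i else z.1 i)‖ₑ) * ∏ i, ‖g (if s i then z.1 i else z.2 i)‖ₑ =
      (∏ i, ‖g (z.1 i)‖ₑ) * ∏ i, ‖g (z.2 i)‖ₑ := by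
    rw [← Finset.prod_mul_distrib, ← Finset.prod_mul_distrib]
    refine Finset.prod_congr rfl fun i _ => ?_
    by_cases hi : s i
    · simp only [hi, if_true, mul_comm]
    · simp only [hi, if_false]
  simp only [F, h3]
  refine le_trans (le_of_eq ?_) (mul_le_mul_right h2 _)
  rw [enorm_kernel_mul, enorm_kernel_mul, Real.exp_add, Real.exp_add,
    ENNReal.ofReal_mul (by positivity), ENNReal.ofReal_mul (by positivity)]
  ring

theorem measurable_timeOrderedKernel (ħ : ℝ) (σ : ℤˣ) {n : ℕ} (α : Fin n → ℝ) :
    Measurable (timeOrderedKernel ħ σ α) := by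
  have h : ∀ i j, Measurable fun x : Fin n → Minkowski => feynman σ (x i) (x j) := by
    intro i j
    have h1 : Measurable fun x : Fin n → Minkowski => lorentzSq (x i) (x j) := by
      unfold lorentzSq
      fun_prop
    unfold feynman
    refine measurable_const.mul (Measurable.add ?_ ?_)
    · simp only [← Real.norm_eq_abs]
      fun_prop
    · exact Measurable.ite (measurableSet_lt measurable_const h1) measurable_const measurable_const
  unfold timeOrderedKernel
  fun_prop

theorem exists_logReg_bound (g : TestDensity) :
    ∃ L : ℝ, 0 ≤ L ∧ ∀ x ∈ tsupport g, ∀ y ∈ tsupport g, |logReg 1 (x - y)| ≤ L := by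
  have hc : Continuous (logReg 1) := by
    unfold logReg
    have h1 : ∀ w : ℝ, w ^ 2 + 1 ^ 2 ≠ 0 := fun w => by positivity
    exact continuous_const.mul ((Continuous.log (by fun_prop) fun z => h1 _).add
      (Continuous.log (by fun_prop) fun z => h1 _))
  have hK := g.hasCompactSupport.isCompact.prod g.hasCompactSupport.isCompact
  obtain ⟨L, hL⟩ := hK.exists_bound_of_continuousOn (f := fun z => logReg 1 (z.1 - z.2))
    (Continuous.continuousOn (by fun_prop))
  exact ⟨|L|, abs_nonneg _, fun x hx y hy => (hL (x, y) ⟨hx, hy⟩).trans (le_abs_self L)⟩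

/-- The charges `α` alone need not be neutral, so the determinant bound does not apply directly. Two
copies of the kernel do form a neutral system, and with the cutoff held fixed the interaction
between the copies is bounded below on the support of `g`. The double integral thus controls the
square of the integral of the modulus. -/
theorem integrable_kernel {ħ a : ℝ} (hħ : 0 < ħ) (ha : 0 < a) (huv : ħ * a ^ 2 < 4 * Real.pi)
    (g : TestDensity) (σ : ℤˣ) {n : ℕ} (α : Fin n → ℝ) (hα : ∀ i, α i = a ∨ α i = -a) :
    Integrable (fun x : Fin n → Minkowski => timeOrderedKernel ħ σ α x * ∏ j, (g (x j) : ℂ)) := by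
  have hm : Measurable fun x : Fin n → Minkowski =>
      timeOrderedKernel ħ σ α x * ∏ j, (g (x j) : ℂ) := by
    have := measurable_timeOrderedKernel ħ σ α
    have := g.continuous.measurable
    fun_prop
  refine ⟨hm.aestronglyMeasurable, ?_⟩
  obtain ⟨p, hp, hp'⟩ := exists_between ((one_lt_div (by positivity)).2 huv)
  obtain ⟨C, hC, h⟩ := exists_lintegral_kernel_le hħ ha hp hp' g
  -- With `δ = 1/2` the cutoff length `2 * δ` is `1`, and `logReg 1` is continuous.
  have h1 := h σ n α hα (1 / 2)
  obtain ⟨L, hL0, hL⟩ := exists_logReg_bound g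
  set F := fun x : Fin n → Minkowski => timeOrderedKernel ħ σ α x * ∏ j, (g (x j) : ℂ)
  set c := ENNReal.ofReal (Real.exp (-(ħ * ∑ _i : Fin n, ∑ _j : Fin n, a ^ 2 * L)))
  have h2 (z : (Fin n → Minkowski) × (Fin n → Minkowski)) : ‖F z.1‖ₑ * ‖F z.2‖ₑ * c ≤
      ‖F z.1‖ₑ * ‖F z.2‖ₑ * ENNReal.ofReal
        (Real.exp (ħ * ∑ i, ∑ j, α i * α j * logReg (2 * (1 / 2)) (z.1 i - z.2 j))) := by
    by_cases hz : (∀ i, z.1 i ∈ tsupport g) ∧ ∀ i, z.2 i ∈ tsupport g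
    · refine mul_le_mul_right (ENNReal.ofReal_le_ofReal (Real.exp_le_exp.2 ?_)) _
      rw [← mul_neg, ← Finset.sum_neg_distrib]
      refine mul_le_mul_of_nonneg_left (Finset.sum_le_sum fun i _ => ?_) hħ.le
      rw [← Finset.sum_neg_distrib]
      refine Finset.sum_le_sum fun j _ => neg_le_of_abs_le ?_
      have ha' (i) : |α i| = a := by
        rcases hα i with h | h <;> simp [h, abs_of_pos ha]
      rw [abs_mul, abs_mul, ha', ha', ← sq, show (2 : ℝ) * (1 / 2) = 1 by norm_num]
      exact mul_le_mul_of_nonneg_left (hL _ (hz.1 i) _ (hz.2 j)) (sq_nonneg a)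
    · have h0 : ‖F z.1‖ₑ * ‖F z.2‖ₑ = 0 := by
        rcases not_and_or.1 hz with h | h <;> simp [F, prod_eq_zero_of_not_forall_mem g h]
      simp [h0]
  have h3 := (lintegral_mono h2).trans h1
  rw [lintegral_mul_const _ (by fun_prop)] at h3
  have h4 : ∫⁻ z : (Fin n → Minkowski) × (Fin n → Minkowski), ‖F z.1‖ₑ * ‖F z.2‖ₑ =
      (∫⁻ x, ‖F x‖ₑ) * ∫⁻ x, ‖F x‖ₑ :=
    lintegral_prod_mul (f := fun x => ‖F x‖ₑ) (g := fun x => ‖F x‖ₑ) hm.enorm.aemeasurable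
      hm.enorm.aemeasurable
  rw [h4] at h3
  have hc0 : c ≠ 0 := (ENNReal.ofReal_pos.2 (Real.exp_pos _)).ne'
  rw [HasFiniteIntegral, lt_top_iff_ne_top]
  intro htop
  rw [htop, ENNReal.top_mul_top, ENNReal.top_mul hc0, top_le_iff] at h3
  exact ENNReal.ofReal_ne_top h3

/-! ### Convolution with locally integrable kernels -/

theorem locallyIntegrable_norm {E : Type*} [TopologicalSpace E] [MeasurableSpace E] {μ : Measure E}
    {κ : E → ℝ} (hκ : LocallyIntegrable κ μ) : LocallyIntegrable (fun z => ‖κ z‖) μ := fun x =>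
  (hκ x).norm

/-- The convolution `∫ κ(x - y) h(y) dy`. -/
def conv (κ h : Minkowski → ℝ) (x : Minkowski) : ℝ := ∫ y, κ (x - y) * h y

theorem integrable_conv {κ h : Minkowski → ℝ} (hκ : LocallyIntegrable κ) (hc : Continuous h)
    (hs : HasCompactSupport h) (x : Minkowski) : Integrable fun y => κ (x - y) * h y := by
  have h1 : ConvolutionExistsAt κ h x (ContinuousLinearMap.mul ℝ ℝ) volume :=
    hs.convolutionExists_right (ContinuousLinearMap.mul ℝ ℝ) hκ hc x
  have h2 := Integrable.comp_sub_left h1 x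
  simpa using h2

theorem conv_eq_convolution (κ h : Minkowski → ℝ) :
    conv κ h = convolution κ h (ContinuousLinearMap.mul ℝ ℝ) volume := by
  funext x
  rw [conv, convolution_def, ← integral_sub_left_eq_self _ volume x]
  simp

theorem continuous_conv {κ h : Minkowski → ℝ} (hκ : LocallyIntegrable κ) (hc : Continuous h)
    (hs : HasCompactSupport h) : Continuous (conv κ h) := by
  rw [conv_eq_convolution]
  exact hs.continuous_convolution_right (ContinuousLinearMap.mul ℝ ℝ) hκ hc

theorem integrable_mul_conv {κ f h : Minkowski → ℝ} (hm : Measurable κ) (hκ : LocallyIntegrable κ)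
    (hc : Continuous h) (hs : HasCompactSupport h) (hcf : Continuous f) (hsf : HasCompactSupport f) :
    Integrable fun z : Minkowski × Minkowski => f z.1 * (κ (z.1 - z.2) * h z.2) := by
  have hme : Measurable fun z : Minkowski × Minkowski => f z.1 * (κ (z.1 - z.2) * h z.2) := by
    have := hcf.measurable
    have := hc.measurable
    fun_prop
  rw [Measure.volume_eq_prod, integrable_prod_iff hme.aestronglyMeasurable]
  refine ⟨Eventually.of_forall fun x => (integrable_conv hκ hc hs x).const_mul (f x), ?_⟩
  have h1 : (fun x => ∫ y, ‖f x * (κ (x - y) * h y)‖) =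
      fun x => ‖f x‖ * conv (fun z => ‖κ z‖) (fun z => ‖h z‖) x := by
    funext x
    simp only [norm_mul, conv, integral_const_mul]
  simp only [h1]
  refine Continuous.integrable_of_hasCompactSupport ?_ hsf.norm.mul_right
  exact hcf.norm.mul (continuous_conv (locallyIntegrable_norm hκ) hc.norm hs.norm)

theorem integral_mul_conv {κ f h : Minkowski → ℝ} (hm : Measurable κ) (hκ : LocallyIntegrable κ)
    (hc : Continuous h) (hs : HasCompactSupport h) (hcf : Continuous f) (hsf : HasCompactSupport f) :
    ∫ x, f x * conv κ h x = ∫ z : Minkowski × Minkowski, f z.1 * (κ (z.1 - z.2) * h z.2) := by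
  refine Eq.trans ?_ (integral_prod _ (integrable_mul_conv hm hκ hc hs hcf hsf)).symm
  simp only [conv, integral_const_mul]

theorem integral_mul_conv_comm {κ f h : Minkowski → ℝ} (hm : Measurable κ) (hκ : LocallyIntegrable κ)
    (he : ∀ z, κ (-z) = κ z)
    (hc : Continuous h) (hs : HasCompactSupport h) (hcf : Continuous f) (hsf : HasCompactSupport f) :
    ∫ x, f x * conv κ h x = ∫ x, h x * conv κ f x := by
  rw [integral_mul_conv hm hκ hc hs hcf hsf, integral_mul_conv hm hκ hcf hsf hc hs,
    Measure.volume_eq_prod, ← integral_prod_swap]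
  refine integral_congr_ae (Eventually.of_forall fun z => ?_)
  simp only [Prod.fst_swap, Prod.snd_swap]
  rw [← he, neg_sub]
  ring

/-- The symmetric parametrix as a function of the difference of the arguments. -/
def hadamardKer (z : Minkowski) : ℝ := -(1 / (4 * Real.pi)) * Real.log |z.1 ^ 2 - z.2 ^ 2|

/-- The commutator function as a function of the difference of the arguments. -/
def commutatorKer (z : Minkowski) : ℝ :=
  -(1 / 2) * (if 0 < z.1 - |z.2| then 1 else 0) + (1 / 2) * (if 0 < -z.1 - |z.2| then 1 else 0)

/-! ### The parametrix, its regularization and the commutator function as convolution kernels. -/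

theorem hadamardForm_eq (f h : TestDensity) :
    hadamardForm f h = ∫ x, f x * conv hadamardKer h x := rfl

theorem commutatorForm_eq (f h : TestDensity) :
    commutatorForm f h = ∫ x, f x * conv commutatorKer h x := by
  unfold commutatorForm conv
  congr 1
  funext x
  congr 2
  funext y
  congr 1
  simp only [commutatorFun, commutatorKer, Prod.fst_sub, Prod.snd_sub, neg_sub]
  congr 4
  rw [show y.1 - x.1 = -x.1 + y.1 by ring]

theorem measurable_hadamardKer : Measurable hadamardKer := by
  unfold hadamardKer
  simp only [← Real.norm_eq_abs]
  fun_prop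

theorem measurable_commutatorKer : Measurable commutatorKer := by
  unfold commutatorKer
  simp only [← Real.norm_eq_abs]
  refine (measurable_const.mul (Measurable.ite ?_ measurable_const measurable_const)).add
    (measurable_const.mul (Measurable.ite ?_ measurable_const measurable_const))
  · exact measurableSet_lt measurable_const (by fun_prop)
  · exact measurableSet_lt measurable_const (by fun_prop)

theorem measurable_logReg (δ : ℝ) : Measurable (logReg δ) := by
  unfold logReg
  fun_prop

theorem locallyIntegrable_commutatorKer : LocallyIntegrable commutatorKer := by
  have h : LocallyIntegrable (fun _ : Minkowski => (1 : ℝ)) := locallyIntegrable_const 1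
  refine h.mono measurable_commutatorKer.aestronglyMeasurable (Eventually.of_forall fun z => ?_)
  unfold commutatorKer
  split_ifs <;> norm_num

/-- A bound of `log (w² + δ²)` for `|δ| ≤ 1`. -/
def logDom (w : ℝ) : ℝ := |Real.log (w ^ 2)| + Real.log (w ^ 2 + 1)

theorem abs_log_le_logDom {w : ℝ} (hw : w ≠ 0) {δ : ℝ} (hδ : δ ^ 2 ≤ 1) :
    |Real.log (w ^ 2 + δ ^ 2)| ≤ logDom w := by
  have h0 : 0 < w ^ 2 := by positivity
  have h1 : Real.log (w ^ 2) ≤ Real.log (w ^ 2 + δ ^ 2) :=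
    Real.log_le_log h0 (by nlinarith [sq_nonneg δ])
  have h2 : Real.log (w ^ 2 + δ ^ 2) ≤ Real.log (w ^ 2 + 1) :=
    Real.log_le_log (by positivity) (by linarith)
  have h3 : 0 ≤ Real.log (w ^ 2 + 1) := Real.log_nonneg (by linarith)
  have h4 := neg_abs_le (Real.log (w ^ 2))
  have h5 := abs_nonneg (Real.log (w ^ 2))
  rw [logDom, abs_le]
  constructor <;> linarith

theorem locallyIntegrable_logDom : LocallyIntegrable logDom := by
  have h1 : LocallyIntegrable fun w : ℝ => Real.log (w ^ 2) := by
    rw [locallyIntegrable_iff]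
    intro K hK
    obtain ⟨R, hR⟩ := hK.isBounded.subset_closedBall (0 : ℝ)
    rw [Real.closedBall_eq_Icc] at hR
    refine IntegrableOn.mono_set ?_ hR
    rcases le_or_gt (0 - R) (0 + R) with h | h
    · rw [← intervalIntegrable_iff_integrableOn_Icc_of_le h]
      have := (intervalIntegral.intervalIntegrable_log' (a := 0 - R) (b := 0 + R)).const_mul 2
      refine this.congr fun w _ => ?_
      simp [Real.log_pow]
    · rw [Set.Icc_eq_empty (not_le.2 h)]
      exact integrableOn_empty
  refine (locallyIntegrable_norm h1).add (Continuous.locallyIntegrable ?_)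
  exact Continuous.log (by fun_prop) fun w => by positivity

theorem measurable_logDom : Measurable logDom := by
  unfold logDom
  simp only [← Real.norm_eq_abs]
  fun_prop

/-- A locally integrable bound of the regularized parametrices. -/
def domKer (z : Minkowski) : ℝ := 1 / (8 * Real.pi) * (logDom (z.1 - z.2) + logDom (z.1 + z.2))

/-- On a compact set both light cone coordinates are bounded, so `lintegral_lightCone` applies with
`η` cut off in one coordinate and an indicator function in the other. -/
theorem locallyIntegrable_lightCone {η : ℝ → ℝ} (hm : Measurable η) (hη : LocallyIntegrable η) :
    LocallyIntegrable (fun z : Minkowski => η (z.1 - z.2)) ∧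
      LocallyIntegrable fun z : Minkowski => η (z.1 + z.2) := by
  have key (K : Set Minkowski) (hK : IsCompact K) : ∃ R, ∀ z ∈ K,
      z.1 - z.2 ∈ Set.Icc (-R) R ∧ z.1 + z.2 ∈ Set.Icc (-R) R := by
    obtain ⟨R, hR⟩ := hK.isBounded.subset_closedBall (0 : Minkowski)
    refine ⟨2 * R, fun z hz => ?_⟩
    have hz' := hR hz
    rw [mem_closedBall_zero_iff, Prod.norm_def, max_le_iff, Real.norm_eq_abs, Real.norm_eq_abs,
        abs_le, abs_le] at hz'
    exact ⟨⟨by linarith, by linarith⟩, ⟨by linarith, by linarith⟩⟩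
  have hfin (R : ℝ) : ∫⁻ w, (Set.Icc (-R) R).indicator (fun w => ‖η w‖ₑ) w ≠ ⊤ := by
    rw [lintegral_indicator measurableSet_Icc]
    exact (hη.integrableOn_isCompact isCompact_Icc).2.ne
  have hone (R : ℝ) : ∫⁻ w, (Set.Icc (-R) R).indicator (fun _ => (1 : ENNReal)) w ≠ ⊤ := by
    rw [lintegral_indicator measurableSet_Icc, lintegral_one]
    simp
  have m1 (R : ℝ) : Measurable ((Set.Icc (-R) R).indicator fun w => ‖η w‖ₑ) :=
    hm.enorm.indicator measurableSet_Icc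
  have m2 (R : ℝ) : Measurable ((Set.Icc (-R) R).indicator fun _ => (1 : ENNReal)) :=
    measurable_const.indicator measurableSet_Icc
  constructor
  · rw [locallyIntegrable_iff]
    intro K hK
    refine ⟨(by fun_prop : Measurable fun z : Minkowski => η (z.1 - z.2)).aestronglyMeasurable, ?_⟩
    obtain ⟨R, hR⟩ := key K hK
    rw [HasFiniteIntegral, lt_top_iff_ne_top]
    refine ne_top_of_le_ne_top (ENNReal.mul_ne_top (hfin R)
      (ENNReal.mul_ne_top (ENNReal.ofReal_ne_top (r := 1 / 2)) (hone R))) ?_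
    rw [← lintegral_lightCone _ _ (m1 R) (m2 R), ← lintegral_indicator hK.measurableSet]
    refine lintegral_mono fun z => ?_
    by_cases hz : z ∈ K
    · rw [Set.indicator_of_mem hz, Set.indicator_of_mem (hR z hz).1,
        Set.indicator_of_mem (hR z hz).2, mul_one]
    · rw [Set.indicator_of_notMem hz]
      exact zero_le
  · rw [locallyIntegrable_iff]
    intro K hK
    refine ⟨(by fun_prop : Measurable fun z : Minkowski => η (z.1 + z.2)).aestronglyMeasurable, ?_⟩
    obtain ⟨R, hR⟩ := key K hK
    rw [HasFiniteIntegral, lt_top_iff_ne_top]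
    refine ne_top_of_le_ne_top (ENNReal.mul_ne_top (hone R)
      (ENNReal.mul_ne_top (ENNReal.ofReal_ne_top (r := 1 / 2)) (hfin R))) ?_
    rw [← lintegral_lightCone _ _ (m2 R) (m1 R), ← lintegral_indicator hK.measurableSet]
    refine lintegral_mono fun z => ?_
    by_cases hz : z ∈ K
    · rw [Set.indicator_of_mem hz, Set.indicator_of_mem (hR z hz).1,
        Set.indicator_of_mem (hR z hz).2, one_mul]
    · rw [Set.indicator_of_notMem hz]
      exact zero_le

theorem locallyIntegrable_domKer : LocallyIntegrable domKer := by
  obtain ⟨h1, h2⟩ := locallyIntegrable_lightCone measurable_logDom locallyIntegrable_logDom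
  exact (h1.add h2).smul (1 / (8 * Real.pi))

theorem ae_lightCone_ne_zero : ∀ᵐ z : Minkowski, z.1 - z.2 ≠ 0 ∧ z.1 + z.2 ≠ 0 := by
  have h0 : (volume : Measure Minkowski).IsAddHaarMeasure :=
    Measure.prod.instIsAddHaarMeasure (volume : Measure ℝ) (volume : Measure ℝ)
  filter_upwards [ae_linear_ne_zero volume (LinearMap.fst ℝ ℝ ℝ - LinearMap.snd ℝ ℝ ℝ)
    ((1, 0) : Minkowski) (by simp), ae_linear_ne_zero volume (LinearMap.fst ℝ ℝ ℝ + LinearMap.snd ℝ ℝ ℝ)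
    ((1, 0) : Minkowski) (by simp)] with z h1 h2 using ⟨h1, h2⟩

theorem abs_logReg_le {z : Minkowski} (hz : z.1 - z.2 ≠ 0 ∧ z.1 + z.2 ≠ 0) {δ : ℝ} (hδ : δ ^ 2 ≤ 1) :
    |logReg δ z| ≤ domKer z := by
  have hpi := Real.pi_pos
  rw [logReg, domKer, abs_mul, abs_neg, abs_of_nonneg (by positivity : 0 ≤ 1 / (8 * Real.pi))]
  refine mul_le_mul_of_nonneg_left ((abs_add_le _ _).trans ?_) (by positivity)
  exact add_le_add (abs_log_le_logDom hz.1 hδ) (abs_log_le_logDom hz.2 hδ)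

theorem hadamardKer_eq {z : Minkowski} (hz : z.1 - z.2 ≠ 0 ∧ z.1 + z.2 ≠ 0) :
    hadamardKer z = logReg 0 z := by
  rw [hadamardKer, logReg, show z.1 ^ 2 - z.2 ^ 2 = (z.1 - z.2) * (z.1 + z.2) by ring, abs_mul,
    Real.log_mul (abs_ne_zero.2 hz.1) (abs_ne_zero.2 hz.2)]
  simp only [Real.log_abs, ne_eq, OfNat.ofNat_ne_zero, not_false_eq_true, zero_pow, add_zero, Real.log_pow]
  push_cast
  ring

theorem locallyIntegrable_hadamardKer : LocallyIntegrable hadamardKer := by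
  refine locallyIntegrable_domKer.mono measurable_hadamardKer.aestronglyMeasurable ?_
  filter_upwards [ae_lightCone_ne_zero] with z hz
  rw [hadamardKer_eq hz]
  exact (abs_logReg_le hz (by norm_num)).trans (le_abs_self _)

theorem continuous_logReg {δ : ℝ} (hδ : δ ≠ 0) : Continuous (logReg δ) := by
  unfold logReg
  have h1 : ∀ w : ℝ, w ^ 2 + δ ^ 2 ≠ 0 := fun w => by positivity
  exact continuous_const.mul ((Continuous.log (by fun_prop) fun z => h1 _).add
    (Continuous.log (by fun_prop) fun z => h1 _))

theorem tendsto_logReg {z : Minkowski} (hz : z.1 - z.2 ≠ 0 ∧ z.1 + z.2 ≠ 0) :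
    Tendsto (fun δ => logReg δ z) (𝓝 0) (𝓝 (hadamardKer z)) := by
  rw [hadamardKer_eq hz]
  have h1 := hz.1
  have h2 := hz.2
  refine ContinuousAt.tendsto (f := fun δ => logReg δ z) ?_
  unfold logReg
  refine continuousAt_const.mul (ContinuousAt.add (ContinuousAt.log (by fun_prop) ?_)
    (ContinuousAt.log (by fun_prop) ?_)) <;> positivity

theorem ae_sub_lightCone_ne_zero (x : Minkowski) :
    ∀ᵐ y : Minkowski, (x - y).1 - (x - y).2 ≠ 0 ∧ (x - y).1 + (x - y).2 ≠ 0 :=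
  (Measure.measurePreserving_sub_left volume x).quasiMeasurePreserving.ae ae_lightCone_ne_zero

theorem abs_conv_logReg_le {h : Minkowski → ℝ} (hc : Continuous h) (hs : HasCompactSupport h)
    {δ : ℝ} (hδ : δ ^ 2 ≤ 1) (x : Minkowski) :
    |conv (logReg δ) h x| ≤ conv domKer (fun y => |h y|) x := by
  rw [← Real.norm_eq_abs]
  refine norm_integral_le_of_norm_le (integrable_conv locallyIntegrable_domKer hc.norm hs.norm x) ?_
  filter_upwards [ae_sub_lightCone_ne_zero x] with y hy
  rw [norm_mul]
  exact mul_le_mul_of_nonneg_right (abs_logReg_le hy hδ) (norm_nonneg _)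

theorem tendsto_conv_logReg {h : Minkowski → ℝ} (hc : Continuous h) (hs : HasCompactSupport h)
    (x : Minkowski) :
    Tendsto (fun δ => conv (logReg δ) h x) (𝓝 0) (𝓝 (conv hadamardKer h x)) := by
  refine tendsto_integral_filter_of_dominated_convergence (fun y => domKer (x - y) * |h y|) ?_ ?_
    (integrable_conv locallyIntegrable_domKer hc.norm hs.norm x) ?_
  · refine Eventually.of_forall fun δ => ?_
    have := measurable_logReg δ
    have := hc.measurable
    exact Measurable.aestronglyMeasurable (by fun_prop)
  · filter_upwards [Icc_mem_nhds (show (-1 : ℝ) < 0 by norm_num) one_pos] with δ hδ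
    filter_upwards [ae_sub_lightCone_ne_zero x] with y hy
    rw [norm_mul]
    exact mul_le_mul_of_nonneg_right (abs_logReg_le hy (by nlinarith [hδ.1, hδ.2])) (norm_nonneg _)
  · filter_upwards [ae_sub_lightCone_ne_zero x] with y hy
    exact (tendsto_logReg hy).mul_const _

theorem tendsto_integral_mul_conv_logReg {f h : Minkowski → ℝ} (hc : Continuous h)
    (hs : HasCompactSupport h) (hcf : Continuous f) (hsf : HasCompactSupport f) :
    Tendsto (fun δ => ∫ x, f x * conv (logReg δ) h x) (𝓝 0)
      (𝓝 (∫ x, f x * conv hadamardKer h x)) := by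
  refine tendsto_integral_filter_of_dominated_convergence
    (fun x => |f x| * conv domKer (fun y => |h y|) x) ?_ ?_ ?_ ?_
  · have hne : ∀ᶠ δ : ℝ in 𝓝 0, True := Eventually.of_forall fun _ => trivial
    filter_upwards [hne] with δ _
    refine AEStronglyMeasurable.mul hcf.aestronglyMeasurable ?_
    have hm : Measurable fun z : Minkowski × Minkowski => logReg δ (z.1 - z.2) * h z.2 := by
      have := measurable_logReg δ
      have := hc.measurable
      fun_prop
    exact hm.stronglyMeasurable.integral_prod_right'.aestronglyMeasurable
  · filter_upwards [Icc_mem_nhds (show (-1 : ℝ) < 0 by norm_num) one_pos] with δ hδ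
    refine Eventually.of_forall fun x => ?_
    rw [norm_mul]
    exact mul_le_mul_of_nonneg_left (abs_conv_logReg_le hc hs (by nlinarith [hδ.1, hδ.2]) x)
      (norm_nonneg _)
  · refine Continuous.integrable_of_hasCompactSupport ?_ hsf.norm.mul_right
    exact hcf.norm.mul (continuous_conv locallyIntegrable_domKer hc.norm hs.norm)
  · exact Eventually.of_forall fun x => (tendsto_conv_logReg hc hs x).const_mul _

/-! ### Mollification -/

/-- The smeared function `∫ ρ(z) η(x + ε z) dz`. -/
def smear {E : Type*} [NormedAddCommGroup E] [NormedSpace ℝ E] (ρ : TestDensity) (η : Minkowski → E)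
    (ε : ℝ) (x : Minkowski) : E := ∫ z, ρ z • η (x + ε • z)

/-- Joint continuity includes `ε = 0`, where the smearing becomes evaluation at `x`. Removing the
smearing is then a matter of continuity. -/
theorem continuous_smear {E : Type*} [NormedAddCommGroup E] [NormedSpace ℝ E] (ρ : TestDensity)
    {η : Minkowski → E} (hη : Continuous η) :
    Continuous fun q : ℝ × Minkowski => smear ρ η q.1 q.2 := by
  have h (q : ℝ × Minkowski) : smear ρ η q.1 q.2 = ∫ z in tsupport ρ, ρ z • η (q.2 + q.1 • z) := by
    rw [setIntegral_eq_integral_of_forall_compl_eq_zero]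
    · rfl
    · intro z hz
      rw [image_eq_zero_of_notMem_tsupport hz, zero_smul]
  simp only [h]
  refine continuous_parametric_integral_of_continuous
    (f := fun (q : ℝ × Minkowski) z => ρ z • η (q.2 + q.1 • z)) ?_ ρ.hasCompactSupport.isCompact
  have := ρ.continuous
  unfold Function.uncurry
  fun_prop

theorem smear_zero {E : Type*} [NormedAddCommGroup E] [NormedSpace ℝ E] [CompleteSpace E] (ρ : TestDensity)
    (η : Minkowski → E) (x : Minkowski) : smear ρ η 0 x = (∫ z, ρ z) • η x := by
  simp only [smear, zero_smul, add_zero]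
  exact integral_smul_const _ _

theorem integral_mollifier_smul {E : Type*} [NormedAddCommGroup E] [NormedSpace ℝ E] (ρ : TestDensity)
    (η : Minkowski → E) {ε : ℝ} (hε : ε ≠ 0) (x : Minkowski) :
    ∫ y, mollifier ρ ε x y • η y = smear ρ η ε x := by
  have h0 : (volume : Measure Minkowski).IsAddHaarMeasure :=
    Measure.prod.instIsAddHaarMeasure (volume : Measure ℝ) (volume : Measure ℝ)
  have h1 (y : Minkowski) : mollifier ρ ε x y • η y =
      (fun w => ((ε ^ 2)⁻¹ * ρ (ε⁻¹ • w)) • η (x + w)) (y - x) := by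
    simp only [add_sub_cancel]
    rfl
  simp only [h1]
  rw [integral_sub_right_eq_self (fun w => ((ε ^ 2)⁻¹ * ρ (ε⁻¹ • w)) • η (x + w)) x]
  have h2 (w : Minkowski) : ((ε ^ 2)⁻¹ * ρ (ε⁻¹ • w)) • η (x + w) =
      (fun z => ((ε ^ 2)⁻¹ * ρ z) • η (x + ε • z)) (ε⁻¹ • w) := by
    simp only [smul_smul, mul_inv_cancel₀ hε, one_smul]
  simp only [h2]
  rw [Measure.integral_comp_inv_smul volume (fun z => ((ε ^ 2)⁻¹ * ρ z) • η (x + ε • z)),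
    Module.finrank_prod, Module.finrank_self, ← integral_smul]
  refine integral_congr_ae (Eventually.of_forall fun z => ?_)
  simp only [smul_smul]
  congr 1
  rw [one_add_one_eq_two, abs_of_nonneg (sq_nonneg ε), ← mul_assoc, mul_inv_cancel₀ (pow_ne_zero _ hε),
    one_mul]

theorem integral_mollifier (ρ : TestDensity) {ε : ℝ} (hε : ε ≠ 0) (x : Minkowski) :
    ∫ y, mollifier ρ ε x y = ∫ z, ρ z := by
  have := integral_mollifier_smul ρ (fun _ => (1 : ℝ)) hε x
  simpa [smear] using this

/-- The plane wave on the light cone. -/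
def planeWave (k : ℝ) (x : Minkowski) : ℂ := Complex.exp (Complex.I * ((|k| * x.1 - k * x.2 : ℝ) : ℂ))

theorem continuous_planeWave (k : ℝ) : Continuous (planeWave k) := by
  unfold planeWave
  fun_prop

theorem norm_planeWave (k : ℝ) (x : Minkowski) : ‖planeWave k x‖ = 1 := by
  rw [planeWave, mul_comm, Complex.norm_exp_ofReal_mul_I]

theorem norm_smear_planeWave_le (ρ : TestDensity) (ε : ℝ) (x : Minkowski) (k : ℝ) :
    ‖smear ρ (planeWave k) ε x‖ ≤ ∫ z, |ρ z| := by
  refine norm_integral_le_of_norm_le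
    (ρ.continuous.integrable_of_hasCompactSupport ρ.hasCompactSupport).norm ?_
  exact Eventually.of_forall fun z => by rw [norm_smul, norm_planeWave, mul_one]; exact le_rfl

/-! ### The Fourier representation of the regularized parametrix -/

theorem integrableOn_exp_cos_sub_one_div {δ : ℝ} (hδ : 0 < δ) (d : ℝ) :
    IntegrableOn (fun k => Real.exp (-δ * k) * ((Real.cos (k * d) - 1) / k)) (Set.Ioi 0) := by
  refine ((integrableOn_exp_mul_Ioi (neg_lt_zero.2 hδ) 0).mul_const |d|).mono'
    (by fun_prop : Measurable fun k => Real.exp (-δ * k) * ((Real.cos (k * d) - 1) / k)).aestronglyMeasurable ?_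
  refine (ae_restrict_mem measurableSet_Ioi).mono fun k hk => ?_
  have hk' : 0 < k := hk
  rw [norm_mul, Real.norm_eq_abs, abs_of_pos (Real.exp_pos _), norm_div, Real.norm_eq_abs,
    Real.norm_eq_abs, abs_of_pos hk']
  refine mul_le_mul_of_nonneg_left ?_ (Real.exp_pos _).le
  rw [div_le_iff₀ hk']
  have := Real.abs_cos_sub_cos_le (k * d) 0
  rw [Real.cos_zero, sub_zero, abs_mul, abs_of_pos hk'] at this
  linarith

theorem integral_exp_sin {δ : ℝ} (hδ : 0 < δ) (d : ℝ) :
    ∫ k in Set.Ioi 0, Real.exp (-δ * k) * Real.sin (k * d) = d / (d ^ 2 + δ ^ 2) := by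
  have hre : ((-δ : ℂ) + d * Complex.I).re < 0 := by simpa using hδ
  have h1 := integral_exp_mul_complex_Ioi hre 0
  have h2 := integrableOn_exp_mul_complex_Ioi hre 0
  have h3 := congrArg Complex.im h1
  have h4 := integral_im h2
  rw [RCLike.im_to_complex, h3] at h4
  have h5 (k : ℝ) : RCLike.im (Complex.exp ((-δ + d * Complex.I) * k)) =
      Real.exp (-δ * k) * Real.sin (k * d) := by
    rw [RCLike.im_to_complex, Complex.exp_im]
    simp [mul_comm]
  simp only [h5] at h4
  rw [h4]
  simp [Complex.div_im, Complex.normSq_apply]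
  ring

/-- Differentiating in `d` removes the factor `1/k` and leaves the Laplace transform of a sine; both
sides vanish at `d = 0`. Subtracting `1` from the cosine makes the integrand regular at `k = 0`. -/
theorem integral_exp_cos_sub_one_div {δ : ℝ} (hδ : 0 < δ) (d : ℝ) :
    ∫ k in Set.Ioi 0, Real.exp (-δ * k) * ((Real.cos (k * d) - 1) / k) =
      -(1 / 2) * (Real.log (d ^ 2 + δ ^ 2) - Real.log (δ ^ 2)) := by
  let F (d : ℝ) : ℝ := ∫ k in Set.Ioi 0, Real.exp (-δ * k) * ((Real.cos (k * d) - 1) / k)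
  have hF (d : ℝ) : HasDerivAt F (-(d / (d ^ 2 + δ ^ 2))) d := by
    have h := hasDerivAt_integral_of_dominated_loc_of_deriv_le (μ := volume.restrict (Set.Ioi 0))
      (F := fun d k => Real.exp (-δ * k) * ((Real.cos (k * d) - 1) / k))
      (F' := fun d k => -(Real.exp (-δ * k) * Real.sin (k * d))) (x₀ := d)
      (bound := fun k => Real.exp (-δ * k)) (s := Set.univ) Filter.univ_mem
      (Eventually.of_forall fun x => (by fun_prop : Measurable fun k =>
        Real.exp (-δ * k) * ((Real.cos (k * x) - 1) / k)).aestronglyMeasurable)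
      (integrableOn_exp_cos_sub_one_div hδ d)
      (by fun_prop : Measurable fun k => -(Real.exp (-δ * k) * Real.sin (k * d))).aestronglyMeasurable
      (Eventually.of_forall fun k x _ => ?_) (integrableOn_exp_mul_Ioi (neg_lt_zero.2 hδ) 0) ?_
    · rw [integral_neg, integral_exp_sin hδ] at h
      exact h.2
    · rw [norm_neg, norm_mul, Real.norm_eq_abs, abs_of_pos (Real.exp_pos _)]
      exact mul_le_of_le_one_right (Real.exp_pos _).le (Real.abs_sin_le_one _)
    · refine (ae_restrict_mem measurableSet_Ioi).mono fun k hk x _ => ?_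
      have hk' : k ≠ 0 := ne_of_gt hk
      have h1 : HasDerivAt (fun x => k * x) k x := by simpa using (hasDerivAt_id x).const_mul k
      refine (((h1.cos.sub_const 1).div_const k).const_mul (Real.exp (-δ * k))).congr_deriv ?_
      field_simp
  -- The difference of the two sides up to a constant, shown to have zero derivative.
  let G (d : ℝ) : ℝ := F d + (1 / 2) * Real.log (d ^ 2 + δ ^ 2)
  have hG (d : ℝ) : HasDerivAt G 0 d := by
    have hne : d ^ 2 + δ ^ 2 ≠ 0 := by positivity
    have h1 : HasDerivAt (fun d => d ^ 2 + δ ^ 2) (2 * d) d := by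
      simpa using (hasDerivAt_pow 2 d).add_const (δ ^ 2)
    refine ((hF d).add ((h1.log hne).const_mul (1 / 2))).congr_deriv ?_
    ring
  have h := is_const_of_deriv_eq_zero (f := G) (fun d => (hG d).differentiableAt)
    (fun d => (hG d).deriv) d 0
  have h0 : F 0 = 0 := by simp [F]
  simp only [G, h0] at h
  change F d = _
  rw [zero_pow two_ne_zero, zero_add, zero_add] at h
  linarith

/-- Positive momenta see only the coordinate `t - x`, negative momenta only `t + x`. Each half line
reduces to the one dimensional integral above. -/
theorem fourier_kernel_comp {δ : ℝ} (z : Minkowski) :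
    (∀ k ∈ Set.Ioi (0 : ℝ), Real.exp (-δ * |k|) / (4 * Real.pi * |k|) *
        (Real.cos (|k| * z.1 - k * z.2) - 1) = 1 / (4 * Real.pi) * (Real.exp (-δ * k) *
        ((Real.cos (k * (z.1 - z.2)) - 1) / k))) ∧
    (∀ k ∈ Set.Ioi (0 : ℝ), Real.exp (-δ * |-k|) / (4 * Real.pi * |-k|) *
        (Real.cos (|-k| * z.1 - -k * z.2) - 1) = 1 / (4 * Real.pi) * (Real.exp (-δ * k) *
        ((Real.cos (k * (z.1 + z.2)) - 1) / k))) := by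
  have hpi := Real.pi_ne_zero
  refine ⟨fun k hk => ?_, fun k hk => ?_⟩
  · have hk' : k ≠ 0 := ne_of_gt hk
    rw [abs_of_pos hk, mul_sub]
    field_simp
  · have hk' : k ≠ 0 := ne_of_gt hk
    rw [abs_neg, abs_of_pos (Set.mem_Ioi.1 hk), show k * z.1 - -k * z.2 = k * (z.1 + z.2) by ring]
    field_simp

theorem integral_fourier_kernel {δ : ℝ} (hδ : 0 < δ) (z : Minkowski) :
    ∫ k : ℝ, Real.exp (-δ * |k|) / (4 * Real.pi * |k|) * (Real.cos (|k| * z.1 - k * z.2) - 1) =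
      logReg δ z - logReg δ 0 := by
  obtain ⟨h1, h2⟩ := fourier_kernel_comp (δ := δ) z
  set f : ℝ → ℝ := fun k => Real.exp (-δ * |k|) / (4 * Real.pi * |k|) *
    (Real.cos (|k| * z.1 - k * z.2) - 1) with hf
  have i1 : IntegrableOn f (Set.Ioi 0) :=
    IntegrableOn.congr_fun ((integrableOn_exp_cos_sub_one_div hδ (z.1 - z.2)).const_mul (1 / (4 * Real.pi)))
      (fun k hk => (h1 k hk).symm) measurableSet_Ioi
  have i2 : IntegrableOn (fun k => f (-k)) (Set.Ioi 0) :=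
    IntegrableOn.congr_fun ((integrableOn_exp_cos_sub_one_div hδ (z.1 + z.2)).const_mul (1 / (4 * Real.pi)))
      (fun k hk => (h2 k hk).symm) measurableSet_Ioi
  have i3 : IntegrableOn f (Set.Iic 0) := by
    have := i2.comp_neg
    simp only [neg_neg, Set.neg_Ioi, neg_zero] at this
    rwa [integrableOn_Iic_iff_integrableOn_Iio]
  have e2 := integral_comp_neg_Ioi 0 f
  rw [neg_zero] at e2
  rw [← intervalIntegral.integral_Iic_add_Ioi i3 i1, ← e2, setIntegral_congr_fun measurableSet_Ioi h1,
    setIntegral_congr_fun measurableSet_Ioi h2, integral_const_mul, integral_const_mul,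
    integral_exp_cos_sub_one_div hδ, integral_exp_cos_sub_one_div hδ, logReg, logReg]
  simp only [Prod.fst_zero, Prod.snd_zero, sub_zero, add_zero, ne_eq, OfNat.ofNat_ne_zero,
    not_false_eq_true, zero_pow, zero_add]
  ring

theorem logReg_neg (δ : ℝ) (z : Minkowski) : logReg δ (-z) = logReg δ z := by
  simp only [logReg, Prod.fst_neg, Prod.snd_neg]
  rw [show (-z.1 - -z.2) ^ 2 = (z.1 - z.2) ^ 2 by ring, show (-z.1 + -z.2) ^ 2 = (z.1 + z.2) ^ 2 by ring]

theorem integrable_exp_neg_mul_abs {δ : ℝ} (hδ : 0 < δ) : Integrable fun k : ℝ => Real.exp (-δ * |k|) := by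
  have h1 : IntegrableOn (fun k : ℝ => Real.exp (-δ * |k|)) (Set.Ioi 0) :=
    (integrableOn_exp_mul_Ioi (neg_lt_zero.2 hδ) 0).congr_fun
      (fun k hk => by simp only [abs_of_pos (Set.mem_Ioi.1 hk)]) measurableSet_Ioi
  have h2 := h1.comp_neg
  simp only [Set.neg_Ioi, neg_zero, abs_neg] at h2
  rw [← integrableOn_univ, ← Set.Iic_union_Ioi (a := (0 : ℝ)), integrableOn_union,
    integrableOn_Iic_iff_integrableOn_Iio]
  exact ⟨h2, h1⟩

/-- The Fourier transform on the light cone of a charge distribution. -/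
def chargeTransform {Ω : Type*} [MeasurableSpace Ω] (m : Measure Ω) (w : Ω → ℝ) (X : Ω → Minkowski)
    (k : ℝ) : ℂ := ∫ s, (w s : ℂ) * planeWave k (X s) ∂m

theorem conj_planeWave_mul_planeWave (k : ℝ) (x y : Minkowski) :
    ((starRingEnd ℂ) (planeWave k x) * planeWave k y).re =
      Real.cos (|k| * (x - y).1 - k * (x - y).2) := by
  rw [planeWave, planeWave, ← Complex.exp_conj, ← Complex.exp_add, map_mul, Complex.conj_I,
    Complex.conj_ofReal, neg_mul, neg_add_eq_sub, ← mul_sub, ← Complex.ofReal_sub, mul_comm Complex.I,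
    Complex.exp_ofReal_mul_I_re, ← Real.cos_neg]
  congr 1
  simp only [Prod.fst_sub, Prod.snd_sub]
  ring

theorem abs_cos_phase_sub_one_le (k : ℝ) (z : Minkowski) :
    |Real.cos (|k| * z.1 - k * z.2) - 1| ≤ |k| * (2 * ‖z‖) := by
  have h := Real.abs_cos_sub_cos_le (|k| * z.1 - k * z.2) 0
  rw [Real.cos_zero, sub_zero] at h
  refine h.trans ?_
  have h1 : |z.1| ≤ ‖z‖ := norm_fst_le z
  have h2 : |z.2| ≤ ‖z‖ := norm_snd_le z
  calc |(|k| * z.1 - k * z.2)| ≤ |(|k| * z.1)| + |k * z.2| := abs_sub _ _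
    _ = |k| * (|z.1| + |z.2|) := by rw [abs_mul, abs_mul, abs_abs]; ring
    _ ≤ _ := by gcongr; linarith

theorem integrable_mul_planeWave {Ω : Type*} [MeasurableSpace Ω] {m : Measure Ω} {w : Ω → ℝ}
    {X : Ω → Minkowski} (hw : Integrable w m) (hX : Measurable X) (k : ℝ) :
    Integrable (fun s => (w s : ℂ) * planeWave k (X s)) m := by
  refine hw.ofReal.mul_bdd (c := 1) ?_ (Eventually.of_forall fun s => (norm_planeWave k _).le)
  exact ((continuous_planeWave k).measurable.comp hX).aestronglyMeasurable

section

variable {Ω Ω' : Type*} [MeasurableSpace Ω] [MeasurableSpace Ω'] {m : Measure Ω} {m' : Measure Ω'}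
  [SFinite m] [SFinite m'] {w : Ω → ℝ} {w' : Ω' → ℝ} {X : Ω → Minkowski} {X' : Ω' → Minkowski}

/-- As the total charge of `w` vanishes, the constant `-1` may be inserted at no cost; it
compensates the singular weight `1/|k|` at `k = 0`. -/
theorem re_conj_chargeTransform_mul (hw : Integrable w m) (hX : Measurable X)
    (hw' : Integrable w' m') (hX' : Measurable X') (h0 : ∫ s, w s ∂m = 0) (k : ℝ) :
    ((starRingEnd ℂ) (chargeTransform m w X k) * chargeTransform m' w' X' k).re =
      ∫ z : Ω × Ω', w z.1 * w' z.2 *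
        (Real.cos (|k| * (X z.1 - X' z.2).1 - k * (X z.1 - X' z.2).2) - 1) ∂(m.prod m') := by
  have i1 := integrable_mul_planeWave hw hX k
  have i2 := integrable_mul_planeWave hw' hX' k
  have i1' : Integrable (fun s => (starRingEnd ℂ) ((w s : ℂ) * planeWave k (X s))) m :=
    (RCLike.conjCLE (K := ℂ)).toContinuousLinearMap.integrable_comp i1
  have i3 := i1'.mul_prod i2
  have i4 : Integrable (fun z : Ω × Ω' => w z.1 * w' z.2) (m.prod m') := hw.mul_prod hw'
  rw [chargeTransform, chargeTransform, ← integral_conj, ← integral_prod_mul, ← RCLike.re_to_complex,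
    ← integral_re i3]
  have h1 (z : Ω × Ω') : RCLike.re ((starRingEnd ℂ) ((w z.1 : ℂ) * planeWave k (X z.1)) *
      ((w' z.2 : ℂ) * planeWave k (X' z.2))) =
      w z.1 * w' z.2 * Real.cos (|k| * (X z.1 - X' z.2).1 - k * (X z.1 - X' z.2).2) := by
    rw [map_mul (starRingEnd ℂ), Complex.conj_ofReal, mul_mul_mul_comm, ← Complex.ofReal_mul, RCLike.re_to_complex,
      Complex.re_ofReal_mul, conj_planeWave_mul_planeWave]
  have i5 := i3.re
  simp only [h1] at i5 ⊢
  simp only [mul_sub, mul_one]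
  rw [integral_sub i5 i4, integral_prod_mul, h0, zero_mul, sub_zero]

/-- Fubini and `integral_fourier_kernel`; the infrared constant `logReg δ 0` is multiplied by the
total charge and disappears. General measure spaces are admitted so that the formula covers both
smooth densities and point charges with a smooth background. -/
theorem fourier_logReg (hw : Integrable w m) (hX : Measurable X)
    (hwX : Integrable (fun s => w s * ‖X s‖) m) (hw' : Integrable w' m') (hX' : Measurable X')
    (hwX' : Integrable (fun s => w' s * ‖X' s‖) m') (h0 : ∫ s, w s ∂m = 0)
    {δ : ℝ} (hδ : 0 < δ) :
    Integrable (fun z : Ω × Ω' => w z.1 * w' z.2 * logReg δ (X z.1 - X' z.2)) (m.prod m') ∧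
    ∫ k : ℝ, Real.exp (-δ * |k|) / (4 * Real.pi * |k|) *
        ((starRingEnd ℂ) (chargeTransform m w X k) * chargeTransform m' w' X' k).re =
      ∫ z : Ω × Ω', w z.1 * w' z.2 * logReg δ (X z.1 - X' z.2) ∂(m.prod m') := by
  have hpi := Real.pi_pos
  have i4 : Integrable (fun z : Ω × Ω' => w z.1 * w' z.2) (m.prod m') := hw.mul_prod hw'
  let f (k : ℝ) (z : Ω × Ω') : ℝ := Real.exp (-δ * |k|) / (4 * Real.pi * |k|) * (w z.1 * w' z.2 *
        (Real.cos (|k| * (X z.1 - X' z.2).1 - k * (X z.1 - X' z.2).2) - 1))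
  have hf : Integrable (Function.uncurry f) ((volume : Measure ℝ).prod (m.prod m')) := by
    have hb1 := (hwX.norm.mul_prod hw'.norm).add (hw.norm.mul_prod hwX'.norm)
    have hb := ((integrable_exp_neg_mul_abs hδ).const_mul (1 / (4 * Real.pi))).mul_prod
      (hb1.const_mul 2)
    refine hb.mono' ?_ (Eventually.of_forall fun q => ?_)
    · have hc : AEStronglyMeasurable (fun q : ℝ × (Ω × Ω') =>
          Real.exp (-δ * |q.1|) / (4 * Real.pi * |q.1|) * (Real.cos (|q.1| * (X q.2.1 - X' q.2.2).1
          - q.1 * (X q.2.1 - X' q.2.2).2) - 1)) (volume.prod (m.prod m')) := by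
        simp only [← Real.norm_eq_abs]
        exact Measurable.aestronglyMeasurable (by fun_prop)
      have hs : AEStronglyMeasurable (fun q : ℝ × (Ω × Ω') => w q.2.1 * w' q.2.2)
          (volume.prod (m.prod m')) := i4.1.comp_snd
      refine (hc.mul hs).congr (Eventually.of_forall fun q => ?_)
      simp only [Function.uncurry, f, Pi.mul_apply]
      ring
    · obtain ⟨k, z⟩ := q
      simp only [Function.uncurry, f, Pi.add_apply, norm_mul, norm_norm]
      have h2 := abs_cos_phase_sub_one_le k (X z.1 - X' z.2)
      have h3 := norm_sub_le (X z.1) (X' z.2)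
      rw [norm_div, Real.norm_eq_abs, Real.norm_eq_abs, Real.norm_eq_abs (Real.cos _ - 1),
        abs_of_pos (Real.exp_pos _), abs_mul, abs_abs, abs_of_pos (by positivity : 0 < 4 * Real.pi)]
      rcases eq_or_ne k 0 with rfl | hk
      · simp only [abs_zero, mul_zero, div_zero, zero_mul]
        positivity
      have hk' : 0 < |k| := abs_pos.2 hk
      calc Real.exp (-δ * |k|) / (4 * Real.pi * |k|) * (‖w z.1‖ * ‖w' z.2‖ *
            |Real.cos (|k| * (X z.1 - X' z.2).1 - k * (X z.1 - X' z.2).2) - 1|)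
          ≤ Real.exp (-δ * |k|) / (4 * Real.pi * |k|) * (‖w z.1‖ * ‖w' z.2‖ *
            (|k| * (2 * (‖X z.1‖ + ‖X' z.2‖)))) := by
            gcongr
            exact h2.trans (by gcongr)
        _ = _ := by
            field_simp
  have hfz (z : Ω × Ω') : ∫ k, f k z = w z.1 * w' z.2 * logReg δ (X z.1 - X' z.2)
      - w z.1 * w' z.2 * logReg δ 0 := by
    have : ∀ k, f k z = (w z.1 * w' z.2) * (Real.exp (-δ * |k|) / (4 * Real.pi * |k|) *
        (Real.cos (|k| * (X z.1 - X' z.2).1 - k * (X z.1 - X' z.2).2) - 1)) := fun k => by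
      simp only [f]; ring
    simp only [this]
    rw [integral_const_mul, integral_fourier_kernel hδ, mul_sub]
  have h1 := integral_integral_swap hf
  have i6 : Integrable (fun z : Ω × Ω' => ∫ k, f k z) (m.prod m') := hf.integral_prod_right
  simp only [hfz] at h1 i6
  have i7 : Integrable (fun z : Ω × Ω' => w z.1 * w' z.2 * logReg δ (X z.1 - X' z.2)) (m.prod m') := by
    refine (i6.add (i4.mul_const (logReg δ 0))).congr (Eventually.of_forall fun z => ?_)
    simp
  rw [integral_sub i7 (i4.mul_const _), integral_mul_const, integral_prod_mul, h0, zero_mul, zero_mul,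
    sub_zero] at h1
  refine ⟨i7, ?_⟩
  rw [← h1]
  refine integral_congr_ae (Eventually.of_forall fun k => ?_)
  simp only [f, integral_const_mul]
  rw [re_conj_chargeTransform_mul hw hX hw' hX' h0]

end

/-! ### One particle vectors -/

theorem integrable_test (f : TestDensity) : Integrable (fun x => f x) :=
  f.continuous.integrable_of_hasCompactSupport f.hasCompactSupport

theorem lightConeTransform_eq (f : TestDensity) (k : ℝ) :
    lightConeTransform f k = ∫ x, f x • planeWave k x := by
  simp only [Complex.real_smul]
  rfl

theorem norm_lightConeTransform_le_integral (f : TestDensity) (k : ℝ) :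
    ‖lightConeTransform f k‖ ≤ ∫ x, |f x| := by
  rw [lightConeTransform_eq]
  refine norm_integral_le_of_norm_le (integrable_test f).norm (Eventually.of_forall fun x => ?_)
  rw [norm_smul, norm_planeWave, mul_one]
  exact le_rfl

/-- Neutrality gives `O(|k|)` at small momenta and smoothness gives `O(1/|k|)` at large ones. Hence
vectors of test densities can be paired with any bounded transform, even that of a point charge. -/
theorem integrable_weight_mul_lightConeTransform (ħ : ℝ) (f : TestDensity) (hf : ∫ x, f x = 0) :
    Integrable fun k : ℝ => ((ħ / (4 * Real.pi * |k|) : ℝ) : ℂ) * lightConeTransform f k := by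
  obtain ⟨A, hA⟩ := norm_lightConeTransform_le f hf
  obtain ⟨B, hB⟩ := norm_lightConeTransform_mul_le f
  have hpi := Real.pi_pos
  refine (integrable_inv_one_add_sq.const_mul (|ħ| / (4 * Real.pi) * (2 * (|A| + |B|)))).mono' ?_
    (Eventually.of_forall fun k => ?_)
  · have h1 := (continuous_lightConeTransform f).measurable
    exact Measurable.aestronglyMeasurable (by fun_prop)
  rw [norm_mul, Complex.norm_real, norm_div, Real.norm_eq_abs, Real.norm_eq_abs, abs_mul, abs_abs,
    abs_of_pos (by positivity : 0 < 4 * Real.pi), ← div_div, div_mul_eq_mul_div, mul_div_assoc,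
    mul_assoc]
  refine mul_le_mul_of_nonneg_left ?_ (by positivity)
  rcases eq_or_ne k 0 with rfl | hk
  · simp only [abs_zero, div_zero]
    positivity
  have hk' : 0 < |k| := abs_pos.2 hk
  have h1 := hA k
  have h2 := hB k
  have hA' := le_abs_self A
  have hB' := le_abs_self B
  have hA0 := abs_nonneg A
  have hB0 := abs_nonneg B
  set L := ‖lightConeTransform f k‖
  have hL : 0 ≤ L := norm_nonneg _
  rw [← div_eq_mul_inv, div_le_div_iff₀ hk' (by positivity), ← sq_abs k]
  rcases le_total |k| 1 with h | h
  · have h3 : |k| ^ 2 ≤ 1 := pow_le_one₀ hk'.le h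
    calc L * (1 + |k| ^ 2) ≤ L * 2 := by gcongr; linarith
      _ ≤ (|A| * |k|) * 2 := by gcongr; exact h1.trans (by gcongr)
      _ ≤ _ := by nlinarith [mul_nonneg hB0 hk'.le]
  · have h3 : 1 ≤ |k| ^ 2 := one_le_pow₀ h
    calc L * (1 + |k| ^ 2) ≤ L * (2 * |k| ^ 2) := by gcongr; linarith
      _ = (L * |k|) * (2 * |k|) := by ring
      _ ≤ |B| * (2 * |k|) := by gcongr; exact h2.trans hB'
      _ ≤ _ := by nlinarith [mul_nonneg hA0 hk'.le]

/-- The pairing of the one particle vector of `f` with the one particle function of a transform `χ`. -/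
def pairing (ħ : ℝ) (f : TestDensity) (χ : ℝ → ℂ) : ℂ :=
  ∫ k : ℝ, ((ħ / (4 * Real.pi * |k|) : ℝ) : ℂ) * ((starRingEnd ℂ) (lightConeTransform f k) * χ k)

/-- A uniform bound of the pairing on transforms bounded by `1`. -/
def pairingBound (ħ : ℝ) (f : TestDensity) : ℝ :=
  ∫ k : ℝ, ‖((ħ / (4 * Real.pi * |k|) : ℝ) : ℂ) * lightConeTransform f k‖

theorem norm_pairing_le (ħ : ℝ) (f : TestDensity) (hf : ∫ x, f x = 0) {χ : ℝ → ℂ} {M : ℝ}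
    (hχ : ∀ k, ‖χ k‖ ≤ M) : ‖pairing ħ f χ‖ ≤ pairingBound ħ f * M := by
  rw [pairingBound, ← integral_mul_const]
  refine norm_integral_le_of_norm_le
    ((integrable_weight_mul_lightConeTransform ħ f hf).norm.mul_const M)
    (Eventually.of_forall fun k => ?_)
  rw [norm_mul, norm_mul, norm_mul, RCLike.norm_conj, ← mul_assoc]
  exact mul_le_mul_of_nonneg_left (hχ k) (by positivity)

theorem tendsto_pairing {ι : Type*} {l : Filter ι} [l.IsCountablyGenerated] (ħ : ℝ) (f : TestDensity)
    (hf : ∫ x, f x = 0) {χ : ι → ℝ → ℂ} {χ₀ : ℝ → ℂ} {M : ℝ}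
    (hm : ∀ᶠ i in l, Measurable (χ i)) (hb : ∀ᶠ i in l, ∀ k, ‖χ i k‖ ≤ M)
    (ht : ∀ k, Tendsto (fun i => χ i k) l (𝓝 (χ₀ k))) :
    Tendsto (fun i => pairing ħ f (χ i)) l (𝓝 (pairing ħ f χ₀)) := by
  refine tendsto_integral_filter_of_dominated_convergence
    (fun k => ‖((ħ / (4 * Real.pi * |k|) : ℝ) : ℂ) * lightConeTransform f k‖ * M) ?_ ?_
    ((integrable_weight_mul_lightConeTransform ħ f hf).norm.mul_const M) ?_
  · filter_upwards [hm] with i hi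
    have h1 := (continuous_lightConeTransform f).measurable
    have h2 : Measurable fun k => (starRingEnd ℂ) (lightConeTransform f k) :=
      Complex.continuous_conj.measurable.comp h1
    exact Measurable.aestronglyMeasurable (by fun_prop)
  · filter_upwards [hb] with i hi
    refine Eventually.of_forall fun k => ?_
    rw [norm_mul, norm_mul, norm_mul, RCLike.norm_conj, ← mul_assoc]
    exact mul_le_mul_of_nonneg_left (hi k) (by positivity)
  · exact Eventually.of_forall fun k => ((ht k).const_mul _).const_mul _

theorem sqrt_weight_mul_self {ħ : ℝ} (hħ : 0 ≤ ħ) (k : ℝ) :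
    Real.sqrt (ħ / (4 * Real.pi * |k|)) * Real.sqrt (ħ / (4 * Real.pi * |k|)) =
      ħ / (4 * Real.pi * |k|) :=
  Real.mul_self_sqrt (by have := Real.pi_pos; positivity)

theorem inner_toLp_weight {ħ : ℝ} (hħ : 0 ≤ ħ) {χ χ' : ℝ → ℂ}
    (h : MemLp (fun k => (Real.sqrt (ħ / (4 * Real.pi * |k|)) : ℂ) * χ k) 2 volume)
    (h' : MemLp (fun k => (Real.sqrt (ħ / (4 * Real.pi * |k|)) : ℂ) * χ' k) 2 volume) :
    inner ℂ (h.toLp _) (h'.toLp _) =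
      ∫ k : ℝ, ((ħ / (4 * Real.pi * |k|) : ℝ) : ℂ) * ((starRingEnd ℂ) (χ k) * χ' k) := by
  rw [L2.inner_def]
  refine integral_congr_ae ?_
  filter_upwards [h.coeFn_toLp, h'.coeFn_toLp] with k h1 h2
  have h3 := congrArg Complex.ofReal (sqrt_weight_mul_self hħ k)
  rw [Complex.ofReal_mul] at h3
  rw [h1, h2, RCLike.inner_apply, map_mul, Complex.conj_ofReal, ← h3]
  ring

theorem inner_oneParticle {ħ : ℝ} (hħ : 0 ≤ ħ) (f h : TestDensity) (hf : ∫ x, f x = 0)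
    (hh : ∫ x, h x = 0) :
    inner ℂ (oneParticle ħ f hf) (oneParticle ħ h hh) = pairing ħ f (lightConeTransform h) :=
  inner_toLp_weight hħ (memLp_oneParticleFun ħ f hf) (memLp_oneParticleFun ħ h hh)

/-- Insert the convergence factor `exp(-δ|k|)`, use `fourier_logReg`, and let `δ` tend to `0` on
both sides. This identity lets normal ordering cancel the self-energy, which diverges for point
charges. -/
theorem norm_sq_oneParticle {ħ : ℝ} (hħ : 0 ≤ ħ) (h : TestDensity) (hh : ∫ x, h x = 0) :
    ‖oneParticle ħ h hh‖ ^ 2 = ħ * hadamardForm h h := by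
  have hpi := Real.pi_pos
  have hX : Integrable fun x : Minkowski => h x * ‖x‖ := by
    have := h.continuous
    exact Continuous.integrable_of_hasCompactSupport (by fun_prop) h.hasCompactSupport.mul_right
  have hF (δ : ℝ) (hδ : 0 < δ) := (fourier_logReg (m := volume) (m' := volume) (X := fun x => x)
    (X' := fun x => x) (integrable_test h) measurable_id hX (integrable_test h) measurable_id hX hh hδ).2
  have hct : chargeTransform volume (fun x => h x) (fun x => x) = lightConeTransform h := rfl
  have hre (k : ℝ) : ((starRingEnd ℂ) (lightConeTransform h k) * lightConeTransform h k).re =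
      ‖lightConeTransform h k‖ ^ 2 := by
    rw [mul_comm, Complex.mul_conj, Complex.ofReal_re, Complex.normSq_eq_norm_sq]
  simp only [hct, hre] at hF
  have hi : Integrable fun k : ℝ => ħ / (4 * Real.pi * |k|) * ‖lightConeTransform h k‖ ^ 2 := by
    have h1 := memLp_oneParticleFun ħ h hh
    refine ((memLp_two_iff_integrable_sq_norm h1.1).1 h1).congr (Eventually.of_forall fun k => ?_)
    simp only [oneParticleFun, norm_mul, mul_pow, Complex.norm_real]
    rw [sq ‖Real.sqrt _‖, ← norm_mul, sqrt_weight_mul_self hħ, Real.norm_of_nonneg (by positivity)]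
  have hn : ‖oneParticle ħ h hh‖ ^ 2 =
      ∫ k : ℝ, ħ / (4 * Real.pi * |k|) * ‖lightConeTransform h k‖ ^ 2 := by
    have h1 := inner_oneParticle hħ h h hh hh
    rw [inner_self_eq_norm_sq_to_K, pairing] at h1
    have h2 : ∀ k : ℝ, ((ħ / (4 * Real.pi * |k|) : ℝ) : ℂ) * ((starRingEnd ℂ) (lightConeTransform h k) *
        lightConeTransform h k) = ((ħ / (4 * Real.pi * |k|) * ‖lightConeTransform h k‖ ^ 2 : ℝ) : ℂ) := by
      intro k
      rw [mul_comm ((starRingEnd ℂ) _), Complex.mul_conj, Complex.normSq_eq_norm_sq]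
      push_cast
      rfl
    simp only [h2] at h1
    rw [integral_complex_ofReal] at h1
    have h3 : ((‖oneParticle ħ h hh‖ ^ 2 : ℝ) : ℂ) = _ := (Complex.ofReal_pow _ _).trans h1
    exact Complex.ofReal_injective h3
  have ht1 : Tendsto (fun δ : ℝ => ∫ k : ℝ, Real.exp (-δ * |k|) *
      (ħ / (4 * Real.pi * |k|) * ‖lightConeTransform h k‖ ^ 2)) (𝓝[>] 0)
      (𝓝 (∫ k : ℝ, ħ / (4 * Real.pi * |k|) * ‖lightConeTransform h k‖ ^ 2)) := by
    refine tendsto_integral_filter_of_dominated_convergence _ ?_ ?_ hi ?_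
    · refine Eventually.of_forall fun δ => ?_
      have hcont : Continuous fun k : ℝ => Real.exp (-δ * |k|) := by fun_prop
      exact hcont.aestronglyMeasurable.mul hi.1
    · filter_upwards [self_mem_nhdsWithin] with δ hδ
      refine Eventually.of_forall fun k => ?_
      rw [norm_mul, Real.norm_of_nonneg (Real.exp_pos _).le, Real.norm_of_nonneg (by positivity)]
      refine mul_le_of_le_one_left (by positivity) (Real.exp_le_one_iff.2 ?_)
      have hδ' : (0 : ℝ) < δ := hδ
      nlinarith [abs_nonneg k]
    · refine Eventually.of_forall fun k => tendsto_nhdsWithin_of_tendsto_nhds ?_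
      have hcont : Continuous fun δ : ℝ => Real.exp (-δ * |k|) *
        (ħ / (4 * Real.pi * |k|) * ‖lightConeTransform h k‖ ^ 2) := by fun_prop
      simpa using hcont.tendsto 0
  have ht2 : Tendsto (fun δ : ℝ => ∫ k : ℝ, Real.exp (-δ * |k|) *
      (ħ / (4 * Real.pi * |k|) * ‖lightConeTransform h k‖ ^ 2)) (𝓝[>] 0)
      (𝓝 (ħ * hadamardForm h h)) := by
    rw [hadamardForm_eq]
    have h3 := (tendsto_nhdsWithin_of_tendsto_nhds (s := Set.Ioi 0) (tendsto_integral_mul_conv_logReg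
      h.continuous h.hasCompactSupport h.continuous h.hasCompactSupport)).const_mul ħ
    refine h3.congr' ?_
    filter_upwards [self_mem_nhdsWithin] with δ hδ
    have hloc : LocallyIntegrable (logReg δ) := (continuous_logReg (ne_of_gt hδ)).locallyIntegrable
    rw [integral_mul_conv (measurable_logReg δ) hloc h.continuous h.hasCompactSupport h.continuous
      h.hasCompactSupport]
    have h4 := hF δ hδ
    have h5 : ∫ z : Minkowski × Minkowski, h z.1 * (logReg δ (z.1 - z.2) * h z.2) =
      ∫ z : Minkowski × Minkowski, h z.1 * h z.2 * logReg δ (z.1 - z.2) :=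
      integral_congr_ae (Eventually.of_forall fun z => by ring)
    rw [h5, Measure.volume_eq_prod, ← h4, ← integral_const_mul]
    refine integral_congr_ae (Eventually.of_forall fun k => ?_)
    ring
  rw [hn]
  exact tendsto_nhds_unique ht1 ht2

/-! ### Regularized point charges -/

/-- Two copies of Minkowski space, carrying a point charge and its neutralizing background. -/
def twoCopies : Measure (Bool × Minkowski) :=
  (volume : Measure Minkowski).map (Prod.mk true) + (volume : Measure Minkowski).map (Prod.mk false)

instance : SFinite twoCopies := by
  unfold twoCopies
  infer_instance

/-- The charge density of a unit charge neutralized by `-ψ`. -/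
def dipoleWeight (ψ : TestDensity) (s : Bool × Minkowski) : ℝ := if s.1 then ψ s.2 else -ψ s.2

/-- The positions of a unit charge at `y` neutralized by `-ψ`. -/
def dipolePos (y : Minkowski) (s : Bool × Minkowski) : Minkowski := if s.1 then y else s.2

theorem measurable_dipolePos (y : Minkowski) : Measurable (dipolePos y) := by
  unfold dipolePos
  exact Measurable.ite (measurable_fst (measurableSet_singleton true)) measurable_const measurable_snd

/-- The first copy carries the weight `ψ` but sits entirely at `y`, producing a point charge `∫ ψ`;
the second carries `-ψ` in its own place. -/
theorem integrable_dipole {E : Type*} [NormedAddCommGroup E] [NormedSpace ℝ E] [CompleteSpace E]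
    (ψ : TestDensity) (y : Minkowski) {F : Minkowski → E} (hF : Continuous F) :
    Integrable (fun s => dipoleWeight ψ s • F (dipolePos y s)) twoCopies ∧
    ∫ s, dipoleWeight ψ s • F (dipolePos y s) ∂twoCopies =
      (∫ z, ψ z) • F y - ∫ z, ψ z • F z := by
  have e1 : MeasurableEmbedding (Prod.mk true : Minkowski → Bool × Minkowski) :=
    MeasurableEmbedding.id.prodMk_left true
  have e2 : MeasurableEmbedding (Prod.mk false : Minkowski → Bool × Minkowski) :=
    MeasurableEmbedding.id.prodMk_left false
  have hψ := ψ.continuous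
  have i1 : Integrable (fun s => dipoleWeight ψ s • F (dipolePos y s))
      ((volume : Measure Minkowski).map (Prod.mk true)) := by
    rw [e1.integrable_map_iff]
    exact (integrable_test ψ).smul_const (F y)
  have i2 : Integrable (fun s => dipoleWeight ψ s • F (dipolePos y s))
      ((volume : Measure Minkowski).map (Prod.mk false)) := by
    rw [e2.integrable_map_iff]
    have : Integrable fun z => ψ z • F z :=
      Continuous.integrable_of_hasCompactSupport (by fun_prop) ψ.hasCompactSupport.smul_right
    refine this.neg.congr (Eventually.of_forall fun z => ?_)
    simp [dipoleWeight, dipolePos]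
  refine ⟨i1.add_measure i2, ?_⟩
  rw [twoCopies, integral_add_measure i1 i2, e1.integral_map, e2.integral_map, ← integral_smul_const,
    sub_eq_add_neg, ← integral_neg]
  simp [dipoleWeight, dipolePos]

/-- The transform of a unit charge at `y` neutralized by `-ψ`. -/
def dipoleTransform (ψ : UnitDensity) (y : Minkowski) (k : ℝ) : ℂ :=
  planeWave k y - lightConeTransform ψ.1 k

theorem dipoleTransform_eq (ψ : UnitDensity) (y : Minkowski) :
    dipoleTransform ψ y = chargeTransform twoCopies (dipoleWeight ψ.1) (dipolePos y) := by
  funext k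
  have h := (integrable_dipole ψ.1 y (continuous_planeWave k)).2
  simp only [ψ.2, one_smul, Complex.real_smul] at h
  exact h.symm

theorem fourier_dipole (ψ : UnitDensity) (y y' : Minkowski) {δ : ℝ} (hδ : 0 < δ) :
    ∫ k : ℝ, Real.exp (-δ * |k|) / (4 * Real.pi * |k|) *
        ((starRingEnd ℂ) (dipoleTransform ψ y k) * dipoleTransform ψ y' k).re =
      logReg δ (y - y') - conv (logReg δ) ψ.1 y - conv (logReg δ) ψ.1 y' +
        ∫ x, ψ.1 x * conv (logReg δ) ψ.1 x := by
  have hw : Integrable (dipoleWeight ψ.1) twoCopies := by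
    simpa using (integrable_dipole ψ.1 y (continuous_const (y := (1 : ℝ)))).1
  have h0 : ∫ s, dipoleWeight ψ.1 s ∂twoCopies = 0 := by
    have := (integrable_dipole ψ.1 y (continuous_const (y := (1 : ℝ)))).2
    simpa [ψ.2] using this
  have hX (y : Minkowski) : Integrable (fun s => dipoleWeight ψ.1 s * ‖dipolePos y s‖) twoCopies :=
    (integrable_dipole ψ.1 y (F := fun z => ‖z‖) continuous_norm).1
  have h := fourier_logReg hw (measurable_dipolePos y) (hX y) hw (measurable_dipolePos y') (hX y') h0 hδ
  rw [← dipoleTransform_eq, ← dipoleTransform_eq] at h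
  have hlc := continuous_logReg hδ.ne'
  have hloc : LocallyIntegrable (logReg δ) := hlc.locallyIntegrable
  have hcc := continuous_conv hloc ψ.1.continuous ψ.1.hasCompactSupport
  rw [h.2, integral_prod _ h.1]
  have h1 (z : Minkowski) : ∫ s, dipoleWeight ψ.1 s * logReg δ (z - dipolePos y' s) ∂twoCopies =
      logReg δ (z - y') - conv (logReg δ) ψ.1 z := by
    have h2 := (integrable_dipole ψ.1 y' (F := fun w => logReg δ (z - w)) (by fun_prop)).2
    simp only [ψ.2, smul_eq_mul, one_mul] at h2
    rw [h2, conv]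
    congr 2
    funext w
    ring
  simp only [mul_assoc, integral_const_mul, h1]
  have h3 := (integrable_dipole ψ.1 y
    (F := fun z => logReg δ (z - y') - conv (logReg δ) ψ.1 z) (by fun_prop)).2
  simp only [ψ.2, smul_eq_mul, one_mul] at h3
  rw [h3]
  have i1 : Integrable fun z => ψ.1 z * logReg δ (z - y') := by
    have := ψ.1.continuous
    exact Continuous.integrable_of_hasCompactSupport (by fun_prop) ψ.1.hasCompactSupport.mul_right
  have i2 : Integrable fun z => ψ.1 z * conv (logReg δ) ψ.1 z := by
    have := ψ.1.continuous
    exact Continuous.integrable_of_hasCompactSupport (by fun_prop) ψ.1.hasCompactSupport.mul_right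
  simp only [mul_sub]
  rw [integral_sub i1 i2]
  have h4 : ∫ z, ψ.1 z * logReg δ (z - y') = conv (logReg δ) ψ.1 y' := by
    rw [conv]
    refine integral_congr_ae (Eventually.of_forall fun z => ?_)
    simp only
    rw [← logReg_neg, neg_sub, mul_comm]
  rw [h4]
  ring

theorem norm_dipoleTransform_le (ψ : UnitDensity) (y : Minkowski) :
    ∃ A : ℝ, ∀ k, ‖dipoleTransform ψ y k‖ ≤ A * |k| := by
  have hψ := ψ.1.continuous
  have hc : Continuous fun x : Minkowski => |ψ.1 x| * (2 * ‖y - x‖) := by fun_prop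
  have hi : Integrable fun x : Minkowski => |ψ.1 x| * (2 * ‖y - x‖) :=
    hc.integrable_of_hasCompactSupport ψ.1.hasCompactSupport.norm.mul_right
  refine ⟨∫ x : Minkowski, |ψ.1 x| * (2 * ‖y - x‖), fun k => ?_⟩
  have h1 : dipoleTransform ψ y k = ∫ x, ψ.1 x • (planeWave k y - planeWave k x) := by
    have i2 : Integrable fun x => ψ.1 x • planeWave k x := by
      have := continuous_planeWave k
      exact Continuous.integrable_of_hasCompactSupport (by fun_prop) ψ.1.hasCompactSupport.smul_right
    simp only [smul_sub]
    rw [integral_sub ((integrable_test ψ.1).smul_const _) i2, integral_smul_const, ψ.2, one_smul,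
      dipoleTransform, lightConeTransform_eq]
  rw [h1, ← integral_mul_const]
  refine norm_integral_le_of_norm_le (hi.mul_const _) (Eventually.of_forall fun x => ?_)
  rw [norm_smul, Real.norm_eq_abs, mul_assoc]
  refine mul_le_mul_of_nonneg_left ?_ (abs_nonneg _)
  have h2 : planeWave k y - planeWave k x = planeWave k x * (planeWave k (y - x) - 1) := by
    rw [mul_sub, mul_one, planeWave, planeWave, planeWave, ← Complex.exp_add]
    congr 2
    simp only [Prod.fst_sub, Prod.snd_sub]
    push_cast
    ring
  rw [h2, norm_mul, norm_planeWave, one_mul]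
  refine Real.norm_exp_I_mul_ofReal_sub_one_le.trans ?_
  have h3 : |(y - x).1| ≤ ‖y - x‖ := norm_fst_le (y - x)
  have h4 : |(y - x).2| ≤ ‖y - x‖ := norm_snd_le (y - x)
  rw [Real.norm_eq_abs]
  calc |(|k| * (y - x).1 - k * (y - x).2)| ≤ |(|k| * (y - x).1)| + |k * (y - x).2| := abs_sub _ _
    _ = |k| * (|(y - x).1| + |(y - x).2|) := by rw [abs_mul, abs_mul, abs_abs]; ring
    _ ≤ |k| * (2 * ‖y - x‖) := by gcongr; linarith
    _ = _ := by ring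

theorem norm_dipoleTransform_le_const (ψ : UnitDensity) (y : Minkowski) (k : ℝ) :
    ‖dipoleTransform ψ y k‖ ≤ 1 + ∫ x, |ψ.1 x| := by
  refine (norm_sub_le _ _).trans (add_le_add (norm_planeWave k y).le ?_)
  exact norm_lightConeTransform_le_integral ψ.1 k

theorem continuous_dipoleTransform (ψ : UnitDensity) :
    Continuous fun q : Minkowski × ℝ => dipoleTransform ψ q.1 q.2 := by
  have := continuous_lightConeTransform ψ.1
  unfold dipoleTransform planeWave
  fun_prop

/-- Of the two factors of the transform one is estimated by `A * |k|`, cancelling the weight, and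
the other by a constant. Decay at large momenta comes only from the factor `exp(-δ|k|)`. -/
theorem memLp_pointVec {ħ : ℝ} (hħ : 0 ≤ ħ) (ψ : UnitDensity) {δ : ℝ} (hδ : 0 < δ) (y : Minkowski) :
    MemLp (fun k => (Real.sqrt (ħ / (4 * Real.pi * |k|)) : ℂ) *
      ((Real.exp (-δ * |k|) : ℂ) * dipoleTransform ψ y k)) 2 volume := by
  have hpi := Real.pi_pos
  have hc : Continuous fun k => dipoleTransform ψ y k := by
    have := continuous_dipoleTransform ψ
    fun_prop
  have hm : AEStronglyMeasurable (fun k => (Real.sqrt (ħ / (4 * Real.pi * |k|)) : ℂ) *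
      ((Real.exp (-δ * |k|) : ℂ) * dipoleTransform ψ y k)) volume := by
    have := hc.measurable
    simp only [← Real.norm_eq_abs]
    exact Measurable.aestronglyMeasurable (by fun_prop)
  rw [memLp_two_iff_integrable_sq_norm hm]
  obtain ⟨A, hA⟩ := norm_dipoleTransform_le ψ y
  refine ((integrable_exp_neg_mul_abs hδ).const_mul (ħ / (4 * Real.pi) * A *
    (1 + ∫ x, |ψ.1 x|))).mono' (hm.norm.pow 2) (Eventually.of_forall fun k => ?_)
  rw [Real.norm_of_nonneg (by positivity), norm_mul, norm_mul, Complex.norm_real, Complex.norm_real,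
    Real.norm_of_nonneg (Real.sqrt_nonneg _), Real.norm_of_nonneg (Real.exp_pos _).le, mul_pow,
    Real.sq_sqrt (by positivity), mul_pow]
  have hM := norm_dipoleTransform_le_const ψ y k
  have hAk := hA k
  set L := ‖dipoleTransform ψ y k‖
  have hL : 0 ≤ L := norm_nonneg _
  have he : Real.exp (-δ * |k|) ^ 2 ≤ Real.exp (-δ * |k|) := by
    have h1 : Real.exp (-δ * |k|) ≤ 1 := Real.exp_le_one_iff.2 (by nlinarith [abs_nonneg k])
    exact pow_le_of_le_one (Real.exp_pos _).le h1 two_ne_zero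
  rcases eq_or_ne k 0 with rfl | hk
  · simp only [abs_zero, mul_zero] at hAk ⊢
    simp only [div_zero, zero_mul]
    have hA1 := hA 1
    have : 0 ≤ A := by simpa using (norm_nonneg _).trans hA1
    have : 0 ≤ 1 + ∫ x, |ψ.1 x| := hL.trans hM
    positivity
  have hk' : 0 < |k| := abs_pos.2 hk
  calc ħ / (4 * Real.pi * |k|) * (Real.exp (-δ * |k|) ^ 2 * L ^ 2)
      ≤ ħ / (4 * Real.pi * |k|) * (Real.exp (-δ * |k|) * ((A * |k|) * (1 + ∫ x, |ψ.1 x|))) := by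
        rw [sq L]
        gcongr
        exact hL.trans hAk
    _ = _ := by field_simp

/-- The one particle vector of a regularized unit charge at `y` neutralized by `-ψ`. -/
def pointVec {ħ : ℝ} (hħ : 0 ≤ ħ) (ψ : UnitDensity) {δ : ℝ} (hδ : 0 < δ) (y : Minkowski) : L2 :=
  (memLp_pointVec hħ ψ hδ y).toLp _

/-- Each vector carries a factor `exp(-δ|k|)`, so the inner product is regularized at length `2 *
δ`. This is the origin of `2 * δ` in the energy estimates. -/
theorem re_inner_pointVec {ħ : ℝ} (hħ : 0 ≤ ħ) (ψ : UnitDensity) {δ : ℝ} (hδ : 0 < δ)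
    (y y' : Minkowski) :
    (inner ℂ (pointVec hħ ψ hδ y) (pointVec hħ ψ hδ y') : ℂ).re =
      ħ * (logReg (2 * δ) (y - y') - conv (logReg (2 * δ)) ψ.1 y - conv (logReg (2 * δ)) ψ.1 y' +
        ∫ x, ψ.1 x * conv (logReg (2 * δ)) ψ.1 x) := by
  rw [← fourier_dipole ψ y y' (by positivity : 0 < 2 * δ), L2.inner_def, ← RCLike.re_to_complex,
    ← integral_re (L2.integrable_inner _ _), ← integral_const_mul]
  refine integral_congr_ae ?_
  filter_upwards [(memLp_pointVec hħ ψ hδ y).coeFn_toLp, (memLp_pointVec hħ ψ hδ y').coeFn_toLp]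
    with k h1 h2
  have h3 := congrArg Complex.ofReal (sqrt_weight_mul_self hħ k)
  have h5 : Real.exp (-(2 * δ) * |k|) = Real.exp (-δ * |k|) * Real.exp (-δ * |k|) := by
    rw [← Real.exp_add]; congr 1; ring
  have h4 : (inner ℂ (pointVec hħ ψ hδ y k) (pointVec hħ ψ hδ y' k) : ℂ) =
      ((ħ * (Real.exp (-(2 * δ) * |k|) / (4 * Real.pi * |k|)) : ℝ) : ℂ) *
        ((starRingEnd ℂ) (dipoleTransform ψ y k) * dipoleTransform ψ y' k) := by
    rw [show ħ * (Real.exp (-(2 * δ) * |k|) / (4 * Real.pi * |k|)) =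
      ħ / (4 * Real.pi * |k|) * Real.exp (-(2 * δ) * |k|) by ring, h5, Complex.ofReal_mul, ← h3,
      pointVec, pointVec, h1, h2, RCLike.inner_apply, map_mul, map_mul, Complex.conj_ofReal,
      Complex.conj_ofReal, Complex.ofReal_mul, Complex.ofReal_mul]
    ring
  rw [h4, RCLike.re_to_complex, Complex.re_ofReal_mul]
  ring

/-- The background terms cancel in the difference, and continuity of `pointVec` follows from that of
`logReg (2 * δ)`. -/
theorem norm_sq_pointVec_sub {ħ : ℝ} (hħ : 0 ≤ ħ) (ψ : UnitDensity) {δ : ℝ} (hδ : 0 < δ)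
    (y y' : Minkowski) :
    ‖pointVec hħ ψ hδ y - pointVec hħ ψ hδ y'‖ ^ 2 =
      2 * ħ * (logReg (2 * δ) 0 - logReg (2 * δ) (y - y')) := by
  have h1 (v : L2) : ‖v‖ ^ 2 = (inner ℂ v v : ℂ).re := by
    rw [inner_self_eq_norm_sq_to_K]
    norm_cast
  rw [@norm_sub_sq ℂ, h1, h1, RCLike.re_to_complex, re_inner_pointVec, re_inner_pointVec, re_inner_pointVec,
    sub_self, sub_self]
  ring

theorem continuous_pointVec {ħ : ℝ} (hħ : 0 ≤ ħ) (ψ : UnitDensity) {δ : ℝ} (hδ : 0 < δ) :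
    Continuous (pointVec hħ ψ hδ) := by
  rw [continuous_iff_continuousAt]
  intro y
  rw [ContinuousAt, tendsto_iff_norm_sub_tendsto_zero]
  have hc := continuous_logReg (by positivity : 2 * δ ≠ 0)
  have h1 : Tendsto (fun y' => Real.sqrt (2 * ħ * (logReg (2 * δ) 0 - logReg (2 * δ) (y' - y))))
      (𝓝 y) (𝓝 0) := by
    have h2 : Continuous fun y' => Real.sqrt (2 * ħ * (logReg (2 * δ) 0 - logReg (2 * δ) (y' - y))) := by
      fun_prop
    have h3 := h2.tendsto y
    simpa using h3
  refine h1.congr fun y' => ?_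
  rw [← norm_sq_pointVec_sub hħ ψ hδ, Real.sqrt_sq (norm_nonneg _)]

theorem inner_oneParticle_pointVec {ħ : ℝ} (hħ : 0 ≤ ħ) (f : TestDensity) (hf : ∫ x, f x = 0)
    (ψ : UnitDensity) {δ : ℝ} (hδ : 0 < δ) (y : Minkowski) :
    inner ℂ (oneParticle ħ f hf) (pointVec hħ ψ hδ y) =
      pairing ħ f (fun k => (Real.exp (-δ * |k|) : ℂ) * dipoleTransform ψ y k) :=
  inner_toLp_weight hħ (memLp_oneParticleFun ħ f hf) (memLp_pointVec hħ ψ hδ y)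

/-! ### Displaced vectors -/

theorem inner_tmul (η η' : Fock) (ξ ξ' : L2) :
    inner ℂ (tmul η ξ) (tmul η' ξ') = (inner ℂ η η' * inner ℂ ξ ξ' : ℂ) := by
  rw [tmul, tmul, UniformSpace.Completion.inner_coe, TensorProduct.inner_tmul]

theorem norm_tmul' (η : Fock) (ξ : L2) : ‖tmul η ξ‖ = ‖η‖ * ‖ξ‖ := by
  rw [tmul, UniformSpace.Completion.norm_coe, TensorProduct.norm_tmul]

theorem continuous_tmul : Continuous fun q : Fock × L2 => tmul q.1 q.2 := by
  have h : IsBoundedBilinearMap ℂ fun q : Fock × L2 => tmul q.1 q.2 :=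
    { add_left := fun x y z => by
        simp only [tmul, TensorProduct.add_tmul, UniformSpace.Completion.coe_add]
      smul_left := fun c x y => by
        simp only [tmul, ← TensorProduct.smul_tmul', UniformSpace.Completion.coe_smul]
      add_right := fun x y z => by
        simp only [tmul, TensorProduct.tmul_add, UniformSpace.Completion.coe_add]
      smul_right := fun c x y => by
        simp only [tmul, TensorProduct.tmul_smul, UniformSpace.Completion.coe_smul]
      bound := ⟨1, one_pos, fun x y => by rw [norm_tmul', one_mul]⟩ }
  exact h.continuous

theorem continuous_tmul_comp {X : Type*} [TopologicalSpace X] {η : X → Fock} {ξ : X → L2}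
    (hη : Continuous η) (hξ : Continuous ξ) : Continuous fun s => tmul (η s) (ξ s) :=
  continuous_tmul.comp (hη.prodMk hξ)

theorem tmul_smul_left (c : ℂ) (η : Fock) (ξ : L2) : tmul (c • η) ξ = c • tmul η ξ := by
  simp only [tmul, ← TensorProduct.smul_tmul', UniformSpace.Completion.coe_smul]

theorem continuous_expVec : Continuous expVec := by
  rw [continuous_iff_continuousAt]
  intro u
  rw [ContinuousAt, tendsto_iff_norm_sub_tendsto_zero]
  have h1 (v : L2) : ‖expVec v - expVec u‖ = Real.sqrt (inner ℂ (expVec v - expVec u) (expVec v - expVec u) : ℂ).re := by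
    rw [norm_eq_sqrt_re_inner (𝕜 := ℂ)]
    rfl
  simp only [h1, inner_sub_left, inner_sub_right, inner_expVec]
  have h2 : Continuous fun v : L2 => Real.sqrt (Complex.exp (inner ℂ v v) - Complex.exp (inner ℂ u v) -
      (Complex.exp (inner ℂ v u) - Complex.exp (inner ℂ u u))).re := by
    have hi {F G : L2 → L2} (hF : Continuous F) (hG : Continuous G) :
      Continuous fun v => (inner ℂ (F v) (G v) : ℂ) := hF.inner hG
    have := hi continuous_id continuous_id
    have := hi continuous_id (continuous_const (y := u))
    have := hi (continuous_const (y := u)) continuous_id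
    simp only [id] at *
    fun_prop
  have h3 := h2.tendsto u
  simp only [sub_self, Complex.zero_re, Real.sqrt_zero] at h3
  exact h3

/-- The vector `exp(-⟪w, u⟫ - ‖u‖²/2) e(i(u + w)) ⊗ ξ`: the Weyl operator of `w`, normalized without its
vacuum expectation value, applied to the coherent state of `u`. -/
def displacedVec (u w ξ : L2) : DMSpace :=
  Complex.exp (-inner ℂ w u - (‖u‖ : ℂ) ^ 2 / 2) • tmul (expVec (Complex.I • (u + w))) ξ

theorem continuous_displacedVec (u : L2) : Continuous fun q : L2 × L2 => displacedVec u q.1 q.2 := by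
  have h1 : Continuous fun q : L2 × L2 => (inner ℂ q.1 u : ℂ) := continuous_fst.inner continuous_const
  have h3 : Continuous fun q : L2 × L2 => Complex.I • (u + q.1) := by fun_prop
  have h2 : Continuous fun q : L2 × L2 => tmul (expVec (Complex.I • (u + q.1))) q.2 :=
    continuous_tmul_comp (continuous_expVec.comp h3) continuous_snd
  exact Continuous.smul (Complex.continuous_exp.comp (h1.neg.sub continuous_const)) h2

theorem inner_I_smul_I_smul (u v : L2) : (inner ℂ (Complex.I • u) (Complex.I • v) : ℂ) = inner ℂ u v := by
  rw [inner_smul_left, inner_smul_right, Complex.conj_I, ← mul_assoc, neg_mul, Complex.I_mul_I, neg_neg,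
    one_mul]

/-- In the real part of the exponent all terms with `u` cancel: conjugation by a coherent state
changes a Weyl operator only by a phase. The final bound is therefore uniform in the test density
`f`. -/
theorem norm_inner_displacedVec (u w w' ξ ξ' : L2) :
    ‖(inner ℂ (displacedVec u w ξ) (displacedVec u w' ξ') : ℂ)‖ =
      Real.exp (inner ℂ w w' : ℂ).re * ‖(inner ℂ ξ ξ' : ℂ)‖ := by
  rw [displacedVec, displacedVec, inner_smul_left, inner_smul_right, inner_tmul, inner_expVec,
    inner_I_smul_I_smul, norm_mul, norm_mul, norm_mul, RCLike.norm_conj, Complex.norm_exp, Complex.norm_exp,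
    Complex.norm_exp, ← mul_assoc, ← mul_assoc, ← Real.exp_add, ← Real.exp_add]
  congr 2
  have h2 : (inner ℂ u w' : ℂ).re = (inner ℂ w' u : ℂ).re := by
    rw [← inner_conj_symm, Complex.conj_re]
  have h3 : (inner ℂ u u : ℂ).re = ‖u‖ ^ 2 := by
    rw [inner_self_eq_norm_sq_to_K, ← Complex.ofReal_re (‖u‖ ^ 2), Complex.ofReal_pow]; rfl
  have h4 : ((‖u‖ : ℂ) ^ 2 / 2).re = ‖u‖ ^ 2 / 2 := by
    rw [← Complex.ofReal_pow, ← Complex.ofReal_ofNat, ← Complex.ofReal_div, Complex.ofReal_re]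
  simp only [inner_add_left, inner_add_right, Complex.add_re, Complex.sub_re, Complex.neg_re, h4, h2, h3]
  ring

/-- The displacement `w` enters only through its pairings with `u'` and `u`, not through its norm.
These pairings stay finite when `w` tends to the vector of a point charge. -/
theorem inner_displacedVec_zero (u' u w ξ' ξ : L2) :
    inner ℂ (displacedVec u' 0 ξ') (displacedVec u w ξ) =
      Complex.exp (inner ℂ u' u - (‖u'‖ : ℂ) ^ 2 / 2 - (‖u‖ : ℂ) ^ 2 / 2) *
        (Complex.exp (inner ℂ u' w - (starRingEnd ℂ) (inner ℂ u w)) * inner ℂ ξ' ξ) := by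
  rw [displacedVec, displacedVec, inner_smul_left, inner_smul_right, inner_tmul, inner_expVec,
    inner_I_smul_I_smul, ← Complex.exp_conj, ← mul_assoc, ← mul_assoc, ← mul_assoc, ← Complex.exp_add,
    ← Complex.exp_add, ← Complex.exp_add]
  congr 2
  have h4 : (starRingEnd ℂ) ((‖u'‖ : ℂ) ^ 2 / 2) = (‖u'‖ : ℂ) ^ 2 / 2 := by
    rw [map_div₀, map_pow, Complex.conj_ofReal, map_ofNat]
  simp only [inner_zero_left, neg_zero, zero_sub, map_neg, h4, add_zero, inner_add_right, inner_conj_symm]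
  ring

/-- The one particle vector of the projection of a test density. -/
def oneParticleProj (ħ : ℝ) (ψ : UnitDensity) (f : TestDensity) : L2 :=
  oneParticle ħ (projDensity ψ f) (integral_projDensity ψ f)

/-- The Schrödinger Weyl operator of a test density. -/
def schrodingerOf (ħ : ℝ) (ψ : UnitDensity) (f : TestDensity) : L2 →ₗᵢ[ℂ] L2 :=
  schrodinger ħ (∫ x, f x) (commutatorForm f ψ.1)

theorem weylVec_eq (ħ : ℝ) (ψ : UnitDensity) (f : TestDensity) (ξ : L2) :
    weylVec ħ ψ f ξ = displacedVec (oneParticleProj ħ ψ f) 0 (schrodingerOf ħ ψ f ξ) := by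
  rw [weylVec, weylRep, tensorOp_tmul, vacuum, displacement_expVec, tmul_smul_left, displacedVec]
  congr 1
  · congr 1
    simp only [norm_smul, Complex.norm_I, one_mul, inner_zero_right, inner_zero_left, oneParticleProj]
    ring
  · simp only [zero_add, add_zero, oneParticleProj]
    rfl

theorem weylRep_displacedVec (ħ : ℝ) (ψ : UnitDensity) (h : TestDensity) (u ξ : L2) :
    weylRep ħ ψ h (displacedVec u 0 ξ) = ((Real.exp (-‖oneParticleProj ħ ψ h‖ ^ 2 / 2) : ℝ) : ℂ) •
      displacedVec u (oneParticleProj ħ ψ h) (schrodingerOf ħ ψ h ξ) := by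
  rw [displacedVec, map_smul, weylRep, tensorOp_tmul, displacement_expVec, tmul_smul_left, displacedVec,
    smul_smul, smul_smul, Complex.ofReal_exp, ← Complex.exp_add, ← Complex.exp_add]
  congr 2
  · simp only [norm_smul, Complex.norm_I, one_mul, inner_zero_left, oneParticleProj, add_zero,
      inner_I_smul_I_smul]
    push_cast
    ring
  · simp only [add_zero, smul_add, oneParticleProj]

theorem normalOrderedExp_weylVec (ħ : ℝ) (ψ : UnitDensity) (h f : TestDensity) (ξ : L2) :
    normalOrderedExp ħ ψ h (weylVec ħ ψ f ξ) =
      ((Real.exp (ħ / 2 * hadamardForm h h - ‖oneParticleProj ħ ψ h‖ ^ 2 / 2) : ℝ) : ℂ) •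
        displacedVec (oneParticleProj ħ ψ f) (oneParticleProj ħ ψ h)
          (schrodingerOf ħ ψ h (schrodingerOf ħ ψ f ξ)) := by
  rw [normalOrderedExp, _root_.smul_apply, weylVec_eq, weylRep_displacedVec, smul_smul,
    ← Complex.ofReal_mul, ← Real.exp_add]
  congr 4
  ring

/-! ### Continuity of the Schrödinger Weyl operators -/

theorem inner_schrodinger (ħ α β β' : ℝ) (ξ : L2) :
    (inner ℂ (schrodinger ħ α β ξ) (schrodinger ħ α β' ξ) : ℂ) =
      ∫ k, Complex.exp ((((β - β') * (k - ħ * α / 2) : ℝ) : ℂ) * Complex.I) *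
        ((‖ξ (k - ħ * α)‖ ^ 2 : ℝ) : ℂ) := by
  rw [L2.inner_def]
  refine integral_congr_ae ?_
  filter_upwards [(memLp_schrodinger ħ α β ξ).coeFn_toLp, (memLp_schrodinger ħ α β' ξ).coeFn_toLp]
    with k h1 h2
  have h1' : schrodinger ħ α β ξ k = _ := h1
  have h2' : schrodinger ħ α β' ξ k = _ := h2
  rw [h1', h2', RCLike.inner_apply, map_mul, ← Complex.exp_conj, map_mul, Complex.conj_ofReal,
    Complex.conj_I, mul_mul_mul_comm, ← Complex.exp_add, Complex.mul_conj, Complex.normSq_eq_norm_sq]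
  congr 2
  push_cast
  ring

theorem integrable_norm_sq_translate (ξ : L2) (c : ℝ) : Integrable fun k => ‖ξ (k - c)‖ ^ 2 := by
  have hs := (Lp.memLp ξ).comp_measurePreserving (measurePreserving_sub_right volume c)
  exact (memLp_two_iff_integrable_sq_norm hs.1).1 hs

/-- The operators are isometries, so strong continuity follows from continuity of the inner
products, which is dominated convergence with the integrable bound `|ξ|²`. -/
theorem continuous_schrodinger (ħ α : ℝ) (ξ : L2) : Continuous fun β => schrodinger ħ α β ξ := by
  rw [continuous_iff_continuousAt]
  intro β
  rw [ContinuousAt, tendsto_iff_norm_sub_tendsto_zero]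
  have h1 (β' : ℝ) : ‖schrodinger ħ α β' ξ - schrodinger ħ α β ξ‖ =
      Real.sqrt (2 * (‖ξ‖ ^ 2 - (inner ℂ (schrodinger ħ α β' ξ) (schrodinger ħ α β ξ) : ℂ).re)) := by
    rw [← Real.sqrt_sq (norm_nonneg (_ - _)), @norm_sub_sq ℂ, LinearIsometry.norm_map,
      LinearIsometry.norm_map, RCLike.re_to_complex]
    congr 1
    ring
  have h2 : Continuous fun β' => (inner ℂ (schrodinger ħ α β' ξ) (schrodinger ħ α β ξ) : ℂ) := by
    simp only [inner_schrodinger]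
    have hi := integrable_norm_sq_translate ξ (ħ * α)
    refine continuous_of_dominated (bound := fun k => ‖ξ (k - ħ * α)‖ ^ 2) (fun β' => ?_)
      (fun β' => ?_) hi ?_
    · exact (Continuous.aestronglyMeasurable (by fun_prop)).mul hi.ofReal.1
    · refine Eventually.of_forall fun k => ?_
      rw [norm_mul, Complex.norm_exp_ofReal_mul_I, one_mul, Complex.norm_real,
        Real.norm_of_nonneg (by positivity)]
    · exact Eventually.of_forall fun k => by fun_prop
  have h3 : (inner ℂ (schrodinger ħ α β ξ) (schrodinger ħ α β ξ) : ℂ).re = ‖ξ‖ ^ 2 := by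
    rw [← (schrodinger ħ α β).norm_map ξ, ← RCLike.re_to_complex, inner_self_eq_norm_sq]
  have h4 : Continuous fun β' =>
      Real.sqrt (2 * (‖ξ‖ ^ 2 - (inner ℂ (schrodinger ħ α β' ξ) (schrodinger ħ α β ξ) : ℂ).re)) := by
    fun_prop
  have h5 := h4.tendsto β
  simp only [h3, sub_self, mul_zero, Real.sqrt_zero] at h5
  exact h5.congr fun β' => (h1 β').symm

/-! ### Smeared charges -/

theorem smearedCharges_apply {n : ℕ} (ρ : TestDensity) (ε : ℝ) (α : Fin n → ℝ) (x : Fin n → Minkowski)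
    (y : Minkowski) : smearedCharges ρ ε α x y = ∑ j, α j * mollifier ρ ε (x j) y := by
  have h (s : Finset (Fin n)) : (∑ j ∈ s, α j • mollifier ρ ε (x j)) y =
      ∑ j ∈ s, α j * mollifier ρ ε (x j) y := by
    classical
    induction s using Finset.induction_on with
    | empty => rfl
    | insert a s ha ih => rw [Finset.sum_insert ha, Finset.sum_insert ha, ← ih]; rfl
  exact h Finset.univ

theorem integrable_test_smul {E : Type*} [NormedAddCommGroup E] [NormedSpace ℝ E] (f : TestDensity)
    {F : Minkowski → E} (hF : Continuous F) : Integrable fun y => f y • F y := by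
  have := f.continuous
  exact Continuous.integrable_of_hasCompactSupport (by fun_prop) f.hasCompactSupport.smul_right

theorem integral_smearedCharges_smul {E : Type*} [NormedAddCommGroup E] [NormedSpace ℝ E] {n : ℕ}
    (ρ : TestDensity) {ε : ℝ} (hε : ε ≠ 0) (α : Fin n → ℝ) (x : Fin n → Minkowski)
    {F : Minkowski → E} (hF : Continuous F) :
    ∫ y, smearedCharges ρ ε α x y • F y = ∑ j, α j • smear ρ F ε (x j) := by
  simp only [smearedCharges_apply, Finset.sum_smul, mul_smul]
  have hi (j : Fin n) : Integrable fun y => α j • mollifier ρ ε (x j) y • F y :=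
    (integrable_test_smul (mollifier ρ ε (x j)) hF).smul (α j)
  rw [integral_finsetSum _ fun j _ => hi j]
  simp only [integral_smul, integral_mollifier_smul ρ F hε]

theorem integral_smearedCharges {n : ℕ} {ρ : TestDensity} (hρ : ∫ x, ρ x = 1) {ε : ℝ} (hε : ε ≠ 0)
    (α : Fin n → ℝ) (x : Fin n → Minkowski) : ∫ y, smearedCharges ρ ε α x y = ∑ j, α j := by
  have h := integral_smearedCharges_smul ρ hε α x (F := fun _ => (1 : ℝ)) continuous_const
  simpa [smear, hρ] using h

theorem integral_test_conv_sub_smul {κ : Minkowski → ℝ} (hκ : LocallyIntegrable κ)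
    (f h h' : TestDensity) (c : ℝ) :
    ∫ x, f x * conv κ (fun y => h y - c * h' y) x =
      (∫ x, f x * conv κ h x) - c * ∫ x, f x * conv κ h' x := by
  have h1 (x : Minkowski) : conv κ (fun y => h y - c * h' y) x = conv κ h x - c * conv κ h' x := by
    simp only [conv, mul_sub]
    rw [integral_sub (integrable_conv hκ h.continuous h.hasCompactSupport x), ← integral_const_mul]
    · congr 2
      funext y
      ring
    · refine ((integrable_conv hκ h'.continuous h'.hasCompactSupport x).const_mul c).congr
        (Eventually.of_forall fun y => ?_)
      ring
  have i1 := integrable_test_smul f (continuous_conv hκ h.continuous h.hasCompactSupport)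
  have i2 := integrable_test_smul f (continuous_conv hκ h'.continuous h'.hasCompactSupport)
  simp only [smul_eq_mul] at i1 i2
  simp only [h1, mul_sub]
  rw [integral_sub i1, ← integral_const_mul]
  · congr 2
    funext y
    ring
  · exact (i2.const_mul c).congr (Eventually.of_forall fun y => by ring)

theorem hadamardKer_neg (z : Minkowski) : hadamardKer (-z) = hadamardKer z := by
  simp [hadamardKer]

theorem hadamardForm_comm (f h : TestDensity) : hadamardForm f h = hadamardForm h f := by
  rw [hadamardForm_eq, hadamardForm_eq, integral_mul_conv_comm measurable_hadamardKer
    locallyIntegrable_hadamardKer hadamardKer_neg h.continuous h.hasCompactSupport f.continuous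
    f.hasCompactSupport]

theorem hadamardForm_projDensity (ψ : UnitDensity) (h : TestDensity) :
    hadamardForm (projDensity ψ h) (projDensity ψ h) =
      hadamardForm h h - 2 * (∫ x, h x) * hadamardForm h ψ.1 +
        (∫ x, h x) ^ 2 * hadamardForm ψ.1 ψ.1 := by
  have key (f : TestDensity) : hadamardForm f (projDensity ψ h) =
      hadamardForm f h - (∫ x, h x) * hadamardForm f ψ.1 :=
    integral_test_conv_sub_smul locallyIntegrable_hadamardKer f h ψ.1 _
  rw [key, hadamardForm_comm _ h, key, hadamardForm_comm (projDensity ψ h) ψ.1, key,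
    hadamardForm_comm ψ.1 h]
  ring

/-- The self-energy of `h` cancels. What remains involves `h` only through its charge and its
pairing with the continuous potential of `ψ`, both of which make sense for point charges. -/
theorem normalOrdering_exponent {ħ : ℝ} (hħ : 0 ≤ ħ) (ψ : UnitDensity) (h : TestDensity) :
    ħ / 2 * hadamardForm h h - ‖oneParticleProj ħ ψ h‖ ^ 2 / 2 =
      ħ * (∫ x, h x) * hadamardForm h ψ.1 - ħ * (∫ x, h x) ^ 2 / 2 * hadamardForm ψ.1 ψ.1 := by
  rw [oneParticleProj, norm_sq_oneParticle hħ, hadamardForm_projDensity]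
  ring

/-! ### Matrix elements of normal ordered exponentials -/

/-- The exponent in the matrix elements of the normal ordered exponential of smeared charges; at `ε = 0`
that of point charges. -/
def smearedExponent (ħ : ℝ) (ψ : UnitDensity) {n : ℕ} (ρ : TestDensity) (α : Fin n → ℝ) (ε : ℝ)
    (x : Fin n → Minkowski) : ℝ :=
  ħ * (∑ j, α j) * ∑ j, α j * smear ρ (conv hadamardKer ψ.1) ε (x j) -
    ħ * (∑ j, α j) ^ 2 / 2 * hadamardForm ψ.1 ψ.1

/-- The momentum translation by smeared charges. -/
def smearedMomentum (ψ : UnitDensity) {n : ℕ} (ρ : TestDensity) (α : Fin n → ℝ) (ε : ℝ)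
    (x : Fin n → Minkowski) : ℝ :=
  ∑ j, α j * smear ρ (conv commutatorKer ψ.1) ε (x j)

/-- The transform of smeared charges neutralized by a multiple of `ψ`. -/
def smearedTransform (ψ : UnitDensity) {n : ℕ} (ρ : TestDensity) (α : Fin n → ℝ) (ε : ℝ)
    (x : Fin n → Minkowski) (k : ℝ) : ℂ :=
  ∑ j, (α j : ℂ) * (smear ρ (planeWave k) ε (x j) - lightConeTransform ψ.1 k)

/-- The matrix element between coherent vectors as a function of the exponent, the two pairings and the
momentum translation. -/
def matrixElt (ħ : ℝ) (ψ : UnitDensity) (c : ℝ) (f' f : TestDensity) (ξ' ξ : L2)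
    (r : ℝ) (p' p : ℂ) (b : ℝ) : ℂ :=
  (Real.exp r : ℂ) * (Complex.exp (inner ℂ (oneParticleProj ħ ψ f') (oneParticleProj ħ ψ f)
      - (‖oneParticleProj ħ ψ f'‖ : ℂ) ^ 2 / 2 - (‖oneParticleProj ħ ψ f‖ : ℂ) ^ 2 / 2) *
    (Complex.exp (p' - (starRingEnd ℂ) p) * inner ℂ (schrodingerOf ħ ψ f' ξ')
      (schrodinger ħ c b (schrodingerOf ħ ψ f ξ))))

theorem continuous_matrixElt (ħ : ℝ) (ψ : UnitDensity) (c : ℝ) (f' f : TestDensity) (ξ' ξ : L2) :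
    Continuous fun q : ℝ × ℂ × ℂ × ℝ => matrixElt ħ ψ c f' f ξ' ξ q.1 q.2.1 q.2.2.1 q.2.2.2 := by
  have h1 : Continuous fun q : ℝ × ℂ × ℂ × ℝ => (inner ℂ (schrodingerOf ħ ψ f' ξ')
      (schrodinger ħ c q.2.2.2 (schrodingerOf ħ ψ f ξ)) : ℂ) :=
    continuous_const.inner ((continuous_schrodinger ħ c _).comp (by fun_prop))
  have h2 : Continuous fun q : ℝ × ℂ × ℂ × ℝ => (starRingEnd ℂ) q.2.2.1 :=
    Complex.continuous_conj.comp (by fun_prop)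
  unfold matrixElt
  fun_prop

theorem lightConeTransform_projDensity (ψ : UnitDensity) (h : TestDensity) (k : ℝ) :
    lightConeTransform (projDensity ψ h) k =
      lightConeTransform h k - (∫ x, h x) * lightConeTransform ψ.1 k := by
  have hF := continuous_planeWave k
  have h1 (x : Minkowski) : projDensity ψ h x • planeWave k x =
      h x • planeWave k x - (∫ x, h x) • (ψ.1 x • planeWave k x) := by
    rw [smul_smul, ← sub_smul]
    rfl
  have hi : Integrable fun x => (∫ x, h x) • (ψ.1 x • planeWave k x) :=
    (integrable_test_smul ψ.1 hF).smul (∫ x, h x)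
  simp only [lightConeTransform_eq, h1]
  rw [integral_sub (integrable_test_smul h hF) hi, integral_smul, Complex.real_smul]

theorem lightConeTransform_projDensity_smearedCharges (ψ : UnitDensity) {n : ℕ} {ρ : TestDensity}
    (hρ : ∫ x, ρ x = 1) {ε : ℝ} (hε : ε ≠ 0) (α : Fin n → ℝ) (x : Fin n → Minkowski) :
    lightConeTransform (projDensity ψ (smearedCharges ρ ε α x)) = smearedTransform ψ ρ α ε x := by
  funext k
  rw [lightConeTransform_projDensity, integral_smearedCharges hρ hε, lightConeTransform_eq,
    integral_smearedCharges_smul ρ hε α x (continuous_planeWave k), smearedTransform]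
  simp only [mul_sub, Finset.sum_sub_distrib, Complex.real_smul, Complex.ofReal_sum, Finset.sum_mul]

/-- The points and the smearing enter only through one exponent, two pairings and one momentum
translation, all of which extend continuously to `ε = 0`. -/
theorem inner_normalOrderedExp {ħ : ℝ} (hħ : 0 ≤ ħ) (ψ : UnitDensity) {n : ℕ} {ρ : TestDensity}
    (hρ : ∫ x, ρ x = 1) {ε : ℝ} (hε : ε ≠ 0) (α : Fin n → ℝ) (x : Fin n → Minkowski)
    (f' f : TestDensity) (ξ' ξ : L2) :
    inner ℂ (weylVec ħ ψ f' ξ')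
      (normalOrderedExp ħ ψ (smearedCharges ρ ε α x) (weylVec ħ ψ f ξ)) =
    matrixElt ħ ψ (∑ j, α j) f' f ξ' ξ (smearedExponent ħ ψ ρ α ε x)
      (pairing ħ (projDensity ψ f') (smearedTransform ψ ρ α ε x))
      (pairing ħ (projDensity ψ f) (smearedTransform ψ ρ α ε x)) (smearedMomentum ψ ρ α ε x) := by
  have h1 : hadamardForm (smearedCharges ρ ε α x) ψ.1 =
      ∑ j, α j * smear ρ (conv hadamardKer ψ.1) ε (x j) :=
    integral_smearedCharges_smul ρ hε α x (continuous_conv locallyIntegrable_hadamardKer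
      ψ.1.continuous ψ.1.hasCompactSupport)
  have h2 : commutatorForm (smearedCharges ρ ε α x) ψ.1 = smearedMomentum ψ ρ α ε x := by
    rw [commutatorForm_eq]
    exact integral_smearedCharges_smul ρ hε α x (continuous_conv locallyIntegrable_commutatorKer
      ψ.1.continuous ψ.1.hasCompactSupport)
  have h3 : schrodingerOf ħ ψ (smearedCharges ρ ε α x) =
      schrodinger ħ (∑ j, α j) (smearedMomentum ψ ρ α ε x) := by
    rw [schrodingerOf, integral_smearedCharges hρ hε, h2]
  rw [normalOrderedExp_weylVec, weylVec_eq, inner_smul_right, inner_displacedVec_zero,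
    normalOrdering_exponent hħ, integral_smearedCharges hρ hε, h1, matrixElt, ← smearedExponent,
    h3]
  simp only [oneParticleProj, inner_oneParticle hħ,
    lightConeTransform_projDensity_smearedCharges ψ hρ hε]

/-! ### Removing the smearing -/

theorem norm_smearedTransform_le (ψ : UnitDensity) {n : ℕ} (ρ : TestDensity) (α : Fin n → ℝ) (ε : ℝ)
    (x : Fin n → Minkowski) (k : ℝ) :
    ‖smearedTransform ψ ρ α ε x k‖ ≤ ∑ j, |α j| * ((∫ z, |ρ z|) + ∫ z, |ψ.1 z|) := by
  refine norm_sum_le_of_le _ fun j _ => ?_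
  rw [norm_mul, Complex.norm_real, Real.norm_eq_abs]
  refine mul_le_mul_of_nonneg_left ((norm_sub_le _ _).trans ?_) (abs_nonneg _)
  exact add_le_add (norm_smear_planeWave_le ρ ε _ k) (norm_lightConeTransform_le_integral ψ.1 k)

theorem continuous_smear_comp {E X : Type*} [NormedAddCommGroup E] [NormedSpace ℝ E] [TopologicalSpace X]
    (ρ : TestDensity) {η : Minkowski → E} (hη : Continuous η) {e : X → ℝ} {y : X → Minkowski}
    (he : Continuous e) (hy : Continuous y) : Continuous fun s => smear ρ η (e s) (y s) :=
  (continuous_smear ρ hη).comp (he.prodMk hy)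

theorem continuous_smearedExponent (ħ : ℝ) (ψ : UnitDensity) {n : ℕ} (ρ : TestDensity)
    (α : Fin n → ℝ) :
    Continuous fun q : ℝ × (Fin n → Minkowski) => smearedExponent ħ ψ ρ α q.1 q.2 := by
  have h := continuous_conv locallyIntegrable_hadamardKer ψ.1.continuous ψ.1.hasCompactSupport
  have h1 (j : Fin n) : Continuous fun q : ℝ × (Fin n → Minkowski) =>
      smear ρ (conv hadamardKer ψ.1) q.1 (q.2 j) :=
    continuous_smear_comp ρ h continuous_fst ((continuous_apply j).comp continuous_snd)
  unfold smearedExponent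
  fun_prop

theorem continuous_smearedMomentum (ψ : UnitDensity) {n : ℕ} (ρ : TestDensity) (α : Fin n → ℝ) :
    Continuous fun q : ℝ × (Fin n → Minkowski) => smearedMomentum ψ ρ α q.1 q.2 := by
  have h := continuous_conv locallyIntegrable_commutatorKer ψ.1.continuous ψ.1.hasCompactSupport
  have h1 (j : Fin n) : Continuous fun q : ℝ × (Fin n → Minkowski) =>
      smear ρ (conv commutatorKer ψ.1) q.1 (q.2 j) :=
    continuous_smear_comp ρ h continuous_fst ((continuous_apply j).comp continuous_snd)
  unfold smearedMomentum
  fun_prop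

theorem continuous_smear_planeWave (ρ : TestDensity) (ε : ℝ) (x : Minkowski) :
    Continuous fun k => smear ρ (planeWave k) ε x := by
  refine continuous_of_dominated (bound := fun z => |ρ z|) (fun k => ?_) (fun k => ?_)
    (integrable_test ρ).norm ?_
  · exact (integrable_test_smul ρ (F := fun z => planeWave k (x + ε • z))
      ((continuous_planeWave k).comp (by fun_prop))).1
  · exact Eventually.of_forall fun z => by rw [norm_smul, norm_planeWave, mul_one]; exact le_rfl
  · refine Eventually.of_forall fun z => ?_
    unfold planeWave
    fun_prop

theorem continuous_pairing_smearedTransform (ħ : ℝ) (ψ : UnitDensity) {n : ℕ} (ρ : TestDensity)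
    (α : Fin n → ℝ) (f : TestDensity) (hf : ∫ x, f x = 0) :
    Continuous fun q : ℝ × (Fin n → Minkowski) => pairing ħ f (smearedTransform ψ ρ α q.1 q.2) := by
  rw [continuous_iff_continuousAt]
  intro q
  refine tendsto_pairing ħ f hf (M := ∑ j, |α j| * ((∫ z, |ρ z|) + ∫ z, |ψ.1 z|))
    (Eventually.of_forall fun q => ?_) (Eventually.of_forall fun q k => norm_smearedTransform_le _ _ _ _ _ k)
    fun k => ?_
  · have h1 (j : Fin n) := continuous_smear_planeWave ρ q.1 (q.2 j)
    have h2 := continuous_lightConeTransform ψ.1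
    refine Continuous.measurable ?_
    unfold smearedTransform
    fun_prop
  · have h1 (j : Fin n) : Continuous fun q : ℝ × (Fin n → Minkowski) =>
        smear ρ (planeWave k) q.1 (q.2 j) :=
      continuous_smear_comp ρ (continuous_planeWave k) continuous_fst
        ((continuous_apply j).comp continuous_snd)
    have h3 : Continuous fun q : ℝ × (Fin n → Minkowski) => smearedTransform ψ ρ α q.1 q.2 k := by
      unfold smearedTransform
      fun_prop
    exact h3.tendsto q

/-- The kernel may be singular, but it is integrable with compact support, and `G` is bounded on
compact sets; dominated convergence applies. -/
theorem tendsto_integral_mul_of_continuous {X : Type*} [TopologicalSpace X] [MeasurableSpace X]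
    [OpensMeasurableSpace X] [SecondCountableTopology X] {μ : Measure X} {κ : X → ℂ} (hκ : Integrable κ μ)
    {K : Set X} (hK : IsCompact K) (h0 : ∀ x ∉ K, κ x = 0) {G : ℝ × X → ℂ} (hG : Continuous G) :
    (∀ ε, Integrable (fun x => κ x * G (ε, x)) μ) ∧
      Tendsto (fun ε => ∫ x, κ x * G (ε, x) ∂μ) (𝓝 0) (𝓝 (∫ x, κ x * G (0, x) ∂μ)) := by
  have hb (R : ℝ) : ∃ M, ∀ ε ∈ Set.Icc (-R) R, ∀ x, ‖κ x * G (ε, x)‖ ≤ ‖κ x‖ * M := by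
    obtain ⟨M, hM⟩ := (isCompact_Icc.prod hK).exists_bound_of_continuousOn
      (f := G) (s := Set.Icc (-R) R ×ˢ K) hG.continuousOn
    refine ⟨M, fun ε hε x => ?_⟩
    by_cases hx : x ∈ K
    · rw [norm_mul]
      exact mul_le_mul_of_nonneg_left (hM _ ⟨hε, hx⟩) (norm_nonneg _)
    · rw [h0 x hx]
      simp
  have hm (ε : ℝ) : AEStronglyMeasurable (fun x => κ x * G (ε, x)) μ := by
    have h1 : Continuous fun x => G (ε, x) := by fun_prop
    exact hκ.1.mul h1.aestronglyMeasurable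
  refine ⟨fun ε => ?_, ?_⟩
  · obtain ⟨M, hM⟩ := hb |ε|
    exact (hκ.norm.mul_const M).mono' (hm ε) (Eventually.of_forall
      (hM ε (Set.mem_Icc.2 (abs_le.1 le_rfl))))
  · obtain ⟨M, hM⟩ := hb 1
    refine tendsto_integral_filter_of_dominated_convergence (fun x => ‖κ x‖ * M)
      (Eventually.of_forall hm) ?_ (hκ.norm.mul_const M) ?_
    · filter_upwards [Icc_mem_nhds (by norm_num : (-1 : ℝ) < 0) one_pos] with ε hε
      exact Eventually.of_forall (hM ε hε)
    · refine Eventually.of_forall fun x => ?_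
      have h1 : Continuous fun ε => κ x * G (ε, x) := by fun_prop
      exact h1.tendsto 0

/-- The kernel `t(x) g(x₁) ⋯ g(xₙ)`. -/
def cutoffKernel (ħ : ℝ) (σ : ℤˣ) (g : TestDensity) {n : ℕ} (α : Fin n → ℝ) (x : Fin n → Minkowski) : ℂ :=
  timeOrderedKernel ħ σ α x * ∏ j, (g (x j) : ℂ)

/-- The matrix element of the normal ordered exponential of point charges. -/
def pointMatrixElt (ħ : ℝ) (ψ : UnitDensity) {n : ℕ} (α : Fin n → ℝ) (f' f : TestDensity) (ξ' ξ : L2)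
    (x : Fin n → Minkowski) : ℂ :=
  matrixElt ħ ψ (∑ j, α j) f' f ξ' ξ
    (ħ * (∑ j, α j) * ∑ j, α j * conv hadamardKer ψ.1 (x j) -
      ħ * (∑ j, α j) ^ 2 / 2 * hadamardForm ψ.1 ψ.1)
    (pairing ħ (projDensity ψ f') fun k => ∑ j, (α j : ℂ) * dipoleTransform ψ (x j) k)
    (pairing ħ (projDensity ψ f) fun k => ∑ j, (α j : ℂ) * dipoleTransform ψ (x j) k)
    (∑ j, α j * conv commutatorKer ψ.1 (x j))

theorem cutoffKernel_eq_zero (ħ : ℝ) (σ : ℤˣ) (g : TestDensity) {n : ℕ} (α : Fin n → ℝ)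
    (x : Fin n → Minkowski) (hx : x ∉ Set.univ.pi fun _ : Fin n => tsupport g) :
    cutoffKernel ħ σ g α x = 0 := by
  have h : ¬∀ i, x i ∈ tsupport g := fun h => hx fun i _ => h i
  rw [cutoffKernel, prod_eq_zero_of_not_forall_mem g h, mul_zero]

theorem isCompact_pi_tsupport (g : TestDensity) (n : ℕ) :
    IsCompact (Set.univ.pi fun _ : Fin n => tsupport g) :=
  isCompact_univ_pi fun _ => g.hasCompactSupport.isCompact

theorem tendsto_integral_normalOrderedExp {ħ : ℝ} (hħ : 0 ≤ ħ) (σ : ℤˣ) (ψ : UnitDensity)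
    (g : TestDensity) {n : ℕ} (α : Fin n → ℝ) (hκ : Integrable (cutoffKernel ħ σ g α))
    {ρ : TestDensity} (hρ : ∫ x, ρ x = 1) (f' f : TestDensity) (ξ' ξ : L2) :
    (∀ ε ≠ 0, Integrable fun x => cutoffKernel ħ σ g α x * inner ℂ (weylVec ħ ψ f' ξ')
        (normalOrderedExp ħ ψ (smearedCharges ρ ε α x) (weylVec ħ ψ f ξ))) ∧
    Tendsto (fun ε : ℝ => ∫ x : Fin n → Minkowski,
        cutoffKernel ħ σ g α x * inner ℂ (weylVec ħ ψ f' ξ')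
          (normalOrderedExp ħ ψ (smearedCharges ρ ε α x) (weylVec ħ ψ f ξ)))
      (𝓝[>] 0) (𝓝 (∫ x, cutoffKernel ħ σ g α x * pointMatrixElt ħ ψ α f' f ξ' ξ x)) := by
  have hG : Continuous fun q : ℝ × (Fin n → Minkowski) =>
      matrixElt ħ ψ (∑ j, α j) f' f ξ' ξ (smearedExponent ħ ψ ρ α q.1 q.2)
      (pairing ħ (projDensity ψ f') (smearedTransform ψ ρ α q.1 q.2))
      (pairing ħ (projDensity ψ f) (smearedTransform ψ ρ α q.1 q.2)) (smearedMomentum ψ ρ α q.1 q.2) :=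
    (continuous_matrixElt ħ ψ (∑ j, α j) f' f ξ' ξ).comp
      ((continuous_smearedExponent ħ ψ ρ α).prodMk
        ((continuous_pairing_smearedTransform ħ ψ ρ α _ (integral_projDensity ψ f')).prodMk
          ((continuous_pairing_smearedTransform ħ ψ ρ α _ (integral_projDensity ψ f)).prodMk
            (continuous_smearedMomentum ψ ρ α))))
  obtain ⟨h1, h2⟩ := tendsto_integral_mul_of_continuous hκ (isCompact_pi_tsupport g n)
    (cutoffKernel_eq_zero ħ σ g α) hG
  refine ⟨fun ε hε => ?_, ?_⟩
  · simp only [inner_normalOrderedExp hħ ψ hρ hε]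
    exact h1 ε
  · have h3 (x : Fin n → Minkowski) : pointMatrixElt ħ ψ α f' f ξ' ξ x =
        matrixElt ħ ψ (∑ j, α j) f' f ξ' ξ (smearedExponent ħ ψ ρ α 0 x)
        (pairing ħ (projDensity ψ f') (smearedTransform ψ ρ α 0 x))
        (pairing ħ (projDensity ψ f) (smearedTransform ψ ρ α 0 x)) (smearedMomentum ψ ρ α 0 x) := by
      rw [pointMatrixElt, smearedExponent, smearedMomentum]
      unfold smearedTransform
      simp only [smear_zero, hρ, one_smul]
      rfl
    simp only [h3]
    refine (tendsto_nhdsWithin_of_tendsto_nhds h2).congr' ?_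
    filter_upwards [self_mem_nhdsWithin] with ε hε
    simp only [inner_normalOrderedExp hħ ψ hρ (ne_of_gt hε)]

/-! ### Weak limits -/

/-- Banach–Alaoglu, along an ultrafilter refining `l`. The weak limit along the ultrafilter must
reproduce every matrix element that converges along `l` itself. -/
theorem exists_weak_limit {H ι : Type*} [NormedAddCommGroup H] [InnerProductSpace ℂ H] [CompleteSpace H]
    {l : Filter ι} [l.NeBot] {v : ι → H} {B : ℝ} (hv : ∀ᶠ i in l, ‖v i‖ ≤ B) :
    ∃ w : H, ‖w‖ ≤ B ∧ ∀ (y : H) (c : ℂ), Tendsto (fun i => (inner ℂ y (v i) : ℂ)) l (𝓝 c) →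
      inner ℂ y w = c := by
  let φ₀ (i : ι) : WeakDual ℂ H := StrongDual.toWeakDual (InnerProductSpace.toDual ℂ H (v i))
  have hK := WeakDual.isCompact_closedBall (𝕜 := ℂ) (E := H) 0 B
  let U := (Ultrafilter.of l).map φ₀
  have hU : ↑U ≤ 𝓟 (WeakDual.toStrongDual ⁻¹' Metric.closedBall (0 : StrongDual ℂ H) B) := by
    rw [le_principal_iff]
    change φ₀ ⁻¹' _ ∈ (Ultrafilter.of l : Filter ι)
    refine Ultrafilter.of_le l ?_
    filter_upwards [hv] with i hi
    rw [Set.mem_preimage, Set.mem_preimage, mem_closedBall_zero_iff]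
    exact ((InnerProductSpace.toDual ℂ H).norm_map (v i)).le.trans hi
  obtain ⟨ℓ, hℓ, hle⟩ := hK.ultrafilter_le_nhds U hU
  refine ⟨(InnerProductSpace.toDual ℂ H).symm (WeakDual.toStrongDual ℓ), ?_, fun y c hc => ?_⟩
  · rw [LinearIsometryEquiv.norm_map]
    exact mem_closedBall_zero_iff.1 hℓ
  have h1 : Tendsto (fun i => φ₀ i y) (Ultrafilter.of l : Filter ι) (𝓝 (ℓ y)) :=
    (WeakDual.eval_continuous y).tendsto ℓ |>.comp hle
  have h2 : Tendsto (fun i => φ₀ i y) (Ultrafilter.of l : Filter ι) (𝓝 ((starRingEnd ℂ) c)) := by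
    have h3 := (Complex.continuous_conj.tendsto c).comp (hc.mono_left (Ultrafilter.of_le l))
    refine h3.congr fun i => ?_
    change (starRingEnd ℂ) (inner ℂ y (v i)) = inner ℂ (v i) y
    rw [inner_conj_symm]
  have h4 := tendsto_nhds_unique h1 h2
  rw [← inner_conj_symm, InnerProductSpace.toDual_symm_apply]
  change (starRingEnd ℂ) (ℓ y) = c
  rw [h4, Complex.conj_conj]

/-- Expand the square and take absolute values inside both integrals. Here the norm of an integrated
vector turns into the energy integral of two configurations. -/
theorem norm_sq_integral_le {H X : Type*} [NormedAddCommGroup H] [InnerProductSpace ℂ H] [CompleteSpace H]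
    [MeasurableSpace X] {μ : Measure X} [SFinite μ] {F : X → H} (hF : Integrable F μ) :
    ENNReal.ofReal (‖∫ x, F x ∂μ‖ ^ 2) ≤ ∫⁻ z, ‖(inner ℂ (F z.1) (F z.2) : ℂ)‖ₑ ∂(μ.prod μ) := by
  have h0 : ENNReal.ofReal (‖∫ x, F x ∂μ‖ ^ 2) =
      ‖(inner ℂ (∫ x, F x ∂μ) (∫ x, F x ∂μ) : ℂ)‖ₑ := by
    rw [← ofReal_norm, inner_self_eq_norm_sq_to_K]
    simp
  have hm : AEMeasurable (fun z : X × X => ‖(inner ℂ (F z.1) (F z.2) : ℂ)‖ₑ) (μ.prod μ) :=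
    (hF.1.comp_fst.inner hF.1.comp_snd).enorm
  rw [h0, ← integral_inner hF, lintegral_prod _ hm]
  refine (enorm_integral_le_lintegral_enorm _).trans (lintegral_mono fun x => ?_)
  rw [← ofReal_norm, norm_inner_symm, ofReal_norm, ← integral_inner hF]
  exact enorm_integral_le_lintegral_enorm _

/-! ### Regularized normal ordered exponentials -/

section

variable {ħ : ℝ} (hħ : 0 ≤ ħ) (ψ : UnitDensity) {δ : ℝ} (hδ : 0 < δ) {n : ℕ} (α : Fin n → ℝ)

/-- The one particle vector of regularized point charges. -/
def chargeVec (x : Fin n → Minkowski) : L2 := ∑ j, (α j : ℂ) • pointVec hħ ψ hδ (x j)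

theorem continuous_chargeVec : Continuous (chargeVec hħ ψ hδ α) := by
  have := continuous_pointVec hħ ψ hδ
  unfold chargeVec
  fun_prop

/-- The exponent in the regularized normal ordered exponential. -/
def regExponent (ħ : ℝ) (ψ : UnitDensity) {n : ℕ} (α : Fin n → ℝ) (δ : ℝ) (x : Fin n → Minkowski) : ℝ :=
  ħ * (∑ j, α j) * ∑ j, α j * conv (logReg δ) ψ.1 (x j) -
    ħ * (∑ j, α j) ^ 2 / 2 * ∫ y, ψ.1 y * conv (logReg δ) ψ.1 y

/-- The regularized normal ordered exponential of point charges, applied to a coherent vector. -/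
def regVec (f : TestDensity) (ξ : L2) (x : Fin n → Minkowski) : DMSpace :=
  ((Real.exp (regExponent ħ ψ α (2 * δ) x) : ℝ) : ℂ) •
    displacedVec (oneParticleProj ħ ψ f) (chargeVec hħ ψ hδ α x)
      (schrodinger ħ (∑ j, α j) (∑ j, α j * conv commutatorKer ψ.1 (x j)) (schrodingerOf ħ ψ f ξ))

theorem continuous_regVec (f : TestDensity) (ξ : L2) : Continuous (regVec hħ ψ hδ α f ξ) := by
  have hloc : LocallyIntegrable (logReg (2 * δ)) :=
    (continuous_logReg (by positivity)).locallyIntegrable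
  have h1 := continuous_conv hloc ψ.1.continuous ψ.1.hasCompactSupport
  have h2 := continuous_conv locallyIntegrable_commutatorKer ψ.1.continuous ψ.1.hasCompactSupport
  have h3 : Continuous fun x : Fin n → Minkowski => schrodinger ħ (∑ j, α j)
      (∑ j, α j * conv commutatorKer ψ.1 (x j)) (schrodingerOf ħ ψ f ξ) :=
    (continuous_schrodinger ħ (∑ j, α j) _).comp (by fun_prop)
  have h4 := (continuous_displacedVec (oneParticleProj ħ ψ f)).comp
    ((continuous_chargeVec hħ ψ hδ α).prodMk h3)
  have h5 : Continuous fun x : Fin n → Minkowski => regExponent ħ ψ α (2 * δ) x := by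
    unfold regExponent
    fun_prop
  exact Continuous.smul (Complex.continuous_ofReal.comp (Real.continuous_exp.comp h5)) h4

/-- The terms with the potential and the self-energy of `ψ` in the inner product are exactly
compensated by the two normal ordering exponents. Hence the bounds do not depend on `ψ`. -/
theorem re_inner_chargeVec (x y : Fin n → Minkowski) :
    (inner ℂ (chargeVec hħ ψ hδ α x) (chargeVec hħ ψ hδ α y) : ℂ).re +
      regExponent ħ ψ α (2 * δ) x + regExponent ħ ψ α (2 * δ) y =
      ħ * ∑ i, ∑ j, α i * α j * logReg (2 * δ) (x i - y j) := by
  have h1 : (inner ℂ (chargeVec hħ ψ hδ α x) (chargeVec hħ ψ hδ α y) : ℂ).re =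
      ∑ i, ∑ j, α i * (α j * (inner ℂ (pointVec hħ ψ hδ (x i)) (pointVec hħ ψ hδ (y j)) : ℂ).re) := by
    simp only [chargeVec, sum_inner, inner_sum, inner_smul_left, inner_smul_right, Complex.conj_ofReal,
      Complex.re_sum, Complex.re_ofReal_mul, Finset.mul_sum]
    rw [Finset.sum_comm]
    exact Finset.sum_congr rfl fun i _ => Finset.sum_congr rfl fun j _ => by ring
  have h2 (i j : Fin n) :
      α i * (α j * (inner ℂ (pointVec hħ ψ hδ (x i)) (pointVec hħ ψ hδ (y j)) : ℂ).re) =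
      ħ * (α i * α j * logReg (2 * δ) (x i - y j)) - ħ * ((α i * conv (logReg (2 * δ)) ψ.1 (x i)) * α j) -
        ħ * (α i * (α j * conv (logReg (2 * δ)) ψ.1 (y j))) +
        ħ * (α i * α j) * ∫ z, ψ.1 z * conv (logReg (2 * δ)) ψ.1 z := by
    rw [re_inner_pointVec]
    ring
  rw [h1]
  simp only [h2, Finset.sum_add_distrib, Finset.sum_sub_distrib, ← Finset.mul_sum, ← Finset.sum_mul,
    regExponent]
  ring

theorem norm_inner_regVec_le (f : TestDensity) (ξ : L2) (x y : Fin n → Minkowski) :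
    ‖(inner ℂ (regVec hħ ψ hδ α f ξ x) (regVec hħ ψ hδ α f ξ y) : ℂ)‖ ≤
      Real.exp (ħ * ∑ i, ∑ j, α i * α j * logReg (2 * δ) (x i - y j)) * ‖ξ‖ ^ 2 := by
  rw [regVec, regVec, inner_smul_left, inner_smul_right, norm_mul, norm_mul, norm_inner_displacedVec,
    RCLike.norm_conj, Complex.norm_real, Complex.norm_real, Real.norm_of_nonneg (Real.exp_pos _).le,
    Real.norm_of_nonneg (Real.exp_pos _).le, ← mul_assoc, ← mul_assoc, ← Real.exp_add, ← Real.exp_add,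
    ← re_inner_chargeVec hħ ψ hδ α]
  refine mul_le_mul (Real.exp_le_exp.2 (le_of_eq (by ring))) ((norm_inner_le_norm _ _).trans ?_)
    (norm_nonneg _) (Real.exp_pos _).le
  rw [LinearIsometry.norm_map, LinearIsometry.norm_map, LinearIsometry.norm_map, LinearIsometry.norm_map, sq]

theorem inner_regVec (f' f : TestDensity) (ξ' ξ : L2) (x : Fin n → Minkowski) :
    inner ℂ (weylVec ħ ψ f' ξ') (regVec hħ ψ hδ α f ξ x) =
      matrixElt ħ ψ (∑ j, α j) f' f ξ' ξ (regExponent ħ ψ α (2 * δ) x)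
      (pairing ħ (projDensity ψ f')
        fun k => (Real.exp (-δ * |k|) : ℂ) * ∑ j, (α j : ℂ) * dipoleTransform ψ (x j) k)
      (pairing ħ (projDensity ψ f)
        fun k => (Real.exp (-δ * |k|) : ℂ) * ∑ j, (α j : ℂ) * dipoleTransform ψ (x j) k)
      (∑ j, α j * conv commutatorKer ψ.1 (x j)) := by
  have h1 (f : TestDensity) : inner ℂ (oneParticleProj ħ ψ f) (chargeVec hħ ψ hδ α x) =
      pairing ħ (projDensity ψ f)
        fun k => (Real.exp (-δ * |k|) : ℂ) * ∑ j, (α j : ℂ) * dipoleTransform ψ (x j) k := by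
    have h2 (j : Fin n) : Integrable fun k : ℝ => (α j : ℂ) * (((ħ / (4 * Real.pi * |k|) : ℝ) : ℂ) *
        ((starRingEnd ℂ) (lightConeTransform (projDensity ψ f) k) *
          ((Real.exp (-δ * |k|) : ℂ) * dipoleTransform ψ (x j) k))) := by
      refine Integrable.const_mul ?_ _
      have h3 := L2.integrable_inner (𝕜 := ℂ) (oneParticleProj ħ ψ f) (pointVec hħ ψ hδ (x j))
      refine h3.congr ?_
      filter_upwards [(memLp_oneParticleFun ħ (projDensity ψ f) (integral_projDensity ψ f)).coeFn_toLp,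
        (memLp_pointVec hħ ψ hδ (x j)).coeFn_toLp] with k h4 h5
      have h4' : oneParticleProj ħ ψ f k = _ := h4
      have h5' : pointVec hħ ψ hδ (x j) k = _ := h5
      have h6 := congrArg Complex.ofReal (sqrt_weight_mul_self hħ k)
      rw [Complex.ofReal_mul] at h6
      rw [h4', h5', RCLike.inner_apply, oneParticleFun, map_mul, Complex.conj_ofReal, ← h6]
      ring
    simp only [chargeVec, inner_sum, inner_smul_right, oneParticleProj, inner_oneParticle_pointVec,
      pairing, ← integral_const_mul]
    rw [← integral_finsetSum _ fun j _ => h2 j]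
    refine integral_congr_ae (Eventually.of_forall fun k => ?_)
    simp only [Finset.mul_sum]
    refine Finset.sum_congr rfl fun j _ => ?_
    ring
  rw [regVec, inner_smul_right, weylVec_eq, inner_displacedVec_zero, h1, h1]
  rfl

end

/-! ### Removing the regularization -/

theorem norm_matrixElt_le (ħ : ℝ) (ψ : UnitDensity) (c : ℝ) (f' f : TestDensity) (ξ' ξ : L2) :
    ∃ A : ℝ, 0 ≤ A ∧ ∀ (r : ℝ) (p' p : ℂ) (b : ℝ), ‖matrixElt ħ ψ c f' f ξ' ξ r p' p b‖ ≤
      Real.exp r * (A * Real.exp (‖p'‖ + ‖p‖)) := by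
  refine ⟨‖Complex.exp (inner ℂ (oneParticleProj ħ ψ f') (oneParticleProj ħ ψ f)
      - (‖oneParticleProj ħ ψ f'‖ : ℂ) ^ 2 / 2 - (‖oneParticleProj ħ ψ f‖ : ℂ) ^ 2 / 2)‖ * (‖ξ'‖ * ‖ξ‖),
    by positivity, fun r p' p b => ?_⟩
  rw [matrixElt, norm_mul, norm_mul, norm_mul, Complex.norm_real, Real.norm_of_nonneg (Real.exp_pos _).le]
  refine mul_le_mul_of_nonneg_left ?_ (Real.exp_pos _).le
  rw [mul_assoc]
  refine mul_le_mul_of_nonneg_left ?_ (norm_nonneg _)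
  rw [mul_comm (‖ξ'‖ * ‖ξ‖)]
  refine mul_le_mul ?_ ?_ (norm_nonneg _) (Real.exp_pos _).le
  · refine (Complex.norm_exp_le_exp_norm _).trans (Real.exp_le_exp.2 ((norm_sub_le _ _).trans ?_))
    rw [RCLike.norm_conj]
  · refine (norm_inner_le_norm _ _).trans (le_of_eq ?_)
    rw [LinearIsometry.norm_map, LinearIsometry.norm_map, LinearIsometry.norm_map]

section

variable {ħ : ℝ} (ψ : UnitDensity) {n : ℕ} (α : Fin n → ℝ)

theorem tendsto_regExponent (x : Fin n → Minkowski) :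
    Tendsto (fun δ => regExponent ħ ψ α δ x) (𝓝 0)
      (𝓝 (ħ * (∑ j, α j) * ∑ j, α j * conv hadamardKer ψ.1 (x j) -
        ħ * (∑ j, α j) ^ 2 / 2 * hadamardForm ψ.1 ψ.1)) := by
  have h1 (y : Minkowski) := tendsto_conv_logReg ψ.1.continuous ψ.1.hasCompactSupport y
  have h2 := tendsto_integral_mul_conv_logReg ψ.1.continuous ψ.1.hasCompactSupport ψ.1.continuous
    ψ.1.hasCompactSupport
  exact ((tendsto_finsetSum _ fun j _ => (h1 (x j)).const_mul (α j)).const_mul _).sub (h2.const_mul _)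

theorem exists_regExponent_le (K : Set Minkowski) (hK : IsCompact K) :
    ∃ R : ℝ, ∀ᶠ δ in 𝓝 0, ∀ x : Fin n → Minkowski, (∀ j, x j ∈ K) → regExponent ħ ψ α δ x ≤ R := by
  have hc : Continuous (conv domKer fun y => |ψ.1 y|) :=
    continuous_conv locallyIntegrable_domKer ψ.1.continuous.norm ψ.1.hasCompactSupport.norm
  obtain ⟨M, hM⟩ := hK.exists_bound_of_continuousOn hc.continuousOn
  have h2 := (tendsto_integral_mul_conv_logReg ψ.1.continuous ψ.1.hasCompactSupport ψ.1.continuous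
    ψ.1.hasCompactSupport).norm.eventually_le_const (lt_add_one _)
  set E := ‖∫ x, ψ.1 x * conv hadamardKer ψ.1 x‖ + 1
  refine ⟨|ħ * ∑ j, α j| * ∑ j, |α j| * M + |ħ * (∑ j, α j) ^ 2 / 2| * E, ?_⟩
  filter_upwards [h2, Icc_mem_nhds (by norm_num : (-1 : ℝ) < 0) one_pos] with δ hδ hδ1 x hx
  rw [regExponent, sub_eq_add_neg]
  refine add_le_add ((le_abs_self _).trans ?_) ((neg_le_abs _).trans ?_)
  · rw [abs_mul]
    refine mul_le_mul_of_nonneg_left ((Finset.abs_sum_le_sum_abs _ _).trans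
      (Finset.sum_le_sum fun j _ => ?_)) (abs_nonneg _)
    rw [abs_mul]
    refine mul_le_mul_of_nonneg_left ?_ (abs_nonneg _)
    refine (abs_conv_logReg_le ψ.1.continuous ψ.1.hasCompactSupport ?_ (x j)).trans
      ((le_abs_self _).trans (hM _ (hx j)))
    exact (sq_le_one_iff_abs_le_one δ).2 (abs_le.2 hδ1)
  · rw [abs_mul]
    exact mul_le_mul_of_nonneg_left hδ (abs_nonneg _)

theorem norm_regTransform_le {δ : ℝ} (hδ : 0 ≤ δ) (x : Fin n → Minkowski) (k : ℝ) :
    ‖(Real.exp (-δ * |k|) : ℂ) * ∑ j, (α j : ℂ) * dipoleTransform ψ (x j) k‖ ≤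
      ∑ j, |α j| * (1 + ∫ z, |ψ.1 z|) := by
  rw [norm_mul, Complex.norm_real, Real.norm_of_nonneg (Real.exp_pos _).le]
  have h1 : Real.exp (-δ * |k|) ≤ 1 := Real.exp_le_one_iff.2 (by nlinarith [abs_nonneg k])
  refine (mul_le_of_le_one_left (norm_nonneg _) h1).trans (norm_sum_le_of_le _ fun j _ => ?_)
  rw [norm_mul, Complex.norm_real, Real.norm_eq_abs]
  exact mul_le_mul_of_nonneg_left (norm_dipoleTransform_le_const ψ _ k) (abs_nonneg _)

theorem continuous_chargeTransform (x : Fin n → Minkowski) :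
    Continuous fun k => ∑ j, (α j : ℂ) * dipoleTransform ψ (x j) k := by
  have h := continuous_dipoleTransform ψ
  have h1 (j : Fin n) : Continuous fun k => dipoleTransform ψ (x j) k :=
    h.comp (continuous_const.prodMk continuous_id)
  fun_prop

theorem tendsto_pairing_regTransform (f : TestDensity) (hf : ∫ x, f x = 0) (x : Fin n → Minkowski) :
    Tendsto (fun δ : ℝ => pairing ħ f
        fun k => (Real.exp (-δ * |k|) : ℂ) * ∑ j, (α j : ℂ) * dipoleTransform ψ (x j) k) (𝓝[>] 0)
      (𝓝 (pairing ħ f fun k => ∑ j, (α j : ℂ) * dipoleTransform ψ (x j) k)) := by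
  refine tendsto_pairing ħ f hf (M := ∑ j, |α j| * (1 + ∫ z, |ψ.1 z|))
    (Eventually.of_forall fun δ => ?_) ?_ fun k => ?_
  · have := continuous_chargeTransform ψ α x
    exact Continuous.measurable (by fun_prop)
  · filter_upwards [self_mem_nhdsWithin] with δ hδ k
    exact norm_regTransform_le ψ α (le_of_lt hδ) x k
  · refine tendsto_nhdsWithin_of_tendsto_nhds ?_
    have h : Continuous fun δ : ℝ => (Real.exp (-δ * |k|) : ℂ) *
      ∑ j, (α j : ℂ) * dipoleTransform ψ (x j) k := by fun_prop
    simpa using h.tendsto 0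

theorem tendsto_integral_inner_regVec (hħ : 0 ≤ ħ) (σ : ℤˣ) (g : TestDensity)
    (hκ : Integrable (cutoffKernel ħ σ g α)) {d : ℕ → ℝ} (hd : ∀ m, 0 < d m)
    (hd0 : Tendsto d atTop (𝓝 0)) (f' f : TestDensity) (ξ' ξ : L2) :
    Tendsto (fun m => ∫ x, cutoffKernel ħ σ g α x *
        inner ℂ (weylVec ħ ψ f' ξ') (regVec hħ ψ (hd m) α f ξ x)) atTop
      (𝓝 (∫ x, cutoffKernel ħ σ g α x * pointMatrixElt ħ ψ α f' f ξ' ξ x)) := by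
  have hd2 : Tendsto (fun m => 2 * d m) atTop (𝓝 0) := by simpa using hd0.const_mul 2
  have hd0' : Tendsto d atTop (𝓝[>] 0) :=
    tendsto_nhdsWithin_iff.2 ⟨hd0, Eventually.of_forall hd⟩
  obtain ⟨A, hA0, hA⟩ := norm_matrixElt_le ħ ψ (∑ j, α j) f' f ξ' ξ
  obtain ⟨R, hR⟩ := exists_regExponent_le (ħ := ħ) ψ α (tsupport g) g.hasCompactSupport.isCompact
  set P := fun f => pairingBound ħ (projDensity ψ f) * ∑ j, |α j| * (1 + ∫ z, |ψ.1 z|)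
  refine tendsto_integral_filter_of_dominated_convergence
    (fun x => ‖cutoffKernel ħ σ g α x‖ * (Real.exp R * (A * Real.exp (P f' + P f)))) ?_ ?_
    (hκ.norm.mul_const _) ?_
  · refine Eventually.of_forall fun m => hκ.1.mul ?_
    exact (continuous_const.inner (continuous_regVec hħ ψ (hd m) α f ξ)).aestronglyMeasurable
  · filter_upwards [hd2.eventually hR] with m hm
    refine Eventually.of_forall fun x => ?_
    by_cases hx : x ∈ Set.univ.pi fun _ : Fin n => tsupport g
    · rw [norm_mul]
      refine mul_le_mul_of_nonneg_left ?_ (norm_nonneg _)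
      rw [inner_regVec]
      refine (hA _ _ _ _).trans ?_
      have h1 := hm x fun j => hx j trivial
      have h2 (f : TestDensity) := norm_pairing_le ħ _ (integral_projDensity ψ f)
        (norm_regTransform_le ψ α (hd m).le x)
      gcongr
      · exact h2 f'
      · exact h2 f
    · rw [cutoffKernel_eq_zero ħ σ g α x hx]
      simp
  · refine Eventually.of_forall fun x => Tendsto.const_mul _ ?_
    simp only [inner_regVec, pointMatrixElt]
    have h1 := (tendsto_regExponent (ħ := ħ) ψ α x).comp hd2
    have h2 (f : TestDensity) := (tendsto_pairing_regTransform (ħ := ħ) ψ α _ (integral_projDensity ψ f) x).comp hd0'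
    exact ((continuous_matrixElt ħ ψ (∑ j, α j) f' f ξ' ξ).tendsto _).comp
      (h1.prodMk_nhds ((h2 f').prodMk_nhds ((h2 f).prodMk_nhds tendsto_const_nhds)))

/-- For positive cutoff the operator integral is an honest Bochner integral with norm at most `B *
‖ξ‖`. Without a cutoff its integrand does not exist, so the vector is obtained as a weak limit along
`δ = 1/(m+1)`; its matrix elements are identified by `tendsto_integral_inner_regVec`. -/
theorem exists_vector_of_kernel_bound (hħ : 0 ≤ ħ) (σ : ℤˣ) (g : TestDensity)
    (hκ : Integrable (cutoffKernel ħ σ g α)) {B : ℝ} (hB0 : 0 ≤ B)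
    (hB : ∀ δ : ℝ, ∫⁻ z : (Fin n → Minkowski) × (Fin n → Minkowski),
      ‖cutoffKernel ħ σ g α z.1‖ₑ * ‖cutoffKernel ħ σ g α z.2‖ₑ *
        ENNReal.ofReal (Real.exp (ħ * ∑ i, ∑ j, α i * α j * logReg (2 * δ) (z.1 i - z.2 j))) ≤
      ENNReal.ofReal (B ^ 2)) (f : TestDensity) (ξ : L2) :
    ∃ v : DMSpace, ‖v‖ ≤ B * ‖ξ‖ ∧ ∀ f' ξ', inner ℂ (weylVec ħ ψ f' ξ') v =
      ∫ x, cutoffKernel ħ σ g α x * pointMatrixElt ħ ψ α f' f ξ' ξ x := by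
  let d (m : ℕ) : ℝ := 1 / ((m : ℝ) + 1)
  have hd (m : ℕ) : 0 < d m := by positivity
  have hd0 : Tendsto d atTop (𝓝 0) := tendsto_one_div_add_atTop_nhds_zero_nat
  have hi (m : ℕ) : Integrable fun x => cutoffKernel ħ σ g α x • regVec hħ ψ (hd m) α f ξ x := by
    have hc := continuous_regVec hħ ψ (hd m) α f ξ
    obtain ⟨M, hM⟩ := (isCompact_pi_tsupport g n).exists_bound_of_continuousOn hc.continuousOn
    refine (hκ.norm.mul_const M).mono' (hκ.1.smul hc.aestronglyMeasurable)
      (Eventually.of_forall fun x => ?_)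
    by_cases hx : x ∈ Set.univ.pi fun _ : Fin n => tsupport g
    · rw [norm_smul]
      exact mul_le_mul_of_nonneg_left (hM x hx) (norm_nonneg _)
    · rw [cutoffKernel_eq_zero ħ σ g α x hx]
      simp
  have hbd (m : ℕ) : ‖∫ x, cutoffKernel ħ σ g α x • regVec hħ ψ (hd m) α f ξ x‖ ≤ B * ‖ξ‖ := by
    refine abs_le_of_sq_le_sq' ?_ (by positivity) |>.2
    rw [← ENNReal.ofReal_le_ofReal_iff (by positivity)]
    refine (norm_sq_integral_le (hi m)).trans ?_
    have h1 (z : (Fin n → Minkowski) × (Fin n → Minkowski)) :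
        ‖(inner ℂ (cutoffKernel ħ σ g α z.1 • regVec hħ ψ (hd m) α f ξ z.1)
          (cutoffKernel ħ σ g α z.2 • regVec hħ ψ (hd m) α f ξ z.2) : ℂ)‖ₑ ≤
        ‖cutoffKernel ħ σ g α z.1‖ₑ * ‖cutoffKernel ħ σ g α z.2‖ₑ *
        ENNReal.ofReal (Real.exp (ħ * ∑ i, ∑ j, α i * α j * logReg (2 * d m) (z.1 i - z.2 j))) *
          ENNReal.ofReal (‖ξ‖ ^ 2) := by
      rw [inner_smul_left, inner_smul_right, enorm_mul, enorm_mul, ← mul_assoc, mul_assoc (_ * _)]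
      refine mul_le_mul' (le_of_eq ?_) ?_
      · rw [← ofReal_norm, RCLike.norm_conj, ofReal_norm]
      · rw [← ENNReal.ofReal_mul (Real.exp_pos _).le, ← ofReal_norm]
        exact ENNReal.ofReal_le_ofReal (norm_inner_regVec_le hħ ψ (hd m) α f ξ z.1 z.2)
    refine (lintegral_mono h1).trans ?_
    rw [lintegral_mul_const' _ _ ENNReal.ofReal_ne_top, mul_pow, ENNReal.ofReal_mul (by positivity)]
    exact mul_le_mul' (hB (d m)) le_rfl
  obtain ⟨v, hv, hw⟩ := exists_weak_limit (l := atTop) (Eventually.of_forall hbd)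
  refine ⟨v, hv, fun f' ξ' => hw _ _ ?_⟩
  refine (tendsto_integral_inner_regVec ψ α hħ σ g hκ hd hd0 f' f ξ' ξ).congr fun m => ?_
  rw [← integral_inner (hi m)]
  simp only [inner_smul_right]

end

/-! ### Density of the domain -/

open scoped FourierTransform SchwartzMap in
-- Injectivity of the Fourier transform on integrable functions. Every smooth compactly supported
-- function is the Fourier transform of a Schwartz function, and exchanging the transform in the
-- integral yields zero against all of them.
theorem ae_eq_zero_of_integral_mul_exp_eq_zero {F : ℝ → ℂ} (hF : Integrable F)
    (h : ∀ y : ℝ, ∫ k, F k * Complex.exp (((k * y : ℝ) : ℂ) * Complex.I) = 0) : ∀ᵐ k, F k = 0 := by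
  refine ae_eq_zero_of_integral_contDiff_smul_eq_zero hF.locallyIntegrable fun φ₀ hφ hs => ?_
  have hs' : HasCompactSupport fun k => (φ₀ k : ℂ) := hs.comp_left Complex.ofReal_zero
  let G : 𝓢(ℝ, ℂ) := hs'.toSchwartzMap (Complex.ofRealCLM.contDiff.comp hφ)
  have h0 : VectorFourier.fourierIntegral Real.fourierChar volume (innerₗ ℝ) F = 0 := by
    funext w
    -- The library transform has the character `exp(-2πi k w)`.
    have h1 := h (-(2 * Real.pi * w))
    rw [VectorFourier.fourierIntegral, Pi.zero_apply, ← h1]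
    refine integral_congr_ae (Eventually.of_forall fun k => ?_)
    simp only [Circle.smul_def, smul_eq_mul, Real.fourierChar_apply, innerₗ_apply_apply,
      RCLike.inner_apply, conj_trivial]
    rw [mul_comm]
    congr 3
    push_cast
    ring
  have h1 := VectorFourier.integral_fourierIntegral_smul_eq_flip (μ := volume) (ν := volume)
    (L := innerₗ ℝ) (f := F) (g := (𝓕⁻ G : 𝓢(ℝ, ℂ))) Real.continuous_fourierChar
    (by exact continuous_inner) hF (𝓕⁻ G : 𝓢(ℝ, ℂ)).integrable
  rw [h0, flip_innerₗ] at h1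
  have h2 : (VectorFourier.fourierIntegral Real.fourierChar volume (innerₗ ℝ) (𝓕⁻ G : 𝓢(ℝ, ℂ)) : ℝ → ℂ)
      = fun k => (φ₀ k : ℂ) := by
    change (𝓕 ((𝓕⁻ G : 𝓢(ℝ, ℂ)) : ℝ → ℂ) : ℝ → ℂ) = _
    rw [← SchwartzMap.fourier_coe, FourierTransform.fourier_fourierInv_eq]
    rfl
  rw [h2] at h1
  simp only [Pi.zero_apply, smul_eq_mul, zero_mul, integral_zero] at h1
  rw [h1]
  exact integral_congr_ae (Eventually.of_forall fun k => by simp [mul_comm])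

/-- Twice the real part of the Fourier transform of `A` is the Fourier transform of `A(k)` plus the
conjugate of `A(-k)`. -/
theorem add_conj_neg_ae_eq_zero {A : ℝ → ℂ} (hA : Integrable A)
    (h : ∀ y : ℝ, (∫ k, A k * Complex.exp (((k * y : ℝ) : ℂ) * Complex.I)).re = 0) :
    ∀ᵐ k, A k + (starRingEnd ℂ) (A (-k)) = 0 := by
  have hA' : Integrable fun k => (starRingEnd ℂ) (A (-k)) :=
    (RCLike.conjCLE (K := ℂ)).toContinuousLinearMap.integrable_comp hA.comp_neg
  refine ae_eq_zero_of_integral_mul_exp_eq_zero (hA.add hA') fun y => ?_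
  have hb {B : ℝ → ℂ} (hB : Integrable B) :
      Integrable fun k => B k * Complex.exp (((k * y : ℝ) : ℂ) * Complex.I) :=
    hB.mul_bdd (c := 1) (Continuous.aestronglyMeasurable (by fun_prop))
      (Eventually.of_forall fun k => (Complex.norm_exp_ofReal_mul_I _).le)
  have h1 : ∫ k, (starRingEnd ℂ) (A (-k)) * Complex.exp (((k * y : ℝ) : ℂ) * Complex.I) =
      (starRingEnd ℂ) (∫ k, A k * Complex.exp (((k * y : ℝ) : ℂ) * Complex.I)) := by
    rw [← integral_conj, ← integral_neg_eq_self]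
    refine integral_congr_ae (Eventually.of_forall fun k => ?_)
    simp only [neg_neg, map_mul, ← Complex.exp_conj, Complex.conj_ofReal, Complex.conj_I]
    congr 2
    push_cast
    ring
  simp only [add_mul]
  rw [integral_add (hb hA) (hb hA'), h1, Complex.add_conj, h y]
  simp

/-- The difference of two mollifiers. -/
def mollifierDiff (ρ : TestDensity) (ε : ℝ) (x₁ x₂ : Minkowski) : TestDensity :=
  mollifier ρ ε x₁ - mollifier ρ ε x₂

theorem integral_mollifierDiff (ρ : TestDensity) {ε : ℝ} (hε : ε ≠ 0) (x₁ x₂ : Minkowski) :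
    ∫ y, mollifierDiff ρ ε x₁ x₂ y = 0 := by
  have h (y : Minkowski) : mollifierDiff ρ ε x₁ x₂ y = mollifier ρ ε x₁ y - mollifier ρ ε x₂ y := rfl
  simp only [h]
  rw [integral_sub (integrable_test _) (integrable_test _), integral_mollifier ρ hε,
    integral_mollifier ρ hε, sub_self]

theorem planeWave_add (k : ℝ) (x y : Minkowski) : planeWave k (x + y) = planeWave k x * planeWave k y := by
  rw [planeWave, planeWave, planeWave, ← Complex.exp_add]
  congr 1
  simp only [Prod.fst_add, Prod.snd_add]
  push_cast
  ring

theorem smear_planeWave (ρ : TestDensity) (ε : ℝ) (x : Minkowski) (k : ℝ) :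
    smear ρ (planeWave k) ε x = planeWave k x * smear ρ (planeWave k) ε 0 := by
  rw [smear, smear, ← integral_const_mul]
  refine integral_congr_ae (Eventually.of_forall fun z => ?_)
  simp only [planeWave_add, zero_add, Complex.real_smul]
  ring

theorem lightConeTransform_mollifierDiff (ρ : TestDensity) {ε : ℝ} (hε : ε ≠ 0) (x₁ x₂ : Minkowski)
    (k : ℝ) : lightConeTransform (mollifierDiff ρ ε x₁ x₂) k =
      (planeWave k x₁ - planeWave k x₂) * smear ρ (planeWave k) ε 0 := by
  have hF := continuous_planeWave k
  have h (y : Minkowski) : mollifierDiff ρ ε x₁ x₂ y • planeWave k y =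
      mollifier ρ ε x₁ y • planeWave k y - mollifier ρ ε x₂ y • planeWave k y := sub_smul _ _ _
  rw [lightConeTransform_eq]
  simp only [h]
  rw [integral_sub (integrable_test_smul _ hF) (integrable_test_smul _ hF),
    integral_mollifier_smul _ _ hε, integral_mollifier_smul _ _ hε, smear_planeWave, smear_planeWave ρ ε x₂]
  ring

/-- Test densities are real, so only real parts of inner products are known to vanish, and one
family of dipoles gives only a relation between `k` and `-k`. Dipoles separated in time and dipoles
separated in space give this relation with opposite signs, which forces both values to vanish. -/
theorem eq_zero_of_re_inner_oneParticle {ħ : ℝ} (hħ : 0 < ħ) {ρ : TestDensity} (hρ : ∫ x, ρ x = 1)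
    (v : L2) (hv : ∀ (h : TestDensity) (hh : ∫ x, h x = 0), (inner ℂ (oneParticle ħ h hh) v : ℂ).re = 0) :
    v = 0 := by
  have hpi := Real.pi_pos
  -- The inner product of `v` with a mollified dipole is the integral of `Y` against a difference of
  -- conjugate plane waves.
  let Y (ε k : ℝ) : ℂ := (Real.sqrt (ħ / (4 * Real.pi * |k|)) : ℂ) *
    (starRingEnd ℂ) (smear ρ (planeWave k) ε 0) * v k
  have hY {ε : ℝ} (hε : ε ≠ 0) (x₁ x₂ : Minkowski) :
      Integrable (fun k => (starRingEnd ℂ) (planeWave k x₁ - planeWave k x₂) * Y ε k) ∧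
      (∫ k, (starRingEnd ℂ) (planeWave k x₁ - planeWave k x₂) * Y ε k).re = 0 := by
    have h0 := integral_mollifierDiff ρ hε x₁ x₂
    have h1 := L2.integrable_inner (𝕜 := ℂ) (oneParticle ħ _ h0) v
    have h2 := hv _ h0
    have h3 : (fun k => (inner ℂ (oneParticle ħ _ h0 k) (v k) : ℂ)) =ᵐ[volume]
        fun k => (starRingEnd ℂ) (planeWave k x₁ - planeWave k x₂) * Y ε k := by
      filter_upwards [(memLp_oneParticleFun ħ _ h0).coeFn_toLp] with k hk
      have hk' : oneParticle ħ _ h0 k = _ := hk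
      rw [hk', RCLike.inner_apply, oneParticleFun, lightConeTransform_mollifierDiff ρ hε, map_mul,
        map_mul, Complex.conj_ofReal]
      simp only [Y]
      ring
    rw [L2.inner_def, integral_congr_ae h3] at h2
    exact ⟨h1.congr h3, h2⟩
  have key {ε : ℝ} (hε : ε ≠ 0) (s : ℝ) : ∀ᵐ k, Real.sin (k * s) ≠ 0 → Y ε k = 0 := by
    let A (k : ℝ) : ℂ := (-(2 * Real.sin (|k| * s)) : ℝ) * Complex.I * Y ε k
    let B (k : ℝ) : ℂ := ((2 * Real.sin (k * s)) : ℝ) * Complex.I * Y ε k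
    have hd (a b : ℝ) : Complex.exp (((b + a : ℝ) : ℂ) * Complex.I) -
        Complex.exp (((b - a : ℝ) : ℂ) * Complex.I) =
        (2 * Real.sin a : ℝ) * Complex.I * Complex.exp ((b : ℂ) * Complex.I) := by
      rw [Complex.ofReal_add, Complex.ofReal_sub, add_mul, sub_mul, Complex.exp_add, Complex.exp_sub,
        div_eq_mul_inv, ← Complex.exp_neg, ← mul_sub, ← neg_mul, Complex.exp_mul_I, Complex.exp_mul_I,
        Complex.exp_mul_I (-_), Complex.cos_neg, Complex.sin_neg]
      push_cast
      ring
    have hpw (k : ℝ) (x : Minkowski) : (starRingEnd ℂ) (planeWave k x) =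
        Complex.exp (((k * x.2 - |k| * x.1 : ℝ) : ℂ) * Complex.I) := by
      rw [planeWave, ← Complex.exp_conj, map_mul, Complex.conj_I, Complex.conj_ofReal]
      congr 1
      push_cast
      ring
    have hA (y : ℝ) : (fun k => (starRingEnd ℂ) (planeWave k (s, y) - planeWave k (-s, y)) * Y ε k) =
        fun k => A k * Complex.exp (((k * y : ℝ) : ℂ) * Complex.I) := by
      funext k
      have h1 := hd (-(|k| * s)) (k * y)
      rw [map_sub, hpw, hpw]
      simp only [A]
      rw [show k * y - |k| * s = k * y + -(|k| * s) by ring,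
        show k * y - |k| * -s = k * y - -(|k| * s) by ring, h1, Real.sin_neg]
      push_cast
      ring
    have hB (y : ℝ) : (fun k => (starRingEnd ℂ) (planeWave k (0, y + s) - planeWave k (0, y - s)) * Y ε k) =
        fun k => B k * Complex.exp (((k * y : ℝ) : ℂ) * Complex.I) := by
      funext k
      have h1 := hd (k * s) (k * y)
      rw [map_sub, hpw, hpw]
      simp only [B]
      rw [show k * (y + s) - |k| * 0 = k * y + k * s by ring,
        show k * (y - s) - |k| * 0 = k * y - k * s by ring, h1]
      ring
    have hA0 : Integrable A := by
      have := (hY hε (s, 0) (-s, 0)).1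
      rw [hA] at this
      simpa using this
    have hB0 : Integrable B := by
      have := (hY hε (0, 0 + s) (0, 0 - s)).1
      rw [hB] at this
      simpa using this
    filter_upwards [add_conj_neg_ae_eq_zero hA0 fun y => by
        have := (hY hε (s, y) (-s, y)).2
        rwa [hA] at this, add_conj_neg_ae_eq_zero hB0 fun y => by
        have := (hY hε (0, y + s) (0, y - s)).2
        rwa [hB] at this] with k h1 h2 hk
    have hk' : (Real.sin (|k| * s) : ℂ) ≠ 0 := by
      rcases abs_choice k with h | h <;> rw [h]
      · exact_mod_cast hk
      · rw [neg_mul, Real.sin_neg, Complex.ofReal_ne_zero]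
        exact neg_ne_zero.2 hk
    have hk'' : (Real.sin (k * s) : ℂ) ≠ 0 := by exact_mod_cast hk
    simp only [A, B, abs_neg, map_mul, Complex.conj_ofReal, Complex.conj_I, neg_mul, Real.sin_neg] at h1 h2
    push_cast at h1 h2 hk' hk''
    -- The time dipole carries the even factor `sin(|k|s)`, the space dipole the odd factor
    -- `sin(ks)`; hence the opposite signs in `h3` and `h4`.
    have h3 : Y ε k = (starRingEnd ℂ) (Y ε (-k)) := by
      refine mul_left_cancel₀ (mul_ne_zero (mul_ne_zero two_ne_zero hk') Complex.I_ne_zero) ?_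
      linear_combination -h1
    have h4 : Y ε k = -(starRingEnd ℂ) (Y ε (-k)) := by
      refine mul_left_cancel₀ (mul_ne_zero (mul_ne_zero two_ne_zero hk'') Complex.I_ne_zero) ?_
      linear_combination h2
    linear_combination (h3 + h4) / 2
  -- Mollifier width and dipole separation run through the same countable sequence, so that all
  -- exceptional null sets can be united.
  have hall : ∀ᵐ k, ∀ m : ℕ, Real.sin (k * (1 / ((m : ℝ) + 1))) ≠ 0 → Y (1 / ((m : ℝ) + 1)) k = 0 :=
    ae_all_iff.2 fun m => key (by positivity) _
  rw [Lp.eq_zero_iff_ae_eq_zero]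
  filter_upwards [hall, compl_mem_ae_iff.2 (measure_singleton (0 : ℝ))] with k hk hk0
  have hk0' : k ≠ 0 := hk0
  have ht : Tendsto (fun m : ℕ => 1 / ((m : ℝ) + 1)) atTop (𝓝 0) := tendsto_one_div_add_atTop_nhds_zero_nat
  have h1 : ∀ᶠ m : ℕ in atTop, smear ρ (planeWave k) (1 / ((m : ℝ) + 1)) 0 ≠ 0 := by
    have hc : Continuous fun ε => smear ρ (planeWave k) ε 0 :=
      continuous_smear_comp ρ (continuous_planeWave k) continuous_id continuous_const
    have h0 : smear ρ (planeWave k) 0 0 ≠ 0 := by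
      rw [smear_zero, hρ, one_smul]
      exact norm_ne_zero_iff.1 (by rw [norm_planeWave]; exact one_ne_zero)
    exact ((hc.tendsto 0).comp ht).eventually_ne h0
  have h2 : ∀ᶠ m : ℕ in atTop, |k * (1 / ((m : ℝ) + 1))| < Real.pi := by
    have h3 : Tendsto (fun m : ℕ => |k * (1 / ((m : ℝ) + 1))|) atTop (𝓝 0) := by
      simpa using (ht.const_mul k).abs
    exact h3.eventually_lt_const hpi
  -- For large `m` the mollifier transform is close to `1` at this `k`, and `0 < |k s| < π` gives a
  -- nonzero sine.
  obtain ⟨m, hm1, hm2⟩ := (h1.and h2).exists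
  have hs : Real.sin (k * (1 / ((m : ℝ) + 1))) ≠ 0 := by
    rw [Ne, Real.sin_eq_zero_iff_of_lt_of_lt (abs_lt.1 hm2).1 (abs_lt.1 hm2).2]
    exact mul_ne_zero hk0' (by positivity)
  have h3 := hk m hs
  simp only [Y] at h3
  have hk1 : 0 < |k| := abs_pos.2 hk0'
  have h4 : (Real.sqrt (ħ / (4 * Real.pi * |k|)) : ℂ) ≠ 0 := by
    rw [Complex.ofReal_ne_zero]
    positivity
  exact (mul_eq_zero.1 h3).resolve_left (mul_ne_zero h4 ((map_ne_zero _).2 hm1))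

/-- The set is only a real subspace, so orthogonality is used in the underlying real Hilbert space,
whose inner product is the real part. -/
theorem dense_of_re_inner_eq_zero {H : Type*} [NormedAddCommGroup H] [InnerProductSpace ℂ H]
    [CompleteSpace H] {S : Set H} (h0 : (0 : H) ∈ S) (hadd : ∀ u ∈ S, ∀ v ∈ S, u + v ∈ S)
    (hsmul : ∀ (c : ℝ), ∀ u ∈ S, (c : ℂ) • u ∈ S)
    (h : ∀ v : H, (∀ u ∈ S, (inner ℂ u v : ℂ).re = 0) → v = 0) : Dense S := by
  let _ : InnerProductSpace ℝ H := InnerProductSpace.rclikeToReal ℂ H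
  let K : Submodule ℝ H :=
    { carrier := S
      add_mem' := fun hu hv => hadd _ hu _ hv
      zero_mem' := h0
      smul_mem' := fun c u hu => hsmul c u hu }
  have hK : K.topologicalClosure = ⊤ := by
    rw [Submodule.topologicalClosure_eq_top_iff, Submodule.eq_bot_iff]
    exact fun v hv => h v fun u hu => hv u hu
  exact Submodule.dense_iff_topologicalClosure_eq_top.2 hK

theorem oneParticle_eq_of_transform {ħ : ℝ} {f h : TestDensity} {hf : ∫ x, f x = 0} {hh : ∫ x, h x = 0}
    {v : L2} (c : ℂ) (hv : v = oneParticle ħ h hh)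
    (hfh : ∀ k, lightConeTransform f k = c * lightConeTransform h k) :
    oneParticle ħ f hf = c • v := by
  rw [hv, oneParticle, oneParticle, ← MemLp.toLp_const_smul]
  refine (MemLp.toLp_eq_toLp_iff _ _).2 (Eventually.of_forall fun k => ?_)
  simp only [Pi.smul_apply, oneParticleFun, hfh, smul_eq_mul]
  ring

/-- The one particle vectors of test densities. -/
def oneParticleSet (ħ : ℝ) : Set L2 :=
  {v | ∃ (h : TestDensity) (hh : ∫ x, h x = 0), v = oneParticle ħ h hh}

theorem dense_oneParticle {ħ : ℝ} (hħ : 0 < ħ) (ψ : UnitDensity) :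
    Dense (oneParticleSet ħ) := by
  have hsmul (c : ℝ) (h : TestDensity) (hh : ∫ x, h x = 0) : ∃ (f : TestDensity) (hf : ∫ x, f x = 0),
      (c : ℂ) • oneParticle ħ h hh = oneParticle ħ f hf := by
    have h1 : ∀ x, (c • h) x = c * h x := fun x => rfl
    have h0 : ∫ x, (c • h) x = 0 := by
      simp only [h1]
      rw [integral_const_mul, hh, mul_zero]
    refine ⟨c • h, h0, (oneParticle_eq_of_transform (c : ℂ) rfl fun k => ?_).symm⟩
    simp only [lightConeTransform, h1, ← integral_const_mul]
    refine integral_congr_ae (Eventually.of_forall fun x => ?_)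
    push_cast
    ring
  refine dense_of_re_inner_eq_zero ?_ ?_ ?_ fun v hv =>
    eq_zero_of_re_inner_oneParticle hħ ψ.2 v fun h hh => hv _ ⟨h, hh, rfl⟩
  · obtain ⟨f, hf, h⟩ := hsmul 0 _ (integral_projDensity ψ ψ.1)
    exact ⟨f, hf, by rw [← h, Complex.ofReal_zero, zero_smul]⟩
  · rintro _ ⟨h, hh, rfl⟩ _ ⟨h', hh', rfl⟩
    have h1 : ∀ x, (h + h') x = h x + h' x := fun x => rfl
    have h0 : ∫ x, (h + h') x = 0 := by
      simp only [h1]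
      rw [integral_add (integrable_test h) (integrable_test h'), hh, hh', add_zero]
    refine ⟨h + h', h0, ?_⟩
    rw [oneParticle, oneParticle, oneParticle, ← MemLp.toLp_add]
    refine (MemLp.toLp_eq_toLp_iff _ _).2 (Eventually.of_forall fun k => ?_)
    have hF := continuous_planeWave k
    have h2 : lightConeTransform (h + h') k = lightConeTransform h k + lightConeTransform h' k := by
      simp only [lightConeTransform_eq, h1, add_smul]
      exact integral_add (integrable_test_smul h hF) (integrable_test_smul h' hF)
    simp only [Pi.add_apply, oneParticleFun, h2, mul_add]
  · rintro c _ ⟨h, hh, rfl⟩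
    exact hsmul c h hh

/-! ### From one particle vectors to the whole Hilbert space. -/

theorem schrodinger_zero_neg (ħ β : ℝ) (ξ : L2) : schrodinger ħ 0 β (schrodinger ħ 0 (-β) ξ) = ξ := by
  refine Lp.ext ?_
  have h1 : schrodinger ħ 0 β (schrodinger ħ 0 (-β) ξ) =ᵐ[volume] _ :=
    (memLp_schrodinger ħ 0 β (schrodinger ħ 0 (-β) ξ)).coeFn_toLp
  have h2 : schrodinger ħ 0 (-β) ξ =ᵐ[volume] _ := (memLp_schrodinger ħ 0 (-β) ξ).coeFn_toLp
  filter_upwards [h1, h2] with k hk1 hk2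
  rw [hk1]
  simp only [mul_zero, sub_zero, zero_mul, zero_div, add_zero] at hk2 ⊢
  rw [hk2, ← mul_assoc, ← Complex.exp_add, ← add_mul]
  simp

/-- For neutral `f` the Schrödinger operator is multiplication by a phase and can be undone by the
choice of the second tensor factor. -/
theorem tmul_expVec_oneParticle_mem (ħ : ℝ) (ψ : UnitDensity) (f : TestDensity) (hf : ∫ x, f x = 0)
    (ξ : L2) : tmul (expVec (Complex.I • oneParticle ħ f hf)) ξ ∈ weylDomain ħ ψ := by
  have h2 : weylVec ħ ψ f (schrodinger ħ 0 (-commutatorForm f ψ.1) ξ) ∈ weylDomain ħ ψ :=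
    Submodule.subset_span ⟨f, _, rfl⟩
  have h3 : projDensity ψ f = f := by
    rw [projDensity, hf, zero_smul, sub_zero]
  have h4 : oneParticleProj ħ ψ f = oneParticle ħ f hf := by
    simp only [oneParticleProj, h3]
  have h5 : schrodingerOf ħ ψ f (schrodinger ħ 0 (-commutatorForm f ψ.1) ξ) = ξ := by
    rw [schrodingerOf, hf, schrodinger_zero_neg]
  rw [weylVec_eq, displacedVec, h4, h5, add_zero] at h2
  exact ((weylDomain ħ ψ).smul_mem_iff (Complex.exp_ne_zero _)).1 h2

/-- The tensor product with a fixed vector of the second factor. -/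
def tmulRight (ξ : L2) : Fock →ₗ[ℂ] DMSpace where
  toFun η := tmul η ξ
  map_add' x y := by simp only [tmul, TensorProduct.add_tmul, UniformSpace.Completion.coe_add]
  map_smul' c x := tmul_smul_left c x ξ

theorem continuous_tmulRight (ξ : L2) : Continuous (tmulRight ξ) :=
  continuous_tmul_comp continuous_id continuous_const

theorem tmul_mem_of_tmul_expVec_mem {D : Submodule ℂ DMSpace} (hcl : IsClosed (D : Set DMSpace))
    (h : ∀ v ξ, tmul (expVec v) ξ ∈ D) (η : Fock) (ξ : L2) : tmul η ξ ∈ D := by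
  have h1 : IsClosed (tmulRight ξ ⁻¹' (D : Set DMSpace)) := hcl.preimage (continuous_tmulRight ξ)
  have h2 (x : L2 →₀ ℂ) : Finsupp.linearCombination ℂ expVec x ∈ tmulRight ξ ⁻¹' (D : Set DMSpace) := by
    rw [Finsupp.linearCombination_apply, Finsupp.sum, Set.mem_preimage, map_sum]
    refine D.sum_mem fun u _ => ?_
    rw [map_smul]
    exact D.smul_mem _ (h u ξ)
  exact denseRange_expVec.induction_on (p := fun η => η ∈ tmulRight ξ ⁻¹' (D : Set DMSpace)) η h1 h2

theorem coe_mem_of_tmul_mem {D : Submodule ℂ DMSpace} (h : ∀ η ξ, tmul η ξ ∈ D) (t : Fock ⊗[ℂ] L2) :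
    (t : DMSpace) ∈ D := by
  induction t using TensorProduct.induction_on with
  | zero =>
    rw [UniformSpace.Completion.coe_zero]
    exact D.zero_mem
  | tmul η ξ =>
    have := h η ξ
    rwa [tmul] at this
  | add x y hx hy =>
    rw [UniformSpace.Completion.coe_add]
    exact D.add_mem hx hy

theorem eq_top_of_tmul_mem {D : Submodule ℂ DMSpace} (hcl : IsClosed (D : Set DMSpace))
    (h : ∀ η ξ, tmul η ξ ∈ D) : D = ⊤ :=
  eq_top_iff.2 fun v _ => UniformSpace.Completion.induction_on (p := fun v => v ∈ D) v hcl
    (coe_mem_of_tmul_mem h)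

/-- Exponential vectors depend continuously on their argument, so a closed subspace containing those
of the dense set `oneParticleSet ħ`, rotated by `i`, contains them all. -/
theorem tmul_expVec_mem_of_isClosed {ħ : ℝ} (hħ : 0 < ħ) (ψ : UnitDensity) {D : Submodule ℂ DMSpace}
    (hcl : IsClosed (D : Set DMSpace)) (hle : weylDomain ħ ψ ≤ D) (v ξ : L2) :
    tmul (expVec v) ξ ∈ D := by
  let e (u : L2) : DMSpace := tmul (expVec (Complex.I • u)) ξ
  have hc : Continuous e :=
    continuous_tmul_comp (continuous_expVec.comp (continuous_const_smul _)) continuous_const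
  have hsub : oneParticleSet ħ ⊆ e ⁻¹' (D : Set DMSpace) := by
    rintro _ ⟨f, hf, rfl⟩
    exact hle (tmul_expVec_oneParticle_mem ħ ψ f hf ξ)
  have h5 := closure_minimal hsub (hcl.preimage hc)
  rw [(dense_oneParticle hħ ψ).closure_eq] at h5
  have h3 : e ((-Complex.I) • v) ∈ D := h5 (Set.mem_univ _)
  have h6 : Complex.I • ((-Complex.I) • v) = v := by
    rw [smul_smul, mul_neg, Complex.I_mul_I, neg_neg, one_smul]
  simp only [e, h6] at h3
  exact h3

theorem dense_weylDomain {ħ : ℝ} (hħ : 0 < ħ) (ψ : UnitDensity) :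
    Dense (weylDomain ħ ψ : Set DMSpace) := by
  rw [Submodule.dense_iff_topologicalClosure_eq_top]
  have hcl : IsClosed ((weylDomain ħ ψ).topologicalClosure : Set DMSpace) :=
    Submodule.isClosed_topologicalClosure _
  exact eq_top_of_tmul_mem hcl (tmul_mem_of_tmul_expVec_mem hcl
    (tmul_expVec_mem_of_isClosed hħ ψ hcl (Submodule.le_topologicalClosure _)))

/-! ### Existence and uniqueness of time ordered products -/

theorem eq_of_forall_inner_weylDomain {ħ : ℝ} (hħ : 0 < ħ) (ψ : UnitDensity) {v w : DMSpace}
    (h : ∀ Ψ' : weylDomain ħ ψ, (inner ℂ (Ψ' : DMSpace) v : ℂ) = inner ℂ (Ψ' : DMSpace) w) : v = w :=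
  (dense_weylDomain hħ ψ).eq_of_inner_right ℂ fun Ψ' hΨ' => h ⟨Ψ', hΨ'⟩

/-- A linear relation that is total and single valued is a linear map. The time ordered product is
characterized by its matrix elements and obtained in this way. -/
theorem exists_linearMap_of_unique {V H : Type*} [AddCommGroup V] [Module ℂ V] [AddCommGroup H]
    [Module ℂ H] {Q : V → H → Prop} (hex : ∀ x, ∃ v, Q x v) (hun : ∀ x v w, Q x v → Q x w → v = w)
    (hadd : ∀ x y v w, Q x v → Q y w → Q (x + y) (v + w)) (hsmul : ∀ (c : ℂ) x v, Q x v → Q (c • x) (c • v)) :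
    ∃ T : V →ₗ[ℂ] H, ∀ x, Q x (T x) := by
  choose F hF using hex
  exact ⟨{ toFun := F
           map_add' := fun x y => hun _ _ _ (hF _) (hadd _ _ _ _ (hF x) (hF y))
           map_smul' := fun c x => hun _ _ _ (hF _) (hsmul c _ _ (hF x)) }, hF⟩

/-- The matrix element of the time ordered product with smeared charges. -/
def smearedMatrixElt (ħ : ℝ) (σ : ℤˣ) (ψ : UnitDensity) (g : TestDensity) {n : ℕ} (α : Fin n → ℝ)
    (ρ : TestDensity) (Ψ' Ψ : DMSpace) (ε : ℝ) (x : Fin n → Minkowski) : ℂ :=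
  cutoffKernel ħ σ g α x * inner ℂ Ψ' (normalOrderedExp ħ ψ (smearedCharges ρ ε α x) Ψ)

/-- `c` is the matrix element of the time ordered product between `Ψ'` and `Ψ`. -/
def IsMatrixElt (ħ : ℝ) (σ : ℤˣ) (ψ : UnitDensity) (g : TestDensity) {n : ℕ} (α : Fin n → ℝ)
    (Ψ' Ψ : DMSpace) (c : ℂ) : Prop :=
  ∀ ρ : TestDensity, ∫ x, ρ x = 1 →
    (∀ ε ≠ 0, Integrable (smearedMatrixElt ħ σ ψ g α ρ Ψ' Ψ ε)) ∧
    Tendsto (fun ε : ℝ => ∫ x, smearedMatrixElt ħ σ ψ g α ρ Ψ' Ψ ε x) (𝓝[>] 0) (𝓝 c)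

section

variable {ħ : ℝ} {σ : ℤˣ} {ψ : UnitDensity} {g : TestDensity} {n : ℕ} {α : Fin n → ℝ}

/-- Quantifying over all operators `A` covers additivity in either argument. The integrals add
because `IsMatrixElt` includes integrability for each nonzero `ε`. -/
theorem IsMatrixElt.of_add {Ψ₁' Ψ₁ Ψ₂' Ψ₂ Ψ' Ψ : DMSpace} {c₁ c₂ : ℂ}
    (h₁ : IsMatrixElt ħ σ ψ g α Ψ₁' Ψ₁ c₁) (h₂ : IsMatrixElt ħ σ ψ g α Ψ₂' Ψ₂ c₂)
    (h : ∀ A : DMSpace →L[ℂ] DMSpace, (inner ℂ Ψ' (A Ψ) : ℂ) = inner ℂ Ψ₁' (A Ψ₁) + inner ℂ Ψ₂' (A Ψ₂)) :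
    IsMatrixElt ħ σ ψ g α Ψ' Ψ (c₁ + c₂) := by
  intro ρ hρ
  have he (ε : ℝ) : smearedMatrixElt ħ σ ψ g α ρ Ψ' Ψ ε = fun x =>
      smearedMatrixElt ħ σ ψ g α ρ Ψ₁' Ψ₁ ε x + smearedMatrixElt ħ σ ψ g α ρ Ψ₂' Ψ₂ ε x := by
    funext x
    rw [smearedMatrixElt, h, mul_add]
    rfl
  obtain ⟨i₁, t₁⟩ := h₁ ρ hρ
  obtain ⟨i₂, t₂⟩ := h₂ ρ hρ
  refine ⟨fun ε hε => by rw [he]; exact (i₁ ε hε).add (i₂ ε hε), (t₁.add t₂).congr' ?_⟩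
  filter_upwards [self_mem_nhdsWithin] with ε hε
  have hε' : ε ≠ 0 := ne_of_gt hε
  rw [he, integral_add (i₁ ε hε') (i₂ ε hε')]

theorem IsMatrixElt.of_smul {Ψ₁' Ψ₁ Ψ' Ψ : DMSpace} {c₁ : ℂ} (h₁ : IsMatrixElt ħ σ ψ g α Ψ₁' Ψ₁ c₁) (c : ℂ)
    (h : ∀ A : DMSpace →L[ℂ] DMSpace, (inner ℂ Ψ' (A Ψ) : ℂ) = c * inner ℂ Ψ₁' (A Ψ₁)) :
    IsMatrixElt ħ σ ψ g α Ψ' Ψ (c * c₁) := by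
  intro ρ hρ
  have he (ε : ℝ) : smearedMatrixElt ħ σ ψ g α ρ Ψ' Ψ ε = fun x =>
      c * smearedMatrixElt ħ σ ψ g α ρ Ψ₁' Ψ₁ ε x := by
    funext x
    rw [smearedMatrixElt, smearedMatrixElt, h]
    ring
  obtain ⟨i₁, t₁⟩ := h₁ ρ hρ
  refine ⟨fun ε hε => by rw [he]; exact (i₁ ε hε).const_mul c, (t₁.const_mul c).congr fun ε => ?_⟩
  rw [he, integral_const_mul]

theorem IsMatrixElt.of_weylVec {Ψ v : DMSpace}
    (h : ∀ f' ξ', IsMatrixElt ħ σ ψ g α (weylVec ħ ψ f' ξ') Ψ (inner ℂ (weylVec ħ ψ f' ξ') v))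
    (Ψ' : weylDomain ħ ψ) : IsMatrixElt ħ σ ψ g α Ψ' Ψ (inner ℂ (Ψ' : DMSpace) v) := by
  obtain ⟨Ψ', hΨ'⟩ := Ψ'
  induction hΨ' using Submodule.span_induction with
  | mem x hx =>
    obtain ⟨f', ξ', rfl⟩ := hx
    exact h f' ξ'
  | zero =>
    have h0 := (h 0 0).of_smul (Ψ' := (0 : DMSpace)) (Ψ := Ψ) 0 fun A => by
      rw [inner_zero_left, zero_mul]
    rwa [zero_mul, ← inner_zero_left (𝕜 := ℂ) v] at h0
  | add x y _ _ hx hy =>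
    have h0 := hx.of_add (Ψ' := x + y) (Ψ := Ψ) hy fun A => inner_add_left _ _ _
    rwa [← inner_add_left] at h0
  | smul c x _ hx =>
    have h0 := hx.of_smul (Ψ' := c • x) (Ψ := Ψ) ((starRingEnd ℂ) c) fun A => inner_smul_left _ _ _
    rwa [← inner_smul_left] at h0

theorem exists_isMatrixElt_weylVec (hħ : 0 ≤ ħ) (hκ : Integrable (cutoffKernel ħ σ g α)) {B : ℝ}
    (hB0 : 0 ≤ B)
    (hB : ∀ δ : ℝ, ∫⁻ z : (Fin n → Minkowski) × (Fin n → Minkowski),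
      ‖cutoffKernel ħ σ g α z.1‖ₑ * ‖cutoffKernel ħ σ g α z.2‖ₑ *
        ENNReal.ofReal (Real.exp (ħ * ∑ i, ∑ j, α i * α j * logReg (2 * δ) (z.1 i - z.2 j))) ≤
      ENNReal.ofReal (B ^ 2)) (f : TestDensity) (ξ : L2) :
    ∃ v : DMSpace, ‖v‖ ≤ B * ‖ξ‖ ∧ ∀ Ψ' : weylDomain ħ ψ,
      IsMatrixElt ħ σ ψ g α Ψ' (weylVec ħ ψ f ξ) (inner ℂ (Ψ' : DMSpace) v) := by
  obtain ⟨v, hv, hw⟩ := exists_vector_of_kernel_bound ψ α hħ σ g hκ hB0 hB f ξ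
  refine ⟨v, hv, IsMatrixElt.of_weylVec fun f' ξ' ρ hρ => ?_⟩
  rw [hw]
  exact tendsto_integral_normalOrderedExp hħ σ ψ g α hκ hρ f' f ξ' ξ

theorem IsTimeOrderedProduct.unique (hħ : 0 < ħ) {T T' : weylDomain ħ ψ →ₗ[ℂ] DMSpace}
    (h : IsTimeOrderedProduct ħ σ ψ g α T) (h' : IsTimeOrderedProduct ħ σ ψ g α T') : T = T' := by
  refine LinearMap.ext fun Ψ => eq_of_forall_inner_weylDomain hħ ψ fun Ψ' => ?_
  -- The density `ψ` itself has integral `1` and serves as mollifier.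
  exact tendsto_nhds_unique (h.2 ψ.1 ψ.2 Ψ Ψ') (h'.2 ψ.1 ψ.2 Ψ Ψ')

theorem exists_timeOrderedProduct (hħ : 0 < ħ) (hκ : Integrable (cutoffKernel ħ σ g α)) {B : ℝ}
    (hB0 : 0 ≤ B)
    (hB : ∀ δ : ℝ, ∫⁻ z : (Fin n → Minkowski) × (Fin n → Minkowski),
      ‖cutoffKernel ħ σ g α z.1‖ₑ * ‖cutoffKernel ħ σ g α z.2‖ₑ *
        ENNReal.ofReal (Real.exp (ħ * ∑ i, ∑ j, α i * α j * logReg (2 * δ) (z.1 i - z.2 j))) ≤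
      ENNReal.ofReal (B ^ 2)) :
    ∃ T : weylDomain ħ ψ →ₗ[ℂ] DMSpace, IsTimeOrderedProduct ħ σ ψ g α T ∧
      ∀ f ξ, ‖T (weylDomainVec ħ ψ f ξ)‖ ≤ B * ‖ξ‖ := by
  let Q (Ψ : weylDomain ħ ψ) (v : DMSpace) : Prop := ∀ Ψ' : weylDomain ħ ψ,
    IsMatrixElt ħ σ ψ g α Ψ' Ψ (inner ℂ (Ψ' : DMSpace) v)
  have hadd (x y : weylDomain ħ ψ) (v w : DMSpace) (hx : Q x v) (hy : Q y w) : Q (x + y) (v + w) := by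
    intro Ψ'
    rw [inner_add_right]
    exact (hx Ψ').of_add (hy Ψ') fun A => by rw [Submodule.coe_add, map_add, inner_add_right]
  have hsmul (c : ℂ) (x : weylDomain ħ ψ) (v : DMSpace) (hx : Q x v) : Q (c • x) (c • v) := by
    intro Ψ'
    rw [inner_smul_right]
    exact (hx Ψ').of_smul c fun A => by rw [Submodule.coe_smul, map_smul, inner_smul_right]
  have hun (x : weylDomain ħ ψ) (v w : DMSpace) (hv : Q x v) (hw : Q x w) : v = w :=
    eq_of_forall_inner_weylDomain hħ ψ fun Ψ' =>
      tendsto_nhds_unique (hv Ψ' ψ.1 ψ.2).2 (hw Ψ' ψ.1 ψ.2).2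
  have hgen := exists_isMatrixElt_weylVec (ψ := ψ) hħ.le hκ hB0 hB
  have hex (x : weylDomain ħ ψ) : ∃ v, Q x v := by
    obtain ⟨x, hx⟩ := x
    induction hx using Submodule.span_induction with
    | mem x hx =>
      obtain ⟨f, ξ, rfl⟩ := hx
      obtain ⟨v, -, hv⟩ := hgen f ξ
      exact ⟨v, hv⟩
    | zero =>
      obtain ⟨v, -, hv⟩ := hgen 0 0
      have h0 := hsmul 0 (weylDomainVec ħ ψ 0 0) v hv
      rw [zero_smul] at h0
      exact ⟨_, h0⟩
    | add x y hx' hy' hx hy =>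
      obtain ⟨v, hv⟩ := hx
      obtain ⟨w, hw⟩ := hy
      exact ⟨v + w, hadd ⟨x, hx'⟩ ⟨y, hy'⟩ v w hv hw⟩
    | smul c x hx' hx =>
      obtain ⟨v, hv⟩ := hx
      exact ⟨c • v, hsmul c ⟨x, hx'⟩ v hv⟩
  obtain ⟨T, hT⟩ := exists_linearMap_of_unique hex hun hadd hsmul
  refine ⟨T, ⟨hκ, fun ρ hρ Ψ Ψ' => (hT Ψ Ψ' ρ hρ).2⟩, fun f ξ => ?_⟩
  obtain ⟨v, hvB, hv⟩ := hgen f ξ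
  rw [hun (weylDomainVec ħ ψ f ξ) _ v (hT _) hv]
  exact hvB

end

theorem signedCharges_eq (a : ℝ) (n k : ℕ) (i : Fin n) :
    signedCharges a n k i = a ∨ signedCharges a n k i = -a := by
  unfold signedCharges
  split_ifs
  · exact Or.inl rfl
  · exact Or.inr rfl

theorem exists_timeOrderedProduct_bound {ħ a p : ℝ} (hħ : 0 < ħ) (ha : 0 < a)
    (huv : ħ * a ^ 2 < 4 * Real.pi) (hp : 1 < p) (hp' : p < 4 * Real.pi / (ħ * a ^ 2)) (g : TestDensity) :
    ∃ C : ℝ, 0 < C ∧ ∀ (σ : ℤˣ) (ψ : UnitDensity) (n : ℕ) (α : Fin n → ℝ), (∀ i, α i = a ∨ α i = -a) →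
      ∃ T : weylDomain ħ ψ →ₗ[ℂ] DMSpace, IsTimeOrderedProduct ħ σ ψ g α T ∧
        ∀ f ξ, ‖T (weylDomainVec ħ ψ f ξ)‖ ≤ C ^ n * (n ! : ℝ) ^ (1 / p) * ‖ξ‖ := by
  obtain ⟨C, hC, h⟩ := exists_lintegral_kernel_le hħ ha hp hp' g
  exact ⟨C, hC, fun σ ψ n α hα => exists_timeOrderedProduct hħ (integrable_kernel hħ ha huv g σ α hα)
    (by positivity) (h σ n α hα)⟩

/-! ### The S-matrix -/

theorem IsSMatrixTerm.unique {ħ a : ℝ} (hħ : 0 < ħ) {σ : ℤˣ} {ψ : UnitDensity} {g : TestDensity} {n : ℕ}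
    {S S' : weylDomain ħ ψ →ₗ[ℂ] DMSpace} (h : IsSMatrixTerm ħ a σ ψ g n S)
    (h' : IsSMatrixTerm ħ a σ ψ g n S') : S = S' := by
  obtain ⟨T, hT, rfl⟩ := h
  obtain ⟨T', hT', rfl⟩ := h'
  congr 1
  refine Finset.sum_congr rfl fun k hk => ?_
  have hk' : k ≤ n := Nat.lt_succ_iff.1 (Finset.mem_range.1 hk)
  rw [(hT k hk').unique hħ (hT' k hk')]

theorem exists_sMatrixTerm_bound {ħ a p : ℝ} (hħ : 0 < ħ) (ha : 0 < a)
    (huv : ħ * a ^ 2 < 4 * Real.pi) (hp : 1 < p) (hp' : p < 4 * Real.pi / (ħ * a ^ 2)) (g : TestDensity) :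
    ∃ C : ℝ, 0 < C ∧ ∀ (σ : ℤˣ) (ψ : UnitDensity) (n : ℕ),
      ∃ S : weylDomain ħ ψ →ₗ[ℂ] DMSpace, IsSMatrixTerm ħ a σ ψ g n S ∧
        ∀ f ξ, ‖S (weylDomainVec ħ ψ f ξ)‖ ≤ C ^ n * (n ! : ℝ) ^ ((1 - p) / p) * ‖ξ‖ := by
  obtain ⟨C, hC, h⟩ := exists_timeOrderedProduct_bound hħ ha huv hp hp' g
  -- The binomial coefficients sum to `2 ^ n`, cancelling `(1/2) ^ n`. The prefactor `(i/ħ) ^ n`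
  -- turns `C` into `C / ħ`, and `1/n!` lowers the exponent `1/p` by one.
  refine ⟨C / ħ, by positivity, fun σ ψ n => ?_⟩
  choose T hT hTB using fun k : ℕ => h σ ψ n (signedCharges a n k) (signedCharges_eq a n k)
  refine ⟨_, ⟨T, fun k _ => hT k, rfl⟩, fun f ξ => ?_⟩
  have hn : (0 : ℝ) < n ! := by positivity
  set Φ := weylDomainVec ħ ψ f ξ
  have hsum : ‖∑ k ∈ Finset.range (n + 1), (n.choose k : ℂ) • T k Φ‖ ≤
      2 ^ n * (C ^ n * (n ! : ℝ) ^ (1 / p) * ‖ξ‖) := by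
    have h2 : ((2 : ℝ) ^ n) = ∑ k ∈ Finset.range (n + 1), (n.choose k : ℝ) := by
      exact_mod_cast (Nat.sum_range_choose n).symm
    rw [h2, Finset.sum_mul]
    refine norm_sum_le_of_le _ fun k _ => ?_
    rw [norm_smul, Complex.norm_natCast]
    exact mul_le_mul_of_nonneg_left (hTB k f ξ) (Nat.cast_nonneg _)
  have hpow : (n ! : ℝ) ^ ((1 - p) / p) = (n ! : ℝ) ^ (1 / p) / n ! := by
    rw [show (1 - p) / p = 1 / p - 1 by field_simp, Real.rpow_sub_one hn.ne']
  rw [LinearMap.smul_apply, LinearMap.sum_apply, norm_smul, norm_mul, norm_mul, norm_pow, norm_pow, norm_div,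
    norm_div, norm_div, norm_one, Complex.norm_natCast, Complex.norm_I, Complex.norm_real,
    Real.norm_of_nonneg hħ.le, Complex.norm_ofNat, hpow]
  refine (mul_le_mul_of_nonneg_left hsum (by positivity)).trans (le_of_eq ?_)
  rw [div_pow, div_pow, div_pow, one_pow]
  field_simp

theorem summable_pow_mul_factorial_rpow {r s : ℝ} (hr : 0 < r) (hs : 0 < s) :
    Summable fun n : ℕ => r ^ n * (n ! : ℝ) ^ (-s) := by
  have hpos (n : ℕ) : (0 : ℝ) < r ^ n * (n ! : ℝ) ^ (-s) := by positivity
  refine summable_of_ratio_test_tendsto_lt_one (l := 0) one_pos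
    (Eventually.of_forall fun n => (hpos n).ne') ?_
  have h1 (n : ℕ) : ‖r ^ (n + 1) * ((n + 1)! : ℝ) ^ (-s)‖ / ‖r ^ n * (n ! : ℝ) ^ (-s)‖ =
      r * ((n + 1 : ℕ) : ℝ) ^ (-s) := by
    rw [Real.norm_of_nonneg (hpos _).le, Real.norm_of_nonneg (hpos _).le, div_eq_iff (hpos n).ne',
      Nat.factorial_succ, Nat.cast_mul, Real.mul_rpow (by positivity) (by positivity)]
    ring
  simp only [h1]
  have h2 : Tendsto (fun n : ℕ => ((n + 1 : ℕ) : ℝ) ^ (-s)) atTop (𝓝 0) :=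
    (tendsto_rpow_neg_atTop hs).comp
      (tendsto_natCast_atTop_atTop.comp (tendsto_add_atTop_nat 1))
  simpa using h2.const_mul r

theorem summable_sMatrix {ħ : ℝ} {ψ : UnitDensity} {S : ℕ → (weylDomain ħ ψ →ₗ[ℂ] DMSpace)} {C s : ℝ}
    (hC : 0 < C) (hs : 0 < s)
    (hS : ∀ n f ξ, ‖S n (weylDomainVec ħ ψ f ξ)‖ ≤ C ^ n * (n ! : ℝ) ^ (-s) * ‖ξ‖) (z : ℂ)
    (Ψ : weylDomain ħ ψ) : Summable fun n => z ^ n • S n Ψ := by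
  obtain ⟨Ψ, hΨ⟩ := Ψ
  induction hΨ using Submodule.span_induction with
  | mem x hx =>
    obtain ⟨f, ξ, rfl⟩ := hx
    -- The base `‖z‖ + 1` instead of `‖z‖` keeps the ratio test valid at `z = 0`.
    have h := (summable_pow_mul_factorial_rpow (r := (‖z‖ + 1) * C) (by positivity) hs).mul_right ‖ξ‖
    refine Summable.of_norm_bounded h fun n => ?_
    rw [norm_smul, norm_pow, mul_pow, mul_assoc, mul_assoc]
    refine mul_le_mul (pow_le_pow_left₀ (norm_nonneg _) (by linarith) _) ?_ (norm_nonneg _)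
      (by positivity)
    rw [← mul_assoc]
    exact hS n f ξ
  | zero =>
    have h0 (n : ℕ) : z ^ n • S n ⟨0, Submodule.zero_mem _⟩ = 0 := by
      rw [show (⟨0, Submodule.zero_mem _⟩ : weylDomain ħ ψ) = 0 from rfl, map_zero, smul_zero]
    exact summable_zero.congr fun n => (h0 n).symm
  | add x y hx' hy' hx hy =>
    refine (hx.add hy).congr fun n => ?_
    rw [← smul_add, ← map_add]
    rfl
  | smul c x hx' hx =>
    refine (hx.const_smul c).congr fun n => ?_
    rw [smul_comm, ← map_smul]
    rfl

end SineGordon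

end

theorem mainTheorem1 (ħ a : ℝ) (hħ : 0 < ħ) (ha : 0 < a) (huv : ħ * a ^ 2 < 4 * Real.pi)
    (σ : ℤˣ) (g : TestDensity) :
    (∀ ψ : UnitDensity,
      Dense (weylDomain ħ ψ : Set DMSpace) ∧
      ∃! S : ℕ → (weylDomain ħ ψ →ₗ[ℂ] DMSpace), ∀ n, IsSMatrixTerm ħ a σ ψ g n (S n)) ∧
    (∀ p : ℝ, 1 < p → p < 4 * Real.pi / (ħ * a ^ 2) →
      ∃ C : ℝ, 0 < C ∧ ∀ (ψ : UnitDensity) (S : ℕ → (weylDomain ħ ψ →ₗ[ℂ] DMSpace)),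
        (∀ n, IsSMatrixTerm ħ a σ ψ g n (S n)) →
        ∀ (n : ℕ) (f : TestDensity) (ξ : L2), ‖ξ‖ = 1 →
          ‖S n (weylDomainVec ħ ψ f ξ)‖ ≤ C ^ n * (Nat.factorial n : ℝ) ^ ((1 - p) / p)) ∧
    (∀ (ψ : UnitDensity) (S : ℕ → (weylDomain ħ ψ →ₗ[ℂ] DMSpace)),
      (∀ n, IsSMatrixTerm ħ a σ ψ g n (S n)) →
      ∀ z : ℂ, ∃ Sz : weylDomain ħ ψ →ₗ[ℂ] DMSpace, ∀ Ψ : weylDomain ħ ψ,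
        HasSum (fun n => z ^ n • S n Ψ) (Sz Ψ)) := by
  have hpi := Real.pi_pos
  have hden : 0 < ħ * a ^ 2 := by positivity
  have hcrit : 1 < 4 * Real.pi / (ħ * a ^ 2) := by rwa [lt_div_iff₀ hden, one_mul]
  -- Existence and convergence do not mention an exponent; any `p₀` in the nonempty admissible
  -- interval serves.
  obtain ⟨p₀, hp₀, hp₀'⟩ := exists_between hcrit
  obtain ⟨C₀, hC₀, h₀⟩ := exists_sMatrixTerm_bound hħ ha huv hp₀ hp₀' g
  refine ⟨fun ψ => ⟨dense_weylDomain hħ ψ, ?_⟩, fun p hp hp' => ?_, fun ψ S hS z => ?_⟩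
  · choose S hS hSB using h₀ σ ψ
    exact ⟨S, hS, fun S' hS' => funext fun n => (hS' n).unique hħ (hS n)⟩
  · obtain ⟨C, hC, h⟩ := exists_sMatrixTerm_bound hħ ha huv hp hp' g
    refine ⟨C, hC, fun ψ S hS n f ξ hξ => ?_⟩
    -- The bound is known for the constructed term; uniqueness transfers it to an arbitrary one.
    obtain ⟨S', hS', hB⟩ := h σ ψ n
    have h1 := hB f ξ
    rwa [hS'.unique hħ (hS n), hξ, mul_one] at h1
  · have hbound (n : ℕ) (f : TestDensity) (ξ : L2) : ‖S n (weylDomainVec ħ ψ f ξ)‖ ≤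
        C₀ ^ n * (Nat.factorial n : ℝ) ^ (-((p₀ - 1) / p₀)) * ‖ξ‖ := by
      obtain ⟨S', hS', hB⟩ := h₀ σ ψ n
      rw [← neg_div, neg_sub, ← hS'.unique hħ (hS n)]
      exact hB f ξ
    have hsum := summable_sMatrix hC₀ (div_pos (sub_pos.2 hp₀) (by linarith)) hbound z
    refine ⟨{ toFun := fun Ψ => ∑' n, z ^ n • S n Ψ
              map_add' := fun x y => ?_
              map_smul' := fun c x => ?_ }, fun Ψ => (hsum Ψ).hasSum⟩
    · rw [← (hsum x).tsum_add (hsum y)]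
      exact tsum_congr fun n => by rw [map_add, smul_add]
    · rw [RingHom.id_apply, ← (hsum x).tsum_const_smul c]
      exact tsum_congr fun n => by rw [map_smul, smul_comm]
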